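/- **Definitions.** All multicategories are plain (non-symmetric) with object sets and hom-sets in two fixed universes. *Multicategories.* A multicategory $\mathbb C$ has objects, sets $\mathbb C_n(a_1,\dots,a_n;b)$ of multimaps for all $n\ge 0$, identities $1_a\in\mathbb C_1(a;a)$, and substitutions $g\circ_i f$ (of $f$ in the $i$-th variable of $g$) which are unital, associative, and commute in different variables. Morphisms preserve identities and substitution. $\mathbf{Multi}$ is the category of multicategories. A multimap $\theta:\bar a\to m$ is *left universal* if $-\circ_1\theta:\mathbb C(m,\bar y;z)\to\mathbb C(\bar a,\bar y;z)$ is a bijection for all $\bar y,z$, and *universal* if $-\circ_{|\bar x|+1}\theta:\mathbb C(\bar x,m,\bar y;z)\to\mathbb C(\bar x,\bar a,\bar y;z)$ is a bijection for all $\bar x,\bar y,z$. $\mathbb C$ is *left representable* (resp. *representable*) if every list $\bar a$, the empty one included, is the source of a left universal (resp. universal) multimap. $\mathbb C$ is *closed* if for all $b,c$ there are an object $[b,c]$ and $e\in\mathbb C_2([b,c],b;c)$ such that $e\circ_1-:\mathbb C_n(\bar x;[b,c])\to\mathbb C_{n+1}(\bar x,b;c)$ is a bijection for all $\bar x$ of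 any length $n\ge0$. *Short multicategories.* A short multicategory is a category $\mathcal C$ with functors $\mathbb C_n(-;-):(\mathcal C^n)^{op}\times\mathcal C\to\mathbf{Set}$ for $0\le n\le4$, with $\mathbb C_1=\mathcal C(-,-)$, and substitutions $g\circ_i f$ of binary $f$ into binary or ternary $g$, of ternary $f$ into binary $g$, and of nullary $f$ into binary or ternary $g$, in every position $i$. These are natural in all the variables, and dinatural in the variable substituted. They satisfy $$f\circ_i(g\circ_j h)=(f\circ_i g)\circ_{i+j-1}h$$ for $f,g$ binary and $h$ binary or nullary, and $$(f\circ_1 g)\circ_{n+1}h=(f\circ_2 h)\circ_1 g$$ for $f$ binary, $g$ $n$-ary, $h$ $p$-ary, $n,p\in\{0,2\}$, where $-\circ_i-$ with a unary map is the functorial action. A morphism is a functor $F$ with natural families $\mathbb C_n(\bar a;b)\to\mathbb D_n(F\bar a;Fb)$ ($0\le n\le4$; for $n=1$ the action of $F$) that preserve all these substitutions. $\mathbf{FMulti}$ is the category of short multicategories. $U:\mathbf{Multi}\to\mathbf{FMulti}$ forgets the multimaps of arity greater than $4$. A short multicategory is *left representable* if there are an object $i$ with $u\in\mathbb C_0(;i)$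 and, for all $a,b$, an object $ab$ with $\theta_{a,b}\in\mathbb C_2(a,b;ab)$, such that $$-\circ_1u:\mathbb C_n(i,\bar y;z)\to\mathbb C_{n-1}(\bar y;z),\qquad -\circ_1\theta_{a,b}:\mathbb C_n(ab,\bar y;z)\to\mathbb C_{n+1}(a,b,\bar y;z)$$ are bijections for $1\le n\le3$ (such $u$, $\theta_{a,b}$ are called left universal classifiers); it is *representable* if $u$ and $\theta_{a,b}$ can be found such that the analogous maps $-\circ_ju:\mathbb C_n(\bar x,i,\bar y;z)\to\mathbb C_{n-1}(\bar x,\bar y;z)$ and $-\circ_j\theta_{a,b}:\mathbb C_n(\bar x,ab,\bar y;z)\to\mathbb C_{n+1}(\bar x,a,b,\bar y;z)$, with $j=|\bar x|+1$, are bijections for $1\le n\le3$ and every position $j$. It is *closed* if for all $b,c$ there are $[b,c]$ and $e\in\mathbb C_2([b,c],b;c)$ such that $e\circ_1-:\mathbb C_n(\bar x;[b,c])\to\mathbb C_{n+1}(\bar x,b;c)$ is a bijection for $n=0,1,2,3$. *Skew monoidal categories.* A (left) skew monoidal category is a category with a functor $\otimes$, an object $i$ and natural maps $\alpha:(ab)c\to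 a(bc)$, $\lambda:ia\to a$, $\rho:a\to ai$, not necessarily invertible, satisfying the five (Mac Lane type) skew monoidal axioms; morphisms are lax monoidal functors $(F,f_0:i\to Fi,f_2:Fa\otimes Fb\to F(a\otimes b))$. It is *left normal* if $\lambda$ is invertible, *monoidal* if $\alpha,\lambda,\rho$ are all invertible, and *closed* if each $-\otimes b$ has a right adjoint. $\mathbf{Multi}_{lr}$, $\mathbf{FMulti}_{lr}$ (left representable), $\mathbf{Multi}_{rep}^{cl}$, $\mathbf{FMulti}_{rep}^{cl}$ (representable and closed), and $\mathbf{SkMon}_{ln}$ (left normal skew monoidal), $\mathbf{Mon}^{cl}$ (closed monoidal) denote the corresponding full subcategories. *The functors $K$ and $T$.* Choose left universal classifiers $u$, $\theta_{a,b}$ for every left representable short multicategory. $K:\mathbf{FMulti}_{lr}\to\mathbf{SkMon}_{ln}$ sends $\mathbb C$ to $\mathcal C$ with unit $i$, tensor $a\otimes b=ab$, and structure maps determined by $$(f\otimes g)\circ\theta_{a,b}=(\theta_{a',b'}\circ_1 f)\circ_2 g\quad(f:a\to a',\ g:b\to b'),$$ $$\alpha\circ(\theta_{ab,c}\circ_1\theta_{a,b})=\theta_{a,bc}\circ_2\theta_{b,c},\qquad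 \lambda\circ(\theta_{i,a}\circ_1u)=1_a,\qquad \rho=\theta_{a,i}\circ_2u,$$ and sends a morphism $F$ to its underlying functor with $f_0\circ u=Fu$ and $f_2\circ\theta_{Fa,Fb}=F\theta_{a,b}$. Likewise, choose a left universal multimap out of every list of objects in every left representable multicategory; $T:\mathbf{Multi}_{lr}\to\mathbf{SkMon}_{ln}$ is defined by the same formulas from the multimaps chosen for the lists of length $0$ and $2$. **Theorem.** For all such choices, $K:\mathbf{FMulti}_{lr}\to\mathbf{SkMon}_{ln}$ is an equivalence of categories. It restricts to an equivalence $K_{rep}^{cl}:\mathbf{FMulti}_{rep}^{cl}\to\mathbf{Mon}^{cl}$ between representable closed short multicategories and closed monoidal categories. The functors $U$ and $T$ also restrict to equivalences $U_{rep}^{cl}:\mathbf{Multi}_{rep}^{cl}\to\mathbf{FMulti}_{rep}^{cl}$ and $T_{rep}^{cl}:\mathbf{Multi}_{rep}^{cl}\to\mathbf{Mon}^{cl}$, and the triangle commutes: $$K_{rep}^{cl}\circ U_{rep}^{cl}\cong T_{rep}^{cl},$$ by a natural isomorphism whose components have identity underlying functors; and $K_{rep}^{cl}\circ U_{rep}^{cl}=T_{rep}^{cl}$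 strictly whenever, for every representable closed multicategory $\mathbb C$, the classifiers chosen for $U\mathbb C$ are the multimaps chosen for $\mathbb C$. -/

import Mathlib

open CategoryTheory

universe v u

/-! ## Skew monoidal categories -/

/-- A (left) skew monoidal category: the structure maps need not be invertible. -/
structure SkewMonCat where
  Obj : Type u
  [cat : Category.{v} Obj]
  tensor : Obj → Obj → Obj
  tensorHom : ∀ {a a' b b' : Obj}, (a ⟶ a') → (b ⟶ b') → (tensor a b ⟶ tensor a' b')
  tensorHom_id : ∀ a b : Obj, tensorHom (𝟙 a) (𝟙 b) = 𝟙 (tensor a b)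
  tensorHom_comp : ∀ {a a' a'' b b' b'' : Obj} (f : a ⟶ a') (f' : a' ⟶ a'')
    (g : b ⟶ b') (g' : b' ⟶ b''),
    tensorHom (f ≫ f') (g ≫ g') = tensorHom f g ≫ tensorHom f' g'
  unit : Obj
  α : ∀ a b c : Obj, tensor (tensor a b) c ⟶ tensor a (tensor b c)
  lam : ∀ a : Obj, tensor unit a ⟶ a
  rho : ∀ a : Obj, a ⟶ tensor a unit
  α_naturality : ∀ {a a' b b' c c' : Obj} (f : a ⟶ a') (g : b ⟶ b') (h : c ⟶ c'),
    tensorHom (tensorHom f g) h ≫ α a' b' c' = α a b c ≫ tensorHom f (tensorHom g h)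
  lam_naturality : ∀ {a a' : Obj} (f : a ⟶ a'), tensorHom (𝟙 unit) f ≫ lam a' = lam a ≫ f
  rho_naturality : ∀ {a a' : Obj} (f : a ⟶ a'), f ≫ rho a' = rho a ≫ tensorHom f (𝟙 unit)
  pentagon : ∀ a b c d : Obj,
    tensorHom (α a b c) (𝟙 d) ≫ α a (tensor b c) d ≫ tensorHom (𝟙 a) (α b c d)
      = α (tensor a b) c d ≫ α a b (tensor c d)
  α_lam : ∀ a b : Obj, α unit a b ≫ lam (tensor a b) = tensorHom (lam a) (𝟙 b)
  rho_α : ∀ a b : Obj, rho (tensor a b) ≫ α a b unit = tensorHom (𝟙 a) (rho b)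
  rho_α_lam : ∀ a b : Obj,
    tensorHom (rho a) (𝟙 b) ≫ α a unit b ≫ tensorHom (𝟙 a) (lam b) = 𝟙 (tensor a b)
  rho_lam : rho unit ≫ lam unit = 𝟙 unit

attribute [instance] SkewMonCat.cat

namespace SkewMonCat

/-- The functor `- ⊗ b`. -/
def tensorRight (C : SkewMonCat.{v, u}) (b : C.Obj) : C.Obj ⥤ C.Obj where
  obj a := C.tensor a b
  map f := C.tensorHom f (𝟙 b)
  map_id a := C.tensorHom_id a b
  map_comp f g := by rw [← C.tensorHom_comp, Category.comp_id]

/-- A lax monoidal functor between skew monoidal categories. -/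
@[ext]
structure LaxFunctor (C D : SkewMonCat.{v, u}) where
  functor : C.Obj ⥤ D.Obj
  f₀ : D.unit ⟶ functor.obj C.unit
  f₂ : ∀ a b : C.Obj, D.tensor (functor.obj a) (functor.obj b) ⟶ functor.obj (C.tensor a b)
  f₂_naturality : ∀ {a a' b b' : C.Obj} (p : a ⟶ a') (q : b ⟶ b'),
    D.tensorHom (functor.map p) (functor.map q) ≫ f₂ a' b'
      = f₂ a b ≫ functor.map (C.tensorHom p q)
  associativity : ∀ a b c : C.Obj,
    D.tensorHom (f₂ a b) (𝟙 (functor.obj c)) ≫ f₂ (C.tensor a b) c ≫ functor.map (C.α a b c)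
      = D.α (functor.obj a) (functor.obj b) (functor.obj c)
        ≫ D.tensorHom (𝟙 (functor.obj a)) (f₂ b c) ≫ f₂ a (C.tensor b c)
  left_unitality : ∀ a : C.Obj,
    D.tensorHom f₀ (𝟙 (functor.obj a)) ≫ f₂ C.unit a ≫ functor.map (C.lam a)
      = D.lam (functor.obj a)
  right_unitality : ∀ a : C.Obj,
    D.rho (functor.obj a) ≫ D.tensorHom (𝟙 (functor.obj a)) f₀ ≫ f₂ a C.unit
      = functor.map (C.rho a)

/-- Skew monoidal categories and lax monoidal functors form a category. -/
instance : Category SkewMonCat.{v, u} where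
  Hom C D := LaxFunctor C D
  id C :=
    { functor := 𝟭 C.Obj
      f₀ := 𝟙 _
      f₂ := fun _ _ => 𝟙 _
      f₂_naturality := by intros; simp
      associativity := by intros; simp [C.tensorHom_id]
      left_unitality := by intros; simp [C.tensorHom_id]
      right_unitality := by intros; simp [C.tensorHom_id] }
  comp {C D E} F G :=
    { functor := F.functor ⋙ G.functor
      f₀ := G.f₀ ≫ G.functor.map F.f₀
      f₂ := fun a b => G.f₂ _ _ ≫ G.functor.map (F.f₂ a b)
      f₂_naturality := by
        intro a a' b b' p q
        simp only [Functor.comp_obj, Functor.comp_map]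
        rw [← Category.assoc, G.f₂_naturality, Category.assoc, ← G.functor.map_comp,
          F.f₂_naturality, G.functor.map_comp, Category.assoc]
      associativity := by
        intro a b c
        simp only [Functor.comp_obj, Functor.comp_map]
        have h1 : E.tensorHom (G.f₂ (F.functor.obj a) (F.functor.obj b)
              ≫ G.functor.map (F.f₂ a b)) (𝟙 (G.functor.obj (F.functor.obj c)))
            = E.tensorHom (G.f₂ (F.functor.obj a) (F.functor.obj b)) (𝟙 _)
              ≫ E.tensorHom (G.functor.map (F.f₂ a b)) (G.functor.map (𝟙 _)) := by
          rw [← E.tensorHom_comp, G.functor.map_id, Category.comp_id]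
        have h2 : E.tensorHom (𝟙 (G.functor.obj (F.functor.obj a)))
              (G.f₂ (F.functor.obj b) (F.functor.obj c) ≫ G.functor.map (F.f₂ b c))
            = E.tensorHom (𝟙 _) (G.f₂ (F.functor.obj b) (F.functor.obj c))
              ≫ E.tensorHom (G.functor.map (𝟙 _)) (G.functor.map (F.f₂ b c)) := by
          rw [← E.tensorHom_comp, G.functor.map_id, Category.comp_id]
        rw [h1, h2]
        simp only [Category.assoc]
        rw [← Category.assoc (E.tensorHom (G.functor.map (F.f₂ a b)) _), G.f₂_naturality,
          ← Category.assoc (E.tensorHom (G.functor.map (𝟙 _)) (G.functor.map (F.f₂ b c))),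
          G.f₂_naturality]
        simp only [Category.assoc, ← G.functor.map_comp]
        rw [F.associativity]
        simp only [G.functor.map_comp]
        have h3 := G.associativity (F.functor.obj a) (F.functor.obj b) (F.functor.obj c)
        have h4 := congrArg (fun k => k ≫ G.functor.map (D.tensorHom (𝟙 _) (F.f₂ b c))
          ≫ G.functor.map (F.f₂ a (C.tensor b c))) h3
        simpa only [Category.assoc] using h4
      left_unitality := by
        intro a
        simp only [Functor.comp_obj, Functor.comp_map]
        have h1 : E.tensorHom (G.f₀ ≫ G.functor.map F.f₀)
              (𝟙 (G.functor.obj (F.functor.obj a)))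
            = E.tensorHom G.f₀ (𝟙 _)
              ≫ E.tensorHom (G.functor.map F.f₀) (G.functor.map (𝟙 _)) := by
          rw [← E.tensorHom_comp, G.functor.map_id, Category.comp_id]
        rw [h1]
        simp only [Category.assoc]
        rw [← Category.assoc (E.tensorHom (G.functor.map F.f₀) _), G.f₂_naturality]
        simp only [Category.assoc, ← G.functor.map_comp]
        rw [F.left_unitality, G.left_unitality]
      right_unitality := by
        intro a
        simp only [Functor.comp_obj, Functor.comp_map]
        have h1 : E.tensorHom (𝟙 (G.functor.obj (F.functor.obj a)))
              (G.f₀ ≫ G.functor.map F.f₀)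
            = E.tensorHom (𝟙 _) G.f₀
              ≫ E.tensorHom (G.functor.map (𝟙 _)) (G.functor.map F.f₀) := by
          rw [← E.tensorHom_comp, G.functor.map_id, Category.comp_id]
        rw [h1]
        simp only [Category.assoc]
        rw [← Category.assoc (E.tensorHom (G.functor.map (𝟙 _)) _), G.f₂_naturality,
          ← F.right_unitality]
        simp only [G.functor.map_comp]
        rw [← G.right_unitality]
        simp only [Category.assoc] }
  id_comp F := by
    refine LaxFunctor.ext rfl (heq_of_eq ?_) (heq_of_eq ?_)
    · change F.f₀ ≫ F.functor.map (𝟙 _) = F.f₀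
      simp
    · funext a b
      change F.f₂ a b ≫ F.functor.map (𝟙 _) = F.f₂ a b
      simp
  comp_id F := by
    refine LaxFunctor.ext rfl (heq_of_eq ?_) (heq_of_eq ?_)
    · exact Category.id_comp _
    · funext a b
      exact Category.id_comp _
  assoc F G H := by
    refine LaxFunctor.ext rfl (heq_of_eq ?_) (heq_of_eq ?_)
    · change H.f₀ ≫ H.functor.map (G.f₀ ≫ G.functor.map F.f₀)
        = (H.f₀ ≫ H.functor.map G.f₀) ≫ H.functor.map (G.functor.map F.f₀)
      simp
    · funext a b
      change H.f₂ _ _ ≫ H.functor.map (G.f₂ _ _ ≫ G.functor.map (F.f₂ a b))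
        = (H.f₂ _ _ ≫ H.functor.map (G.f₂ _ _)) ≫ H.functor.map (G.functor.map (F.f₂ a b))
      simp

/-- Left normal: the left unit map is invertible. -/
def isLeftNormal : ObjectProperty SkewMonCat.{v, u} := fun C => ∀ a, IsIso (C.lam a)

/-- A monoidal category is a skew monoidal category with invertible structure maps. -/
def isMonoidal : ObjectProperty SkewMonCat.{v, u} := fun C =>
  (∀ a b c, IsIso (C.α a b c)) ∧ (∀ a, IsIso (C.lam a)) ∧ (∀ a, IsIso (C.rho a))

/-- (Left) closed: every `- ⊗ b` has a right adjoint. -/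
def isClosed : ObjectProperty SkewMonCat.{v, u} := fun C =>
  ∀ b, (C.tensorRight b).IsLeftAdjoint

/-- Closed monoidal categories. -/
def isClosedMonoidal : ObjectProperty SkewMonCat.{v, u} := isMonoidal ⊓ isClosed

theorem isClosedMonoidal_le : isClosedMonoidal.{v, u} ≤ isLeftNormal := fun _ h => h.1.2.1

end SkewMonCat

/-! ## Short multicategories -/

/-- A short multicategory. `M₀ b`, `M₂ a b c`, `M₃ a b c d`, `M₄ a b c d e` are the sets of multimaps
of arity `0, 2, 3, 4` (the last argument is the codomain); unary multimaps are the morphisms of the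
category. `mapₙ` is the action on morphisms of the functor `(Objⁿ)ᵒᵖ × Obj ⥤ Type`.
`subₙₘ_i g f` is the substitution of the `m`-ary multimap `f` in the `i`-th variable of the
`n`-ary multimap `g`. -/
structure ShortMulticat where
  Obj : Type u
  [cat : Category.{v} Obj]
  M₀ : Obj → Type v
  M₂ : Obj → Obj → Obj → Type v
  M₃ : Obj → Obj → Obj → Obj → Type v
  M₄ : Obj → Obj → Obj → Obj → Obj → Type v
  -- functoriality of the multimaps
  map₀ : ∀ {z z' : Obj}, (z ⟶ z') → M₀ z → M₀ z'
  map₂ : ∀ {a a' b b' z z' : Obj}, (a' ⟶ a) → (b' ⟶ b) → (z ⟶ z') → M₂ a b z → M₂ a' b' z'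
  map₃ : ∀ {a a' b b' c c' z z' : Obj}, (a' ⟶ a) → (b' ⟶ b) → (c' ⟶ c) → (z ⟶ z') →
    M₃ a b c z → M₃ a' b' c' z'
  map₄ : ∀ {a a' b b' c c' d d' z z' : Obj}, (a' ⟶ a) → (b' ⟶ b) → (c' ⟶ c) → (d' ⟶ d) →
    (z ⟶ z') → M₄ a b c d z → M₄ a' b' c' d' z'
  map₀_id : ∀ {z : Obj} (f : M₀ z), map₀ (𝟙 z) f = f
  map₂_id : ∀ {a b z : Obj} (f : M₂ a b z), map₂ (𝟙 a) (𝟙 b) (𝟙 z) f = f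
  map₃_id : ∀ {a b c z : Obj} (f : M₃ a b c z), map₃ (𝟙 a) (𝟙 b) (𝟙 c) (𝟙 z) f = f
  map₄_id : ∀ {a b c d z : Obj} (f : M₄ a b c d z), map₄ (𝟙 a) (𝟙 b) (𝟙 c) (𝟙 d) (𝟙 z) f = f
  map₀_comp : ∀ {z z' z'' : Obj} (s : z ⟶ z') (s' : z' ⟶ z'') (f : M₀ z),
    map₀ s' (map₀ s f) = map₀ (s ≫ s') f
  map₂_comp : ∀ {a a' a'' b b' b'' z z' z'' : Obj} (p : a' ⟶ a) (p' : a'' ⟶ a')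
    (q : b' ⟶ b) (q' : b'' ⟶ b') (s : z ⟶ z') (s' : z' ⟶ z'') (f : M₂ a b z),
    map₂ p' q' s' (map₂ p q s f) = map₂ (p' ≫ p) (q' ≫ q) (s ≫ s') f
  map₃_comp : ∀ {a a' a'' b b' b'' c c' c'' z z' z'' : Obj} (p : a' ⟶ a) (p' : a'' ⟶ a')
    (q : b' ⟶ b) (q' : b'' ⟶ b') (r : c' ⟶ c) (r' : c'' ⟶ c') (s : z ⟶ z') (s' : z' ⟶ z'')
    (f : M₃ a b c z),
    map₃ p' q' r' s' (map₃ p q r s f) = map₃ (p' ≫ p) (q' ≫ q) (r' ≫ r) (s ≫ s') f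
  map₄_comp : ∀ {a a' a'' b b' b'' c c' c'' d d' d'' z z' z'' : Obj} (p : a' ⟶ a) (p' : a'' ⟶ a')
    (q : b' ⟶ b) (q' : b'' ⟶ b') (r : c' ⟶ c) (r' : c'' ⟶ c') (t : d' ⟶ d) (t' : d'' ⟶ d')
    (s : z ⟶ z') (s' : z' ⟶ z'') (f : M₄ a b c d z),
    map₄ p' q' r' t' s' (map₄ p q r t s f)
      = map₄ (p' ≫ p) (q' ≫ q) (r' ≫ r) (t' ≫ t) (s ≫ s') f
  -- binary into binary
  sub₂₂_1 : ∀ {x y z a b : Obj}, M₂ x y z → M₂ a b x → M₃ a b y z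
  sub₂₂_2 : ∀ {x y z a b : Obj}, M₂ x y z → M₂ a b y → M₃ x a b z
  -- binary into ternary
  sub₃₂_1 : ∀ {x y w z a b : Obj}, M₃ x y w z → M₂ a b x → M₄ a b y w z
  sub₃₂_2 : ∀ {x y w z a b : Obj}, M₃ x y w z → M₂ a b y → M₄ x a b w z
  sub₃₂_3 : ∀ {x y w z a b : Obj}, M₃ x y w z → M₂ a b w → M₄ x y a b z
  -- ternary into binary
  sub₂₃_1 : ∀ {x y z a b c : Obj}, M₂ x y z → M₃ a b c x → M₄ a b c y z
  sub₂₃_2 : ∀ {x y z a b c : Obj}, M₂ x y z → M₃ a b c y → M₄ x a b c z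
  -- nullary into binary
  sub₂₀_1 : ∀ {x y z : Obj}, M₂ x y z → M₀ x → (y ⟶ z)
  sub₂₀_2 : ∀ {x y z : Obj}, M₂ x y z → M₀ y → (x ⟶ z)
  -- nullary into ternary
  sub₃₀_1 : ∀ {x y w z : Obj}, M₃ x y w z → M₀ x → M₂ y w z
  sub₃₀_2 : ∀ {x y w z : Obj}, M₃ x y w z → M₀ y → M₂ x w z
  sub₃₀_3 : ∀ {x y w z : Obj}, M₃ x y w z → M₀ w → M₂ x y z
  -- naturality of the substitutions in all variables but the one substituted
  sub₂₂_1_nat : ∀ {x y y' z z' a a' b b' : Obj} (p : a' ⟶ a) (q : b' ⟶ b) (r : y' ⟶ y)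
    (s : z ⟶ z') (g : M₂ x y z) (f : M₂ a b x),
    map₃ p q r s (sub₂₂_1 g f) = sub₂₂_1 (map₂ (𝟙 x) r s g) (map₂ p q (𝟙 x) f)
  sub₂₂_2_nat : ∀ {x x' y z z' a a' b b' : Obj} (r : x' ⟶ x) (p : a' ⟶ a) (q : b' ⟶ b)
    (s : z ⟶ z') (g : M₂ x y z) (f : M₂ a b y),
    map₃ r p q s (sub₂₂_2 g f) = sub₂₂_2 (map₂ r (𝟙 y) s g) (map₂ p q (𝟙 y) f)
  sub₃₂_1_nat : ∀ {x y y' w w' z z' a a' b b' : Obj} (p : a' ⟶ a) (q : b' ⟶ b) (r : y' ⟶ y)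
    (t : w' ⟶ w) (s : z ⟶ z') (g : M₃ x y w z) (f : M₂ a b x),
    map₄ p q r t s (sub₃₂_1 g f) = sub₃₂_1 (map₃ (𝟙 x) r t s g) (map₂ p q (𝟙 x) f)
  sub₃₂_2_nat : ∀ {x x' y w w' z z' a a' b b' : Obj} (r : x' ⟶ x) (p : a' ⟶ a) (q : b' ⟶ b)
    (t : w' ⟶ w) (s : z ⟶ z') (g : M₃ x y w z) (f : M₂ a b y),
    map₄ r p q t s (sub₃₂_2 g f) = sub₃₂_2 (map₃ r (𝟙 y) t s g) (map₂ p q (𝟙 y) f)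
  sub₃₂_3_nat : ∀ {x x' y y' w z z' a a' b b' : Obj} (r : x' ⟶ x) (t : y' ⟶ y) (p : a' ⟶ a)
    (q : b' ⟶ b) (s : z ⟶ z') (g : M₃ x y w z) (f : M₂ a b w),
    map₄ r t p q s (sub₃₂_3 g f) = sub₃₂_3 (map₃ r t (𝟙 w) s g) (map₂ p q (𝟙 w) f)
  sub₂₃_1_nat : ∀ {x y y' z z' a a' b b' c c' : Obj} (p : a' ⟶ a) (q : b' ⟶ b) (r : c' ⟶ c)
    (t : y' ⟶ y) (s : z ⟶ z') (g : M₂ x y z) (f : M₃ a b c x),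
    map₄ p q r t s (sub₂₃_1 g f) = sub₂₃_1 (map₂ (𝟙 x) t s g) (map₃ p q r (𝟙 x) f)
  sub₂₃_2_nat : ∀ {x x' y z z' a a' b b' c c' : Obj} (t : x' ⟶ x) (p : a' ⟶ a) (q : b' ⟶ b)
    (r : c' ⟶ c) (s : z ⟶ z') (g : M₂ x y z) (f : M₃ a b c y),
    map₄ t p q r s (sub₂₃_2 g f) = sub₂₃_2 (map₂ t (𝟙 y) s g) (map₃ p q r (𝟙 y) f)
  sub₂₀_1_nat : ∀ {x y y' z z' : Obj} (r : y' ⟶ y) (s : z ⟶ z') (g : M₂ x y z) (f : M₀ x),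
    r ≫ sub₂₀_1 g f ≫ s = sub₂₀_1 (map₂ (𝟙 x) r s g) f
  sub₂₀_2_nat : ∀ {x x' y z z' : Obj} (r : x' ⟶ x) (s : z ⟶ z') (g : M₂ x y z) (f : M₀ y),
    r ≫ sub₂₀_2 g f ≫ s = sub₂₀_2 (map₂ r (𝟙 y) s g) f
  sub₃₀_1_nat : ∀ {x y y' w w' z z' : Obj} (r : y' ⟶ y) (t : w' ⟶ w) (s : z ⟶ z')
    (g : M₃ x y w z) (f : M₀ x),
    map₂ r t s (sub₃₀_1 g f) = sub₃₀_1 (map₃ (𝟙 x) r t s g) f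
  sub₃₀_2_nat : ∀ {x x' y w w' z z' : Obj} (r : x' ⟶ x) (t : w' ⟶ w) (s : z ⟶ z')
    (g : M₃ x y w z) (f : M₀ y),
    map₂ r t s (sub₃₀_2 g f) = sub₃₀_2 (map₃ r (𝟙 y) t s g) f
  sub₃₀_3_nat : ∀ {x x' y y' w z z' : Obj} (r : x' ⟶ x) (t : y' ⟶ y) (s : z ⟶ z')
    (g : M₃ x y w z) (f : M₀ w),
    map₂ r t s (sub₃₀_3 g f) = sub₃₀_3 (map₃ r t (𝟙 w) s g) f
  -- dinaturality of the substitutions in the variable substituted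
  sub₂₂_1_dinat : ∀ {x x' y z a b : Obj} (k : x' ⟶ x) (g : M₂ x y z) (f : M₂ a b x'),
    sub₂₂_1 (map₂ k (𝟙 y) (𝟙 z) g) f = sub₂₂_1 g (map₂ (𝟙 a) (𝟙 b) k f)
  sub₂₂_2_dinat : ∀ {x y y' z a b : Obj} (k : y' ⟶ y) (g : M₂ x y z) (f : M₂ a b y'),
    sub₂₂_2 (map₂ (𝟙 x) k (𝟙 z) g) f = sub₂₂_2 g (map₂ (𝟙 a) (𝟙 b) k f)
  sub₃₂_1_dinat : ∀ {x x' y w z a b : Obj} (k : x' ⟶ x) (g : M₃ x y w z) (f : M₂ a b x'),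
    sub₃₂_1 (map₃ k (𝟙 y) (𝟙 w) (𝟙 z) g) f = sub₃₂_1 g (map₂ (𝟙 a) (𝟙 b) k f)
  sub₃₂_2_dinat : ∀ {x y y' w z a b : Obj} (k : y' ⟶ y) (g : M₃ x y w z) (f : M₂ a b y'),
    sub₃₂_2 (map₃ (𝟙 x) k (𝟙 w) (𝟙 z) g) f = sub₃₂_2 g (map₂ (𝟙 a) (𝟙 b) k f)
  sub₃₂_3_dinat : ∀ {x y w w' z a b : Obj} (k : w' ⟶ w) (g : M₃ x y w z) (f : M₂ a b w'),
    sub₃₂_3 (map₃ (𝟙 x) (𝟙 y) k (𝟙 z) g) f = sub₃₂_3 g (map₂ (𝟙 a) (𝟙 b) k f)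
  sub₂₃_1_dinat : ∀ {x x' y z a b c : Obj} (k : x' ⟶ x) (g : M₂ x y z) (f : M₃ a b c x'),
    sub₂₃_1 (map₂ k (𝟙 y) (𝟙 z) g) f = sub₂₃_1 g (map₃ (𝟙 a) (𝟙 b) (𝟙 c) k f)
  sub₂₃_2_dinat : ∀ {x y y' z a b c : Obj} (k : y' ⟶ y) (g : M₂ x y z) (f : M₃ a b c y'),
    sub₂₃_2 (map₂ (𝟙 x) k (𝟙 z) g) f = sub₂₃_2 g (map₃ (𝟙 a) (𝟙 b) (𝟙 c) k f)
  sub₂₀_1_dinat : ∀ {x x' y z : Obj} (k : x' ⟶ x) (g : M₂ x y z) (f : M₀ x'),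
    sub₂₀_1 (map₂ k (𝟙 y) (𝟙 z) g) f = sub₂₀_1 g (map₀ k f)
  sub₂₀_2_dinat : ∀ {x y y' z : Obj} (k : y' ⟶ y) (g : M₂ x y z) (f : M₀ y'),
    sub₂₀_2 (map₂ (𝟙 x) k (𝟙 z) g) f = sub₂₀_2 g (map₀ k f)
  sub₃₀_1_dinat : ∀ {x x' y w z : Obj} (k : x' ⟶ x) (g : M₃ x y w z) (f : M₀ x'),
    sub₃₀_1 (map₃ k (𝟙 y) (𝟙 w) (𝟙 z) g) f = sub₃₀_1 g (map₀ k f)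
  sub₃₀_2_dinat : ∀ {x y y' w z : Obj} (k : y' ⟶ y) (g : M₃ x y w z) (f : M₀ y'),
    sub₃₀_2 (map₃ (𝟙 x) k (𝟙 w) (𝟙 z) g) f = sub₃₀_2 g (map₀ k f)
  sub₃₀_3_dinat : ∀ {x y w w' z : Obj} (k : w' ⟶ w) (g : M₃ x y w z) (f : M₀ w'),
    sub₃₀_3 (map₃ (𝟙 x) (𝟙 y) k (𝟙 z) g) f = sub₃₀_3 g (map₀ k f)
  -- associativity `f ∘ᵢ (g ∘ⱼ h) = (f ∘ᵢ g) ∘ⱼ₊ᵢ₋₁ h`, with `f, g, h` binary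
  assoc₂_11 : ∀ {x y z a b c d : Obj} (f : M₂ x y z) (g : M₂ a b x) (h : M₂ c d a),
    sub₂₃_1 f (sub₂₂_1 g h) = sub₃₂_1 (sub₂₂_1 f g) h
  assoc₂_12 : ∀ {x y z a b c d : Obj} (f : M₂ x y z) (g : M₂ a b x) (h : M₂ c d b),
    sub₂₃_1 f (sub₂₂_2 g h) = sub₃₂_2 (sub₂₂_1 f g) h
  assoc₂_21 : ∀ {x y z a b c d : Obj} (f : M₂ x y z) (g : M₂ a b y) (h : M₂ c d a),
    sub₂₃_2 f (sub₂₂_1 g h) = sub₃₂_2 (sub₂₂_2 f g) h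
  assoc₂_22 : ∀ {x y z a b c d : Obj} (f : M₂ x y z) (g : M₂ a b y) (h : M₂ c d b),
    sub₂₃_2 f (sub₂₂_2 g h) = sub₃₂_3 (sub₂₂_2 f g) h
  -- associativity, with `f, g` binary and `h` nullary
  assoc₀_11 : ∀ {x y z a b : Obj} (f : M₂ x y z) (g : M₂ a b x) (h : M₀ a),
    map₂ (sub₂₀_1 g h) (𝟙 y) (𝟙 z) f = sub₃₀_1 (sub₂₂_1 f g) h
  assoc₀_12 : ∀ {x y z a b : Obj} (f : M₂ x y z) (g : M₂ a b x) (h : M₀ b),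
    map₂ (sub₂₀_2 g h) (𝟙 y) (𝟙 z) f = sub₃₀_2 (sub₂₂_1 f g) h
  assoc₀_21 : ∀ {x y z a b : Obj} (f : M₂ x y z) (g : M₂ a b y) (h : M₀ a),
    map₂ (𝟙 x) (sub₂₀_1 g h) (𝟙 z) f = sub₃₀_2 (sub₂₂_2 f g) h
  assoc₀_22 : ∀ {x y z a b : Obj} (f : M₂ x y z) (g : M₂ a b y) (h : M₀ b),
    map₂ (𝟙 x) (sub₂₀_2 g h) (𝟙 z) f = sub₃₀_3 (sub₂₂_2 f g) h
  -- commutativity `(f ∘₁ g) ∘ₙ₊₁ h = (f ∘₂ h) ∘₁ g`, with `f` binary, `g` of arity `n` and `h` of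
  -- arity `p`, for `(n, p) = (2, 2), (2, 0), (0, 2), (0, 0)`
  comm₂₂ : ∀ {x y z a b c d : Obj} (f : M₂ x y z) (g : M₂ a b x) (h : M₂ c d y),
    sub₃₂_3 (sub₂₂_1 f g) h = sub₃₂_1 (sub₂₂_2 f h) g
  comm₂₀ : ∀ {x y z a b : Obj} (f : M₂ x y z) (g : M₂ a b x) (h : M₀ y),
    sub₃₀_3 (sub₂₂_1 f g) h = map₂ (𝟙 a) (𝟙 b) (sub₂₀_2 f h) g
  comm₀₂ : ∀ {x y z c d : Obj} (f : M₂ x y z) (g : M₀ x) (h : M₂ c d y),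
    map₂ (𝟙 c) (𝟙 d) (sub₂₀_1 f g) h = sub₃₀_1 (sub₂₂_2 f h) g
  comm₀₀ : ∀ {x y z : Obj} (f : M₂ x y z) (g : M₀ x) (h : M₀ y),
    map₀ (sub₂₀_1 f g) h = map₀ (sub₂₀_2 f h) g

attribute [instance] ShortMulticat.cat

namespace ShortMulticat

/-- A morphism of short multicategories: a functor and natural families commuting with all
substitutions. -/
@[ext]
structure Morphism (C D : ShortMulticat.{v, u}) where
  functor : C.Obj ⥤ D.Obj
  F₀ : ∀ {z : C.Obj}, C.M₀ z → D.M₀ (functor.obj z)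
  F₂ : ∀ {a b z : C.Obj}, C.M₂ a b z → D.M₂ (functor.obj a) (functor.obj b) (functor.obj z)
  F₃ : ∀ {a b c z : C.Obj}, C.M₃ a b c z →
    D.M₃ (functor.obj a) (functor.obj b) (functor.obj c) (functor.obj z)
  F₄ : ∀ {a b c d z : C.Obj}, C.M₄ a b c d z →
    D.M₄ (functor.obj a) (functor.obj b) (functor.obj c) (functor.obj d) (functor.obj z)
  nat₀ : ∀ {z z' : C.Obj} (s : z ⟶ z') (f : C.M₀ z), F₀ (C.map₀ s f) = D.map₀ (functor.map s) (F₀ f)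
  nat₂ : ∀ {a a' b b' z z' : C.Obj} (p : a' ⟶ a) (q : b' ⟶ b) (s : z ⟶ z') (f : C.M₂ a b z),
    F₂ (C.map₂ p q s f) = D.map₂ (functor.map p) (functor.map q) (functor.map s) (F₂ f)
  nat₃ : ∀ {a a' b b' c c' z z' : C.Obj} (p : a' ⟶ a) (q : b' ⟶ b) (r : c' ⟶ c) (s : z ⟶ z')
    (f : C.M₃ a b c z), F₃ (C.map₃ p q r s f)
      = D.map₃ (functor.map p) (functor.map q) (functor.map r) (functor.map s) (F₃ f)
  nat₄ : ∀ {a a' b b' c c' d d' z z' : C.Obj} (p : a' ⟶ a) (q : b' ⟶ b) (r : c' ⟶ c) (t : d' ⟶ d)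
    (s : z ⟶ z') (f : C.M₄ a b c d z), F₄ (C.map₄ p q r t s f)
      = D.map₄ (functor.map p) (functor.map q) (functor.map r) (functor.map t) (functor.map s) (F₄ f)
  comm_sub₂₂_1 : ∀ {x y z a b : C.Obj} (g : C.M₂ x y z) (f : C.M₂ a b x),
    F₃ (C.sub₂₂_1 g f) = D.sub₂₂_1 (F₂ g) (F₂ f)
  comm_sub₂₂_2 : ∀ {x y z a b : C.Obj} (g : C.M₂ x y z) (f : C.M₂ a b y),
    F₃ (C.sub₂₂_2 g f) = D.sub₂₂_2 (F₂ g) (F₂ f)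
  comm_sub₃₂_1 : ∀ {x y w z a b : C.Obj} (g : C.M₃ x y w z) (f : C.M₂ a b x),
    F₄ (C.sub₃₂_1 g f) = D.sub₃₂_1 (F₃ g) (F₂ f)
  comm_sub₃₂_2 : ∀ {x y w z a b : C.Obj} (g : C.M₃ x y w z) (f : C.M₂ a b y),
    F₄ (C.sub₃₂_2 g f) = D.sub₃₂_2 (F₃ g) (F₂ f)
  comm_sub₃₂_3 : ∀ {x y w z a b : C.Obj} (g : C.M₃ x y w z) (f : C.M₂ a b w),
    F₄ (C.sub₃₂_3 g f) = D.sub₃₂_3 (F₃ g) (F₂ f)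
  comm_sub₂₃_1 : ∀ {x y z a b c : C.Obj} (g : C.M₂ x y z) (f : C.M₃ a b c x),
    F₄ (C.sub₂₃_1 g f) = D.sub₂₃_1 (F₂ g) (F₃ f)
  comm_sub₂₃_2 : ∀ {x y z a b c : C.Obj} (g : C.M₂ x y z) (f : C.M₃ a b c y),
    F₄ (C.sub₂₃_2 g f) = D.sub₂₃_2 (F₂ g) (F₃ f)
  comm_sub₂₀_1 : ∀ {x y z : C.Obj} (g : C.M₂ x y z) (f : C.M₀ x),
    functor.map (C.sub₂₀_1 g f) = D.sub₂₀_1 (F₂ g) (F₀ f)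
  comm_sub₂₀_2 : ∀ {x y z : C.Obj} (g : C.M₂ x y z) (f : C.M₀ y),
    functor.map (C.sub₂₀_2 g f) = D.sub₂₀_2 (F₂ g) (F₀ f)
  comm_sub₃₀_1 : ∀ {x y w z : C.Obj} (g : C.M₃ x y w z) (f : C.M₀ x),
    F₂ (C.sub₃₀_1 g f) = D.sub₃₀_1 (F₃ g) (F₀ f)
  comm_sub₃₀_2 : ∀ {x y w z : C.Obj} (g : C.M₃ x y w z) (f : C.M₀ y),
    F₂ (C.sub₃₀_2 g f) = D.sub₃₀_2 (F₃ g) (F₀ f)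
  comm_sub₃₀_3 : ∀ {x y w z : C.Obj} (g : C.M₃ x y w z) (f : C.M₀ w),
    F₂ (C.sub₃₀_3 g f) = D.sub₃₀_3 (F₃ g) (F₀ f)

/-- Short multicategories and their morphisms form a category. -/
instance : Category ShortMulticat.{v, u} where
  Hom C D := Morphism C D
  id C :=
    { functor := 𝟭 C.Obj
      F₀ := fun f => f
      F₂ := fun f => f
      F₃ := fun f => f
      F₄ := fun f => f
      nat₀ := fun _ _ => rfl
      nat₂ := fun _ _ _ _ => rfl
      nat₃ := fun _ _ _ _ _ => rfl
      nat₄ := fun _ _ _ _ _ _ => rfl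
      comm_sub₂₂_1 := fun _ _ => rfl
      comm_sub₂₂_2 := fun _ _ => rfl
      comm_sub₃₂_1 := fun _ _ => rfl
      comm_sub₃₂_2 := fun _ _ => rfl
      comm_sub₃₂_3 := fun _ _ => rfl
      comm_sub₂₃_1 := fun _ _ => rfl
      comm_sub₂₃_2 := fun _ _ => rfl
      comm_sub₂₀_1 := fun _ _ => rfl
      comm_sub₂₀_2 := fun _ _ => rfl
      comm_sub₃₀_1 := fun _ _ => rfl
      comm_sub₃₀_2 := fun _ _ => rfl
      comm_sub₃₀_3 := fun _ _ => rfl }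
  comp F G :=
    { functor := F.functor ⋙ G.functor
      F₀ := fun f => G.F₀ (F.F₀ f)
      F₂ := fun f => G.F₂ (F.F₂ f)
      F₃ := fun f => G.F₃ (F.F₃ f)
      F₄ := fun f => G.F₄ (F.F₄ f)
      nat₀ := by intros; simp only [F.nat₀, G.nat₀, Functor.comp_map]
      nat₂ := by intros; simp only [F.nat₂, G.nat₂, Functor.comp_map, Functor.comp_obj]
      nat₃ := by intros; simp only [F.nat₃, G.nat₃, Functor.comp_map, Functor.comp_obj]
      nat₄ := by intros; simp only [F.nat₄, G.nat₄, Functor.comp_map, Functor.comp_obj]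
      comm_sub₂₂_1 := by intros; simp only [F.comm_sub₂₂_1, G.comm_sub₂₂_1, Functor.comp_obj]
      comm_sub₂₂_2 := by intros; simp only [F.comm_sub₂₂_2, G.comm_sub₂₂_2, Functor.comp_obj]
      comm_sub₃₂_1 := by intros; simp only [F.comm_sub₃₂_1, G.comm_sub₃₂_1, Functor.comp_obj]
      comm_sub₃₂_2 := by intros; simp only [F.comm_sub₃₂_2, G.comm_sub₃₂_2, Functor.comp_obj]
      comm_sub₃₂_3 := by intros; simp only [F.comm_sub₃₂_3, G.comm_sub₃₂_3, Functor.comp_obj]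
      comm_sub₂₃_1 := by intros; simp only [F.comm_sub₂₃_1, G.comm_sub₂₃_1, Functor.comp_obj]
      comm_sub₂₃_2 := by intros; simp only [F.comm_sub₂₃_2, G.comm_sub₂₃_2, Functor.comp_obj]
      comm_sub₂₀_1 := by
        intros; simp only [F.comm_sub₂₀_1, G.comm_sub₂₀_1, Functor.comp_map, Functor.comp_obj]
      comm_sub₂₀_2 := by
        intros; simp only [F.comm_sub₂₀_2, G.comm_sub₂₀_2, Functor.comp_map, Functor.comp_obj]
      comm_sub₃₀_1 := by intros; simp only [F.comm_sub₃₀_1, G.comm_sub₃₀_1, Functor.comp_obj]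
      comm_sub₃₀_2 := by intros; simp only [F.comm_sub₃₀_2, G.comm_sub₃₀_2, Functor.comp_obj]
      comm_sub₃₀_3 := by intros; simp only [F.comm_sub₃₀_3, G.comm_sub₃₀_3, Functor.comp_obj] }
  id_comp _ := rfl
  comp_id _ := rfl
  assoc _ _ _ := rfl

/-- A left universal nullary map classifier `u`. -/
structure IsLeftUniversalNullary (C : ShortMulticat.{v, u}) {i : C.Obj} (u : C.M₀ i) : Prop where
  bij₀ : ∀ z, Function.Bijective (fun f : i ⟶ z => C.map₀ f u)
  bij₁ : ∀ x z, Function.Bijective (fun f : C.M₂ i x z => C.sub₂₀_1 f u)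
  bij₂ : ∀ x y z, Function.Bijective (fun f : C.M₃ i x y z => C.sub₃₀_1 f u)

/-- A left universal binary map classifier `θ`. -/
structure IsLeftUniversalBinary (C : ShortMulticat.{v, u}) {a b m : C.Obj} (θ : C.M₂ a b m) :
    Prop where
  bij₁ : ∀ z, Function.Bijective (fun f : m ⟶ z => C.map₂ (𝟙 a) (𝟙 b) f θ)
  bij₂ : ∀ x z, Function.Bijective (fun f : C.M₂ m x z => C.sub₂₂_1 f θ)
  bij₃ : ∀ x y z, Function.Bijective (fun f : C.M₃ m x y z => C.sub₃₂_1 f θ)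

/-- A nullary map classifier, universal in every variable. -/
structure IsUniversalNullary (C : ShortMulticat.{v, u}) {i : C.Obj} (u : C.M₀ i) : Prop
    extends IsLeftUniversalNullary C u where
  bij₂_2 : ∀ x z, Function.Bijective (fun f : C.M₂ x i z => C.sub₂₀_2 f u)
  bij₃_2 : ∀ x y z, Function.Bijective (fun f : C.M₃ x i y z => C.sub₃₀_2 f u)
  bij₃_3 : ∀ x y z, Function.Bijective (fun f : C.M₃ x y i z => C.sub₃₀_3 f u)

/-- A binary map classifier, universal in every variable. -/
structure IsUniversalBinary (C : ShortMulticat.{v, u}) {a b m : C.Obj} (θ : C.M₂ a b m) : Prop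
    extends IsLeftUniversalBinary C θ where
  bij₂_2 : ∀ x z, Function.Bijective (fun f : C.M₂ x m z => C.sub₂₂_2 f θ)
  bij₃_2 : ∀ x y z, Function.Bijective (fun f : C.M₃ x m y z => C.sub₃₂_2 f θ)
  bij₃_3 : ∀ x y z, Function.Bijective (fun f : C.M₃ x y m z => C.sub₃₂_3 f θ)

/-- Left representable short multicategories. -/
def isLeftRepresentable : ObjectProperty ShortMulticat.{v, u} := fun C =>
  (∃ (i : C.Obj) (u : C.M₀ i), C.IsLeftUniversalNullary u) ∧
    ∀ a b : C.Obj, ∃ (m : C.Obj) (θ : C.M₂ a b m), C.IsLeftUniversalBinary θ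

/-- Representable short multicategories. -/
def isRepresentable : ObjectProperty ShortMulticat.{v, u} := fun C =>
  (∃ (i : C.Obj) (u : C.M₀ i), C.IsUniversalNullary u) ∧
    ∀ a b : C.Obj, ∃ (m : C.Obj) (θ : C.M₂ a b m), C.IsUniversalBinary θ

/-- Closed short multicategories. -/
def isClosed : ObjectProperty ShortMulticat.{v, u} := fun C =>
  ∀ b c : C.Obj, ∃ (h : C.Obj) (e : C.M₂ h b c),
    (Function.Bijective (fun f : C.M₀ h => C.sub₂₀_1 e f)) ∧
    (∀ x, Function.Bijective (fun f : x ⟶ h => C.map₂ f (𝟙 b) (𝟙 c) e)) ∧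
    (∀ x y, Function.Bijective (fun f : C.M₂ x y h => C.sub₂₂_1 e f)) ∧
    (∀ x y w, Function.Bijective (fun f : C.M₃ x y w h => C.sub₂₃_1 e f))

/-- Representable closed short multicategories. -/
def isClosedRepresentable : ObjectProperty ShortMulticat.{v, u} := isRepresentable ⊓ isClosed

theorem isClosedRepresentable_le : isClosedRepresentable.{v, u} ≤ isLeftRepresentable := by
  rintro C ⟨⟨⟨i, u, hu⟩, h⟩, -⟩
  refine ⟨⟨i, u, hu.toIsLeftUniversalNullary⟩, fun a b => ?_⟩
  obtain ⟨m, θ, hθ⟩ := h a b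
  exact ⟨m, θ, hθ.toIsLeftUniversalBinary⟩

/-- A choice of left universal nullary and binary map classifiers. -/
structure Classifiers (C : ShortMulticat.{v, u}) where
  unit : C.Obj
  u : C.M₀ unit
  u_univ : C.IsLeftUniversalNullary u
  tensor : C.Obj → C.Obj → C.Obj
  θ : ∀ a b : C.Obj, C.M₂ a b (tensor a b)
  θ_univ : ∀ a b : C.Obj, C.IsLeftUniversalBinary (θ a b)

theorem nonempty_classifiers {C : ShortMulticat.{v, u}} (h : isLeftRepresentable C) :
    Nonempty C.Classifiers := by
  obtain ⟨⟨i, u, hu⟩, h⟩ := h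
  choose m θ hθ using h
  exact ⟨⟨i, u, hu, m, θ, hθ⟩⟩

section Lemmas

variable (C : ShortMulticat.{v, u})

theorem post₂₂_1 {x y z z' a b : C.Obj} (s : z ⟶ z') (g : C.M₂ x y z) (f : C.M₂ a b x) :
    C.map₃ (𝟙 a) (𝟙 b) (𝟙 y) s (C.sub₂₂_1 g f) = C.sub₂₂_1 (C.map₂ (𝟙 x) (𝟙 y) s g) f := by
  rw [C.sub₂₂_1_nat, C.map₂_id f]

theorem post₂₂_2 {x y z z' a b : C.Obj} (s : z ⟶ z') (g : C.M₂ x y z) (f : C.M₂ a b y) :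
    C.map₃ (𝟙 x) (𝟙 a) (𝟙 b) s (C.sub₂₂_2 g f) = C.sub₂₂_2 (C.map₂ (𝟙 x) (𝟙 y) s g) f := by
  rw [C.sub₂₂_2_nat, C.map₂_id f]

theorem post₃₂_1 {x y w z z' a b : C.Obj} (s : z ⟶ z') (g : C.M₃ x y w z) (f : C.M₂ a b x) :
    C.map₄ (𝟙 a) (𝟙 b) (𝟙 y) (𝟙 w) s (C.sub₃₂_1 g f)
      = C.sub₃₂_1 (C.map₃ (𝟙 x) (𝟙 y) (𝟙 w) s g) f := by
  rw [C.sub₃₂_1_nat, C.map₂_id f]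

theorem post₃₂_2 {x y w z z' a b : C.Obj} (s : z ⟶ z') (g : C.M₃ x y w z) (f : C.M₂ a b y) :
    C.map₄ (𝟙 x) (𝟙 a) (𝟙 b) (𝟙 w) s (C.sub₃₂_2 g f)
      = C.sub₃₂_2 (C.map₃ (𝟙 x) (𝟙 y) (𝟙 w) s g) f := by
  rw [C.sub₃₂_2_nat, C.map₂_id f]

theorem post₃₂_3 {x y w z z' a b : C.Obj} (s : z ⟶ z') (g : C.M₃ x y w z) (f : C.M₂ a b w) :
    C.map₄ (𝟙 x) (𝟙 y) (𝟙 a) (𝟙 b) s (C.sub₃₂_3 g f)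
      = C.sub₃₂_3 (C.map₃ (𝟙 x) (𝟙 y) (𝟙 w) s g) f := by
  rw [C.sub₃₂_3_nat, C.map₂_id f]

theorem post₂₃_1 {x y z z' a b c : C.Obj} (s : z ⟶ z') (g : C.M₂ x y z) (f : C.M₃ a b c x) :
    C.map₄ (𝟙 a) (𝟙 b) (𝟙 c) (𝟙 y) s (C.sub₂₃_1 g f)
      = C.sub₂₃_1 (C.map₂ (𝟙 x) (𝟙 y) s g) f := by
  rw [C.sub₂₃_1_nat, C.map₃_id f]

theorem post₂₃_2 {x y z z' a b c : C.Obj} (s : z ⟶ z') (g : C.M₂ x y z) (f : C.M₃ a b c y) :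
    C.map₄ (𝟙 x) (𝟙 a) (𝟙 b) (𝟙 c) s (C.sub₂₃_2 g f)
      = C.sub₂₃_2 (C.map₂ (𝟙 x) (𝟙 y) s g) f := by
  rw [C.sub₂₃_2_nat, C.map₃_id f]

theorem post₂₀_1 {x y z z' : C.Obj} (s : z ⟶ z') (g : C.M₂ x y z) (f : C.M₀ x) :
    C.sub₂₀_1 g f ≫ s = C.sub₂₀_1 (C.map₂ (𝟙 x) (𝟙 y) s g) f := by
  rw [← C.sub₂₀_1_nat, Category.id_comp]

theorem post₂₀_2 {x y z z' : C.Obj} (s : z ⟶ z') (g : C.M₂ x y z) (f : C.M₀ y) :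
    C.sub₂₀_2 g f ≫ s = C.sub₂₀_2 (C.map₂ (𝟙 x) (𝟙 y) s g) f := by
  rw [← C.sub₂₀_2_nat, Category.id_comp]

theorem map₂_split_1 {a a' b b' z z' : C.Obj} (p : a' ⟶ a) (q : b' ⟶ b) (s : z ⟶ z')
    (f : C.M₂ a b z) :
    C.map₂ p q s f = C.map₂ p (𝟙 b') (𝟙 z') (C.map₂ (𝟙 a) q s f) := by
  rw [C.map₂_comp, Category.comp_id, Category.id_comp, Category.comp_id]

theorem map₂_split_2 {a a' b b' z z' : C.Obj} (p : a' ⟶ a) (q : b' ⟶ b) (s : z ⟶ z')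
    (f : C.M₂ a b z) :
    C.map₂ p q s f = C.map₂ (𝟙 a') q (𝟙 z') (C.map₂ p (𝟙 b) s f) := by
  rw [C.map₂_comp, Category.comp_id, Category.id_comp, Category.comp_id]

theorem map₂_post {a a' b b' z z' z'' : C.Obj} (p : a' ⟶ a) (q : b' ⟶ b) (s : z ⟶ z')
    (s' : z' ⟶ z'') (f : C.M₂ a b z) :
    C.map₂ p q (s ≫ s') f = C.map₂ p q s' (C.map₂ (𝟙 a) (𝟙 b) s f) := by
  rw [C.map₂_comp, Category.comp_id, Category.comp_id]

theorem map₂_post' {a a' b b' z z' z'' : C.Obj} (p : a' ⟶ a) (q : b' ⟶ b) (s : z ⟶ z')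
    (s' : z' ⟶ z'') (f : C.M₂ a b z) :
    C.map₂ p q (s ≫ s') f = C.map₂ (𝟙 a') (𝟙 b') s' (C.map₂ p q s f) := by
  rw [C.map₂_comp, Category.id_comp, Category.id_comp]

theorem map₃_post {a b c z z' z'' : C.Obj} (s : z ⟶ z') (s' : z' ⟶ z'') (f : C.M₃ a b c z) :
    C.map₃ (𝟙 a) (𝟙 b) (𝟙 c) (s ≫ s') f
      = C.map₃ (𝟙 a) (𝟙 b) (𝟙 c) s' (C.map₃ (𝟙 a) (𝟙 b) (𝟙 c) s f) := by
  rw [C.map₃_comp]; simp only [Category.comp_id]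

theorem map₄_post {a b c d z z' z'' : C.Obj} (s : z ⟶ z') (s' : z' ⟶ z'') (f : C.M₄ a b c d z) :
    C.map₄ (𝟙 a) (𝟙 b) (𝟙 c) (𝟙 d) (s ≫ s') f
      = C.map₄ (𝟙 a) (𝟙 b) (𝟙 c) (𝟙 d) s' (C.map₄ (𝟙 a) (𝟙 b) (𝟙 c) (𝟙 d) s f) := by
  rw [C.map₄_comp]; simp only [Category.comp_id]

end Lemmas

namespace Classifiers

variable {C : ShortMulticat.{v, u}} (L : C.Classifiers)

theorem ext₀ {z : C.Obj} {f g : L.unit ⟶ z} (h : C.map₀ f L.u = C.map₀ g L.u) : f = g :=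
  (L.u_univ.bij₀ z).1 h

theorem ext₂ {a b z : C.Obj} {f g : L.tensor a b ⟶ z}
    (h : C.map₂ (𝟙 a) (𝟙 b) f (L.θ a b) = C.map₂ (𝟙 a) (𝟙 b) g (L.θ a b)) : f = g :=
  ((L.θ_univ a b).bij₁ z).1 h

theorem ext₁ {a z : C.Obj} {f g : L.tensor L.unit a ⟶ z}
    (h : C.sub₂₀_1 (L.θ L.unit a) L.u ≫ f = C.sub₂₀_1 (L.θ L.unit a) L.u ≫ g) : f = g := by
  rw [C.post₂₀_1, C.post₂₀_1] at h
  exact L.ext₂ ((L.u_univ.bij₁ _ _).1 h)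

theorem ext₃ {a b c z : C.Obj} {f g : L.tensor (L.tensor a b) c ⟶ z}
    (h : C.map₃ (𝟙 a) (𝟙 b) (𝟙 c) f (C.sub₂₂_1 (L.θ (L.tensor a b) c) (L.θ a b))
      = C.map₃ (𝟙 a) (𝟙 b) (𝟙 c) g (C.sub₂₂_1 (L.θ (L.tensor a b) c) (L.θ a b))) : f = g := by
  rw [C.post₂₂_1, C.post₂₂_1] at h
  exact L.ext₂ (((L.θ_univ _ _).bij₂ _ _).1 h)

theorem ext₄ {a b c d z : C.Obj} {f g : L.tensor (L.tensor (L.tensor a b) c) d ⟶ z}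
    (h : C.map₄ (𝟙 a) (𝟙 b) (𝟙 c) (𝟙 d) f (C.sub₃₂_1 (C.sub₂₂_1
        (L.θ (L.tensor (L.tensor a b) c) d) (L.θ (L.tensor a b) c)) (L.θ a b))
      = C.map₄ (𝟙 a) (𝟙 b) (𝟙 c) (𝟙 d) g (C.sub₃₂_1 (C.sub₂₂_1
        (L.θ (L.tensor (L.tensor a b) c) d) (L.θ (L.tensor a b) c)) (L.θ a b))) : f = g := by
  rw [C.post₃₂_1, C.post₃₂_1] at h
  exact L.ext₃ (((L.θ_univ _ _).bij₃ _ _ _).1 h)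

/-- Maps `f ⊗ g`, `α`, `λ`, `ρ` which satisfy the equations that determine them. -/
structure TensorData where
  tensorHom : ∀ {a a' b b' : C.Obj}, (a ⟶ a') → (b ⟶ b') → (L.tensor a b ⟶ L.tensor a' b')
  α : ∀ a b c : C.Obj, L.tensor (L.tensor a b) c ⟶ L.tensor a (L.tensor b c)
  lam : ∀ a : C.Obj, L.tensor L.unit a ⟶ a
  rho : ∀ a : C.Obj, a ⟶ L.tensor a L.unit
  tensorHom_spec : ∀ {a a' b b' : C.Obj} (f : a ⟶ a') (g : b ⟶ b'),
    C.map₂ (𝟙 a) (𝟙 b) (tensorHom f g) (L.θ a b) = C.map₂ f g (𝟙 _) (L.θ a' b')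
  α_spec : ∀ a b c : C.Obj,
    C.map₃ (𝟙 a) (𝟙 b) (𝟙 c) (α a b c) (C.sub₂₂_1 (L.θ (L.tensor a b) c) (L.θ a b))
      = C.sub₂₂_2 (L.θ a (L.tensor b c)) (L.θ b c)
  lam_spec : ∀ a : C.Obj, C.sub₂₀_1 (L.θ L.unit a) L.u ≫ lam a = 𝟙 a
  rho_spec : ∀ a : C.Obj, rho a = C.sub₂₀_2 (L.θ a L.unit) L.u

namespace TensorData

variable {L} (T : L.TensorData)

theorem tensorHom_spec' {a a' b b' z : C.Obj} (f : a ⟶ a') (g : b ⟶ b')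
    (s : L.tensor a' b' ⟶ z) :
    C.map₂ (𝟙 a) (𝟙 b) (T.tensorHom f g ≫ s) (L.θ a b) = C.map₂ f g s (L.θ a' b') := by
  rw [C.map₂_post, T.tensorHom_spec, ← C.map₂_post', Category.id_comp]

/-- The skew monoidal category with the given structure maps. -/
def toSkewMonCat : SkewMonCat.{v, u} where
  Obj := C.Obj
  tensor := L.tensor
  tensorHom := T.tensorHom
  unit := L.unit
  α := T.α
  lam := T.lam
  rho := T.rho
  tensorHom_id a b := L.ext₂ (T.tensorHom_spec _ _)
  tensorHom_comp f f' g g' := by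
    apply L.ext₂
    rw [T.tensorHom_spec, T.tensorHom_spec']
    have h := congrArg (C.map₂ f g (𝟙 _)) (T.tensorHom_spec f' g')
    rw [C.map₂_comp, C.map₂_comp] at h
    simpa only [Category.comp_id, Category.id_comp] using h.symm
  α_naturality {a a' b b' c c'} f g h := by
    apply L.ext₃
    have e1 : C.map₃ (𝟙 a) (𝟙 b) (𝟙 c) (T.tensorHom (T.tensorHom f g) h ≫ T.α a' b' c')
        (C.sub₂₂_1 (L.θ (L.tensor a b) c) (L.θ a b))
        = C.map₃ f g h (T.α a' b' c') (C.sub₂₂_1 (L.θ (L.tensor a' b') c') (L.θ a' b')) := by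
      rw [C.post₂₂_1, T.tensorHom_spec', C.map₂_split_1, C.sub₂₂_1_dinat, T.tensorHom_spec,
        C.sub₂₂_1_nat]
    have e2 : C.map₃ (𝟙 a) (𝟙 b) (𝟙 c) (T.tensorHom f (T.tensorHom g h))
        (C.sub₂₂_2 (L.θ a (L.tensor b c)) (L.θ b c))
        = C.map₃ f g h (𝟙 _) (C.sub₂₂_2 (L.θ a' (L.tensor b' c')) (L.θ b' c')) := by
      rw [C.post₂₂_2, T.tensorHom_spec, C.map₂_split_2, C.sub₂₂_2_dinat, T.tensorHom_spec,
        C.sub₂₂_2_nat]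
    rw [e1, C.map₃_post, T.α_spec, e2, ← T.α_spec, C.map₃_comp]
    simp only [Category.comp_id]
  lam_naturality {a a'} f := by
    apply L.ext₁
    rw [C.post₂₀_1, T.tensorHom_spec', ← C.sub₂₀_1_nat, T.lam_spec, Category.comp_id,
      ← Category.assoc, T.lam_spec, Category.id_comp]
  rho_naturality {a a'} f := by
    rw [T.rho_spec, T.rho_spec, C.post₂₀_2, T.tensorHom_spec, ← C.sub₂₀_2_nat, Category.comp_id]
  pentagon a b c d := by
    apply L.ext₄
    have e1 : C.map₄ (𝟙 a) (𝟙 b) (𝟙 c) (𝟙 d)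
        (T.tensorHom (T.α a b c) (𝟙 d) ≫ T.α a (L.tensor b c) d
          ≫ T.tensorHom (𝟙 a) (T.α b c d))
        (C.sub₃₂_1 (C.sub₂₂_1 (L.θ (L.tensor (L.tensor a b) c) d) (L.θ (L.tensor a b) c))
          (L.θ a b))
        = C.sub₂₃_2 (L.θ a (L.tensor b (L.tensor c d)))
            (C.sub₂₂_2 (L.θ b (L.tensor c d)) (L.θ c d)) := by
      rw [C.map₄_post, ← C.assoc₂_11, C.post₂₃_1, T.tensorHom_spec, C.sub₂₃_1_dinat, T.α_spec,
        C.assoc₂_12, C.map₄_post, C.post₃₂_2, T.α_spec, ← C.assoc₂_21, C.post₂₃_2,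
        T.tensorHom_spec, C.sub₂₃_2_dinat, T.α_spec]
    rw [e1, C.map₄_post, C.post₃₂_1, T.α_spec, ← C.comm₂₂, C.post₃₂_3, T.α_spec, C.assoc₂_22]
  α_lam a b := by
    apply L.ext₃
    apply (L.u_univ.bij₂ _ _ _).1
    change C.sub₃₀_1 _ L.u = C.sub₃₀_1 _ L.u
    rw [C.map₃_post, T.α_spec, ← C.sub₃₀_1_nat, ← C.comm₀₂, ← C.map₂_post, T.lam_spec,
      C.map₂_id, C.post₂₂_1, T.tensorHom_spec, ← C.assoc₀_11, C.map₂_comp, T.lam_spec]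
    simp only [Category.comp_id, C.map₂_id]
  rho_α a b := by
    apply L.ext₂
    rw [T.rho_spec, C.map₂_post, ← C.comm₂₀, C.sub₃₀_3_nat, T.α_spec, ← C.assoc₀_22,
      T.tensorHom_spec, T.rho_spec]
  rho_α_lam a b := by
    apply L.ext₂
    have e1 : C.map₂ (C.sub₂₀_2 (L.θ a L.unit) L.u) (𝟙 b) (T.α a L.unit b
          ≫ T.tensorHom (𝟙 a) (T.lam b)) (L.θ (L.tensor a L.unit) b)
        = C.map₂ (𝟙 a) (𝟙 b) (T.tensorHom (𝟙 a) (T.lam b)) (C.sub₃₀_2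
          (C.sub₂₂_2 (L.θ a (L.tensor L.unit b)) (L.θ L.unit b)) L.u) := by
      rw [← T.α_spec, ← C.sub₃₀_2_nat, ← C.assoc₀_12, ← C.map₂_post', ← C.map₂_post',
        Category.id_comp]
    rw [T.tensorHom_spec', T.rho_spec, e1, ← C.assoc₀_21, ← C.map₂_post', Category.id_comp,
      C.map₂_split_2, T.tensorHom_spec, C.map₂_comp, T.lam_spec]
    simp only [Category.comp_id]
  rho_lam := by
    apply L.ext₀
    rw [← C.map₀_comp, T.rho_spec, ← C.comm₀₀, C.map₀_comp, T.lam_spec]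

theorem isLeftNormal_toSkewMonCat : SkewMonCat.isLeftNormal T.toSkewMonCat := by
  intro (a : C.Obj)
  refine ⟨C.sub₂₀_1 (L.θ L.unit a) L.u, ?_, T.lam_spec a⟩
  change T.lam a ≫ C.sub₂₀_1 (L.θ L.unit a) L.u = 𝟙 (L.tensor L.unit a)
  apply L.ext₁
  rw [← Category.assoc, T.lam_spec, Category.id_comp, Category.comp_id]

end TensorData

/-- The structure maps defined by the universal properties of the classifiers. -/
noncomputable def tensorData : L.TensorData where
  tensorHom {a a' b b'} f g :=
    (((L.θ_univ a b).bij₁ _).2 (C.map₂ f g (𝟙 _) (L.θ a' b'))).choose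
  tensorHom_spec {a a' b b'} f g :=
    (((L.θ_univ a b).bij₁ _).2 (C.map₂ f g (𝟙 _) (L.θ a' b'))).choose_spec
  α a b c :=
    (((L.θ_univ (L.tensor a b) c).bij₁ _).2 (((L.θ_univ a b).bij₂ _ _).2
      (C.sub₂₂_2 (L.θ a (L.tensor b c)) (L.θ b c))).choose).choose
  α_spec a b c := by
    rw [C.post₂₂_1]
    exact (congrArg (fun f => C.sub₂₂_1 f (L.θ a b))
      (((L.θ_univ (L.tensor a b) c).bij₁ _).2 _).choose_spec).trans
      (((L.θ_univ a b).bij₂ _ _).2 (C.sub₂₂_2 (L.θ a (L.tensor b c)) (L.θ b c))).choose_spec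
  lam a := (((L.θ_univ L.unit a).bij₁ _).2 ((L.u_univ.bij₁ _ _).2 (𝟙 a)).choose).choose
  lam_spec a := by
    rw [C.post₂₀_1]
    exact (congrArg (fun f => C.sub₂₀_1 f L.u)
      (((L.θ_univ L.unit a).bij₁ _).2 _).choose_spec).trans
      ((L.u_univ.bij₁ _ _).2 (𝟙 a)).choose_spec
  rho a := C.sub₂₀_2 (L.θ a L.unit) L.u
  rho_spec _ := rfl

end Classifiers

/-- Maps `f₀`, `f₂` which satisfy the equations that determine them from a morphism `F`. -/
structure LaxData {C D : ShortMulticat.{v, u}} (L : C.Classifiers) (L' : D.Classifiers)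
    (F : C ⟶ D) where
  f₀ : L'.unit ⟶ F.functor.obj L.unit
  f₂ : ∀ a b : C.Obj,
    L'.tensor (F.functor.obj a) (F.functor.obj b) ⟶ F.functor.obj (L.tensor a b)
  f₀_spec : D.map₀ f₀ L'.u = F.F₀ L.u
  f₂_spec : ∀ a b : C.Obj, D.map₂ (𝟙 _) (𝟙 _) (f₂ a b)
    (L'.θ (F.functor.obj a) (F.functor.obj b)) = F.F₂ (L.θ a b)

namespace LaxData

variable {C D : ShortMulticat.{v, u}} {L : C.Classifiers} {L' : D.Classifiers} {F : C ⟶ D}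

theorem ext' (X Y : LaxData L L' F) : X.f₀ = Y.f₀ ∧ X.f₂ = Y.f₂ :=
  ⟨L'.ext₀ (X.f₀_spec.trans Y.f₀_spec.symm),
    funext fun a => funext fun b => L'.ext₂ ((X.f₂_spec a b).trans (Y.f₂_spec a b).symm)⟩

variable (X : LaxData L L' F)

theorem f₂_spec' (a b : C.Obj) {z : D.Obj} (s : F.functor.obj (L.tensor a b) ⟶ z) :
    D.map₂ (𝟙 _) (𝟙 _) (X.f₂ a b ≫ s) (L'.θ (F.functor.obj a) (F.functor.obj b))
      = D.map₂ (𝟙 _) (𝟙 _) s (F.F₂ (L.θ a b)) := by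
  rw [D.map₂_post, X.f₂_spec]

/-- The lax monoidal functor with the given structure maps. -/
def toLaxFunctor (T : L.TensorData) (T' : L'.TensorData) :
    SkewMonCat.LaxFunctor T.toSkewMonCat T'.toSkewMonCat where
  functor := F.functor
  f₀ := X.f₀
  f₂ := X.f₂
  f₂_naturality := by
    intro (a : C.Obj) (a' : C.Obj) (b : C.Obj) (b' : C.Obj) (p : a ⟶ a') (q : b ⟶ b')
    apply L'.ext₂
    refine (T'.tensorHom_spec' (F.functor.map p) (F.functor.map q) (X.f₂ a' b')).trans ?_
    refine Eq.trans ?_ (X.f₂_spec' a b (F.functor.map (T.tensorHom p q))).symm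
    have h := congrArg F.F₂ (T.tensorHom_spec p q)
    rw [F.nat₂, F.nat₂] at h
    simp only [CategoryTheory.Functor.map_id] at h
    rw [h, ← X.f₂_spec, D.map₂_comp]
    simp only [Category.comp_id]
  associativity (a b c : C.Obj) := by
    apply L'.ext₃
    have e1 : D.map₃ (𝟙 _) (𝟙 _) (𝟙 _)
        (T'.tensorHom (X.f₂ a b) (𝟙 (F.functor.obj c)) ≫ X.f₂ (L.tensor a b) c
          ≫ F.functor.map (T.α a b c)) (D.sub₂₂_1 (L'.θ _ _) (L'.θ _ _))
        = F.F₃ (C.sub₂₂_2 (L.θ a (L.tensor b c)) (L.θ b c)) := by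
      rw [D.post₂₂_1, T'.tensorHom_spec', D.map₂_split_1, X.f₂_spec', D.sub₂₂_1_dinat,
        X.f₂_spec, ← D.post₂₂_1, ← F.comm_sub₂₂_1]
      have h := congrArg F.F₃ (T.α_spec a b c)
      rw [F.nat₃] at h
      simp only [CategoryTheory.Functor.map_id] at h
      exact h
    have e2 : D.map₃ (𝟙 _) (𝟙 _) (𝟙 _)
        (T'.α _ _ _ ≫ T'.tensorHom (𝟙 (F.functor.obj a)) (X.f₂ b c) ≫ X.f₂ a (L.tensor b c))
          (D.sub₂₂_1 (L'.θ _ _) (L'.θ _ _))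
        = F.F₃ (C.sub₂₂_2 (L.θ a (L.tensor b c)) (L.θ b c)) := by
      rw [D.map₃_post, T'.α_spec, D.post₂₂_2, T'.tensorHom_spec', D.map₂_split_2, X.f₂_spec,
        D.sub₂₂_2_dinat, X.f₂_spec, F.comm_sub₂₂_2]
    exact e1.trans e2.symm
  left_unitality (a : C.Obj) := by
    apply L'.ext₁
    have e1 : D.sub₂₀_1 (L'.θ L'.unit (F.functor.obj a)) L'.u
        ≫ T'.tensorHom X.f₀ (𝟙 (F.functor.obj a)) ≫ X.f₂ L.unit a ≫ F.functor.map (T.lam a)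
        = 𝟙 _ := by
      rw [D.post₂₀_1, T'.tensorHom_spec', D.map₂_split_1, X.f₂_spec', D.sub₂₀_1_dinat,
        X.f₀_spec, ← D.post₂₀_1, ← F.comm_sub₂₀_1, ← F.functor.map_comp, T.lam_spec,
        F.functor.map_id]
    exact e1.trans (T'.lam_spec _).symm
  right_unitality (a : C.Obj) := by
    change T'.rho _ ≫ T'.tensorHom (𝟙 (F.functor.obj a)) X.f₀ ≫ X.f₂ a L.unit
      = F.functor.map (T.rho a)
    rw [T'.rho_spec, T.rho_spec, D.post₂₀_2, T'.tensorHom_spec', D.map₂_split_2, X.f₂_spec,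
      D.sub₂₀_2_dinat, X.f₀_spec, F.comm_sub₂₀_2]

end LaxData

/-- The structure maps of the lax monoidal functor of `F`, defined by universal properties. -/
noncomputable def laxData {C D : ShortMulticat.{v, u}} (L : C.Classifiers) (L' : D.Classifiers)
    (F : C ⟶ D) : LaxData L L' F where
  f₀ := ((L'.u_univ.bij₀ _).2 (F.F₀ L.u)).choose
  f₀_spec := ((L'.u_univ.bij₀ _).2 (F.F₀ L.u)).choose_spec
  f₂ a b := (((L'.θ_univ _ _).bij₁ _).2 (F.F₂ (L.θ a b))).choose
  f₂_spec a b := (((L'.θ_univ _ _).bij₁ _).2 (F.F₂ (L.θ a b))).choose_spec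

/-- The identity structure maps. -/
def idLaxData {C : ShortMulticat.{v, u}} (L : C.Classifiers) : LaxData L L (𝟙 C) where
  f₀ := 𝟙 _
  f₂ _ _ := 𝟙 _
  f₀_spec := C.map₀_id _
  f₂_spec _ _ := C.map₂_id _

/-- The composite structure maps. -/
def LaxData.comp {C D E : ShortMulticat.{v, u}} {L : C.Classifiers} {L' : D.Classifiers}
    {L'' : E.Classifiers} {F : C ⟶ D} {G : D ⟶ E} (X : LaxData L L' F) (Y : LaxData L' L'' G) :
    LaxData L L'' (F ≫ G) where
  f₀ := Y.f₀ ≫ G.functor.map X.f₀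
  f₂ a b := Y.f₂ _ _ ≫ G.functor.map (X.f₂ a b)
  f₀_spec := by
    rw [← E.map₀_comp, Y.f₀_spec, ← G.nat₀, X.f₀_spec]
    rfl
  f₂_spec a b := by
    refine (Y.f₂_spec' _ _ _).trans ?_
    have h := congrArg G.F₂ (X.f₂_spec a b)
    rw [G.nat₂] at h
    simp only [CategoryTheory.Functor.map_id] at h
    exact h

/-- A choice of classifiers for every left representable short multicategory. -/
abbrev Choice := ∀ C : isLeftRepresentable.{v, u}.FullSubcategory, C.obj.Classifiers

/-- The functor from left representable short multicategories to left normal skew monoidal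
categories: `a ⊗ b` and the unit are the chosen classifiers, and `f ⊗ g`, `α`, `λ`, `ρ`, `f₀`, `f₂`
are determined by the universal properties. -/
noncomputable def K (χ : Choice.{v, u}) :
    isLeftRepresentable.{v, u}.FullSubcategory ⥤ SkewMonCat.isLeftNormal.{v, u}.FullSubcategory where
  obj C := ⟨(χ C).tensorData.toSkewMonCat, (χ C).tensorData.isLeftNormal_toSkewMonCat⟩
  map {C D} F := ObjectProperty.homMk ((laxData (χ C) (χ D) F.hom).toLaxFunctor _ _)
  map_id C := by
    have h := LaxData.ext' (laxData (χ C) (χ C) (𝟙 C.obj)) (idLaxData (χ C))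
    apply ObjectProperty.hom_ext
    exact SkewMonCat.LaxFunctor.ext rfl (heq_of_eq h.1) (heq_of_eq h.2)
  map_comp {C D E} F G := by
    have h := LaxData.ext' (laxData (χ C) (χ E) (F.hom ≫ G.hom))
      ((laxData (χ C) (χ D) F.hom).comp (laxData (χ D) (χ E) G.hom))
    apply ObjectProperty.hom_ext
    exact SkewMonCat.LaxFunctor.ext rfl (heq_of_eq h.1) (heq_of_eq h.2)

end ShortMulticat

/-! ## Multicategories -/

/-- A multicategory. `Hom l b` is the set of multimaps with domain the list `l` and codomain `b`.
`sub xs ys hl hr g f` substitutes `f`, with domain `as` and codomain `b`, in the variable `b` of `g`,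
whose domain is `xs, b, ys`; the result has domain `xs, as, ys`. The domains of `g` and of
the result are variables `l`, `r` with equations `hl`, `hr` so that no casts are needed. -/
structure Multicat where
  Obj : Type u
  Hom : List Obj → Obj → Type v
  id : ∀ a : Obj, Hom [a] a
  sub : ∀ {l r as : List Obj} {b c : Obj} (xs ys : List Obj), l = xs ++ b :: ys →
    r = xs ++ (as ++ ys) → Hom l c → Hom as b → Hom r c
  id_sub : ∀ {as : List Obj} {b : Obj} (hr : as = [] ++ (as ++ [])) (f : Hom as b),
    sub [] [] rfl hr (id b) f = f
  sub_id : ∀ {l : List Obj} {b c : Obj} (xs ys : List Obj) (hl : l = xs ++ b :: ys)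
    (hr : l = xs ++ ([b] ++ ys)) (g : Hom l c), sub xs ys hl hr g (id b) = g
  -- `h ∘ᵢ (g ∘ⱼ f) = (h ∘ᵢ g) ∘ⱼ₊ᵢ₋₁ f`
  assoc : ∀ {l m p q r as : List Obj} {b c d : Obj} (xs ys us vs : List Obj)
    (hl : l = xs ++ b :: ys) (hm : m = us ++ d :: vs) (hp : p = xs ++ (m ++ ys))
    (hp' : p = (xs ++ us) ++ d :: (vs ++ ys)) (hq : q = us ++ (as ++ vs))
    (hr : r = xs ++ (q ++ ys)) (hr' : r = (xs ++ us) ++ (as ++ (vs ++ ys)))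
    (h : Hom l c) (g : Hom m b) (f : Hom as d),
    sub xs ys hl hr h (sub us vs hm hq g f)
      = sub (xs ++ us) (vs ++ ys) hp' hr' (sub xs ys hl hp h g) f
  -- `(h ∘ᵢ g) ∘ₙ₊ⱼ₋₁ f = (h ∘ⱼ f) ∘ᵢ g` for `i < j`
  comm : ∀ {l p q r as bs : List Obj} {b c d : Obj} (xs ys zs : List Obj)
    (hl : l = xs ++ b :: (ys ++ d :: zs)) (hl' : l = (xs ++ b :: ys) ++ d :: zs)
    (hp : p = xs ++ (as ++ (ys ++ d :: zs))) (hp' : p = (xs ++ as ++ ys) ++ d :: zs)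
    (hq : q = (xs ++ b :: ys) ++ (bs ++ zs)) (hq' : q = xs ++ b :: (ys ++ (bs ++ zs)))
    (hr : r = (xs ++ as ++ ys) ++ (bs ++ zs)) (hr' : r = xs ++ (as ++ (ys ++ (bs ++ zs))))
    (h : Hom l c) (g : Hom as b) (f : Hom bs d),
    sub (xs ++ as ++ ys) zs hp' hr (sub xs (ys ++ d :: zs) hl hp h g) f
      = sub xs (ys ++ (bs ++ zs)) hq' hr' (sub (xs ++ b :: ys) zs hl' hq h f) g

namespace Multicat

/-- A multifunctor. As for substitution, `map h f` has domain a list `l'` which is equal to the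
list of images of the domain of `f`. -/
@[ext]
structure Multifunctor (M N : Multicat.{v, u}) where
  obj : M.Obj → N.Obj
  map : ∀ {l : List M.Obj} {l' : List N.Obj} {b : M.Obj}, l' = l.map obj →
    M.Hom l b → N.Hom l' (obj b)
  map_id : ∀ a : M.Obj, map (l' := [obj a]) rfl (M.id a) = N.id (obj a)
  map_sub : ∀ {l r as : List M.Obj} {l' r' as' : List N.Obj} {b c : M.Obj}
    (xs ys : List M.Obj) (xs' ys' : List N.Obj) (hl : l = xs ++ b :: ys)
    (hr : r = xs ++ (as ++ ys)) (el : l' = l.map obj) (er : r' = r.map obj)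
    (eas : as' = as.map obj) (_ : xs' = xs.map obj) (_ : ys' = ys.map obj)
    (hl' : l' = xs' ++ obj b :: ys') (hr' : r' = xs' ++ (as' ++ ys'))
    (g : M.Hom l c) (f : M.Hom as b),
    map er (M.sub xs ys hl hr g f) = N.sub xs' ys' hl' hr' (map el g) (map eas f)

/-- The multimap `f`, with its domain rewritten along an equality. -/
def cast (M : Multicat.{v, u}) {l l' : List M.Obj} {b : M.Obj} (h : l' = l) (f : M.Hom l b) :
    M.Hom l' b := h ▸ f

/-- Multicategories and multifunctors form a category. -/
instance : Category Multicat.{v, u} where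
  Hom M N := Multifunctor M N
  id M :=
    { obj := fun a => a
      map := fun h f => M.cast (h.trans (List.map_id' _)) f
      map_id := fun _ => rfl
      map_sub := by
        intro l r as l' r' as' b c xs ys xs' ys' hl hr el er eas ex ey hl' hr' g f
        obtain rfl := el.trans (List.map_id' _)
        obtain rfl := er.trans (List.map_id' _)
        obtain rfl := eas.trans (List.map_id' _)
        obtain rfl := ex.trans (List.map_id' _)
        obtain rfl := ey.trans (List.map_id' _)
        rfl }
  comp {M N P} F G :=
    { obj := fun a => G.obj (F.obj a)
      map := fun {l l' b} h f => G.map (l := l.map F.obj) (h.trans (by simp)) (F.map rfl f)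
      map_id := fun a => by
        rw [F.map_id]
        exact G.map_id _
      map_sub := by
        intro l r as l' r' as' b c xs ys xs' ys' hl hr el er eas ex ey hl' hr' g f
        rw [F.map_sub xs ys (xs.map F.obj) (ys.map F.obj) hl hr rfl rfl rfl rfl rfl
          (by simp [hl]) (by simp [hr])]
        exact G.map_sub _ _ _ _ _ _ (el.trans (by simp)) _ (eas.trans (by simp))
          (ex.trans (by simp)) (ey.trans (by simp)) _ _ _ _ }
  id_comp {M N} F := by
    refine Multifunctor.ext rfl (heq_of_eq ?_)
    funext l l' b h f
    have key : ∀ (k : List M.Obj) (e : k = l) (h' : l' = k.map F.obj),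
        F.map h' (M.cast e f) = F.map h f := by
      rintro k rfl h'
      rfl
    exact key (l.map (fun a => a)) (List.map_id' l) _
  comp_id {M N} F := by
    refine Multifunctor.ext rfl (heq_of_eq ?_)
    funext l l' b h f
    have key : ∀ (k : List N.Obj) (e : k = l.map F.obj) (h' : l' = k),
        N.cast h' (F.map e f) = F.map h f := by
      rintro k rfl rfl
      rfl
    exact key _ rfl h
  assoc {M N P Q} F G H := by
    refine Multifunctor.ext rfl (heq_of_eq ?_)
    funext l l' b h f
    have key : ∀ (k k' : List P.Obj) (e : k = (l.map F.obj).map G.obj)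
        (e' : k' = (l.map F.obj).map G.obj) (h1 : l' = k.map H.obj) (h2 : l' = k'.map H.obj),
        H.map h1 (G.map e (F.map rfl f)) = H.map h2 (G.map e' (F.map rfl f)) := by
      rintro k k' rfl rfl h1 h2
      rfl
    exact key (l.map (fun a => G.obj (F.obj a))) ((l.map F.obj).map G.obj) (by simp) rfl
      (h.trans (by simp)) (h.trans (by simp))

/-- The category of unary multimaps. -/
instance underlying (M : Multicat.{v, u}) : Category.{v} M.Obj where
  Hom a b := M.Hom [a] b
  id a := M.id a
  comp f g := M.sub [] [] rfl rfl g f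
  id_comp f := M.sub_id [] [] rfl rfl f
  comp_id f := M.id_sub rfl f
  assoc f g h := M.assoc [] [] [] [] rfl rfl rfl rfl rfl rfl rfl h g f

end Multicat

namespace Multicat

section Substitution

variable (M : Multicat.{v, u})

/-- Postcomposition with a unary multimap. -/
def post {l : List M.Obj} {c c' : M.Obj} (s : c ⟶ c') (g : M.Hom l c) : M.Hom l c' :=
  M.sub [] [] rfl (by simp) s g

/-- Substitution of a multimap of arity `1` in the variable number `1`. -/
def sub1_1 {a1 b c : M.Obj} {ys : List M.Obj} (g : M.Hom (b :: ys) c)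
    (f : a1 ⟶ b) : M.Hom (a1 :: ys) c :=
  M.sub [] ys rfl rfl g f

/-- Substitution of a multimap of arity `0` in the variable number `1`. -/
def sub1_0 {b c : M.Obj} {ys : List M.Obj} (g : M.Hom (b :: ys) c)
    (f : M.Hom [] b) : M.Hom ys c :=
  M.sub [] ys rfl rfl g f

/-- Substitution of a multimap of arity `2` in the variable number `1`. -/
def sub1_2 {a1 a2 b c : M.Obj} {ys : List M.Obj} (g : M.Hom (b :: ys) c)
    (f : M.Hom [a1, a2] b) : M.Hom (a1 :: a2 :: ys) c :=
  M.sub [] ys rfl rfl g f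

/-- Substitution of a multimap of arity `3` in the variable number `1`. -/
def sub1_3 {a1 a2 a3 b c : M.Obj} {ys : List M.Obj} (g : M.Hom (b :: ys) c)
    (f : M.Hom [a1, a2, a3] b) : M.Hom (a1 :: a2 :: a3 :: ys) c :=
  M.sub [] ys rfl rfl g f

/-- Substitution of a multimap of arity `1` in the variable number `2`. -/
def sub2_1 {x1 a1 b c : M.Obj} {ys : List M.Obj} (g : M.Hom (x1 :: b :: ys) c)
    (f : a1 ⟶ b) : M.Hom (x1 :: a1 :: ys) c :=
  M.sub [x1] ys rfl rfl g f

/-- Substitution of a multimap of arity `0` in the variable number `2`. -/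
def sub2_0 {x1 b c : M.Obj} {ys : List M.Obj} (g : M.Hom (x1 :: b :: ys) c)
    (f : M.Hom [] b) : M.Hom (x1 :: ys) c :=
  M.sub [x1] ys rfl rfl g f

/-- Substitution of a multimap of arity `2` in the variable number `2`. -/
def sub2_2 {x1 a1 a2 b c : M.Obj} {ys : List M.Obj} (g : M.Hom (x1 :: b :: ys) c)
    (f : M.Hom [a1, a2] b) : M.Hom (x1 :: a1 :: a2 :: ys) c :=
  M.sub [x1] ys rfl rfl g f

/-- Substitution of a multimap of arity `3` in the variable number `2`. -/
def sub2_3 {x1 a1 a2 a3 b c : M.Obj} {ys : List M.Obj} (g : M.Hom (x1 :: b :: ys) c)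
    (f : M.Hom [a1, a2, a3] b) : M.Hom (x1 :: a1 :: a2 :: a3 :: ys) c :=
  M.sub [x1] ys rfl rfl g f

/-- Substitution of a multimap of arity `1` in the variable number `3`. -/
def sub3_1 {x1 x2 a1 b c : M.Obj} {ys : List M.Obj} (g : M.Hom (x1 :: x2 :: b :: ys) c)
    (f : a1 ⟶ b) : M.Hom (x1 :: x2 :: a1 :: ys) c :=
  M.sub [x1, x2] ys rfl rfl g f

/-- Substitution of a multimap of arity `0` in the variable number `3`. -/
def sub3_0 {x1 x2 b c : M.Obj} {ys : List M.Obj} (g : M.Hom (x1 :: x2 :: b :: ys) c)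
    (f : M.Hom [] b) : M.Hom (x1 :: x2 :: ys) c :=
  M.sub [x1, x2] ys rfl rfl g f

/-- Substitution of a multimap of arity `2` in the variable number `3`. -/
def sub3_2 {x1 x2 a1 a2 b c : M.Obj} {ys : List M.Obj} (g : M.Hom (x1 :: x2 :: b :: ys) c)
    (f : M.Hom [a1, a2] b) : M.Hom (x1 :: x2 :: a1 :: a2 :: ys) c :=
  M.sub [x1, x2] ys rfl rfl g f

/-- Substitution of a multimap of arity `1` in the variable number `4`. -/
def sub4_1 {x1 x2 x3 a1 b c : M.Obj} {ys : List M.Obj} (g : M.Hom (x1 :: x2 :: x3 :: b :: ys) c)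
    (f : a1 ⟶ b) : M.Hom (x1 :: x2 :: x3 :: a1 :: ys) c :=
  M.sub [x1, x2, x3] ys rfl rfl g f

theorem post_sub {l r as : List M.Obj} {b c d : M.Obj} (s : c ⟶ d) (us vs : List M.Obj)
    (hl : l = us ++ b :: vs) (hr : r = us ++ (as ++ vs)) (g : M.Hom l c) (f : M.Hom as b) :
    M.post s (M.sub us vs hl hr g f) = M.sub us vs hl hr (M.post s g) f := by
  have key : ∀ (ws : List M.Obj) (e : ws = vs) (hl' : l = us ++ b :: ws)
      (hr' : r = us ++ (as ++ ws)),
      M.sub us ws hl' hr' (M.post s g) f = M.sub us vs hl hr (M.post s g) f := by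
    rintro ws rfl _ _
    rfl
  rw [← key (vs ++ []) (List.append_nil vs) (by simp [hl]) (by simp [hr])]
  exact M.assoc [] [] us vs rfl hl (by simp) (by simp [hl]) hr (by simp) (by simp [hr]) s g f

variable {M}

@[simp] theorem post_post {l : List M.Obj} {c c' c'' : M.Obj} (s : c ⟶ c') (s' : c' ⟶ c'')
    (g : M.Hom l c) : M.post s' (M.post s g) = M.post (s ≫ s') g :=
  M.assoc [] [] [] [] rfl rfl (by simp) (by simp) (by simp) (by simp) (by simp) s' s g

@[simp] theorem post_id {l : List M.Obj} {c : M.Obj} (g : M.Hom l c) : M.post (𝟙 c) g = g :=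
  M.id_sub _ g

@[simp] theorem sub1_1_id {b c : M.Obj} {ys : List M.Obj} (g : M.Hom (b :: ys) c) :
    M.sub1_1 g (𝟙 b) = g :=
  M.sub_id [] ys rfl rfl g

@[simp] theorem sub1_1_comp {a a' b c : M.Obj} {ys : List M.Obj} (g : M.Hom (b :: ys) c)
    (p : a ⟶ b) (p' : a' ⟶ a) : M.sub1_1 (M.sub1_1 g p) p' = M.sub1_1 g (p' ≫ p) :=
  (M.assoc [] ys [] [] rfl rfl rfl rfl rfl rfl rfl g p p').symm

@[simp] theorem sub2_1_id {x1 b c : M.Obj} {ys : List M.Obj} (g : M.Hom (x1 :: b :: ys) c) :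
    M.sub2_1 g (𝟙 b) = g :=
  M.sub_id [x1] ys rfl rfl g

@[simp] theorem sub2_1_comp {x1 a a' b c : M.Obj} {ys : List M.Obj} (g : M.Hom (x1 :: b :: ys) c)
    (p : a ⟶ b) (p' : a' ⟶ a) : M.sub2_1 (M.sub2_1 g p) p' = M.sub2_1 g (p' ≫ p) :=
  (M.assoc [x1] ys [] [] rfl rfl rfl rfl rfl rfl rfl g p p').symm

@[simp] theorem sub3_1_id {x1 x2 b c : M.Obj} {ys : List M.Obj} (g : M.Hom (x1 :: x2 :: b :: ys) c) :
    M.sub3_1 g (𝟙 b) = g :=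
  M.sub_id [x1, x2] ys rfl rfl g

@[simp] theorem sub3_1_comp {x1 x2 a a' b c : M.Obj} {ys : List M.Obj} (g : M.Hom (x1 :: x2 :: b :: ys) c)
    (p : a ⟶ b) (p' : a' ⟶ a) : M.sub3_1 (M.sub3_1 g p) p' = M.sub3_1 g (p' ≫ p) :=
  (M.assoc [x1, x2] ys [] [] rfl rfl rfl rfl rfl rfl rfl g p p').symm

@[simp] theorem sub4_1_id {x1 x2 x3 b c : M.Obj} {ys : List M.Obj} (g : M.Hom (x1 :: x2 :: x3 :: b :: ys) c) :
    M.sub4_1 g (𝟙 b) = g :=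
  M.sub_id [x1, x2, x3] ys rfl rfl g

@[simp] theorem sub4_1_comp {x1 x2 x3 a a' b c : M.Obj} {ys : List M.Obj} (g : M.Hom (x1 :: x2 :: x3 :: b :: ys) c)
    (p : a ⟶ b) (p' : a' ⟶ a) : M.sub4_1 (M.sub4_1 g p) p' = M.sub4_1 g (p' ≫ p) :=
  (M.assoc [x1, x2, x3] ys [] [] rfl rfl rfl rfl rfl rfl rfl g p p').symm

@[simp] theorem post_sub1_1 {a1 b c d : M.Obj} {ys : List M.Obj} (s : c ⟶ d)
    (g : M.Hom (b :: ys) c) (f : a1 ⟶ b) :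
    M.post s (M.sub1_1 g f) = M.sub1_1 (M.post s g) f :=
  M.post_sub s [] ys rfl rfl g f

@[simp] theorem post_sub1_0 {b c d : M.Obj} {ys : List M.Obj} (s : c ⟶ d)
    (g : M.Hom (b :: ys) c) (f : M.Hom [] b) :
    M.post s (M.sub1_0 g f) = M.sub1_0 (M.post s g) f :=
  M.post_sub s [] ys rfl rfl g f

theorem sub1_0_dinat {b d c : M.Obj} {ys : List M.Obj} (k : b ⟶ d)
    (g : M.Hom (d :: ys) c) (f : M.Hom [] b) :
    M.sub1_0 (M.sub1_1 g k) f = M.sub1_0 g (M.post k f) :=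
  (M.assoc [] ys [] [] rfl rfl rfl rfl rfl rfl rfl g k f).symm

@[simp] theorem sub1_1_sub1_0 {x2 b w c : M.Obj} {ys : List M.Obj}
    (g : M.Hom (b :: x2 :: ys) c) (f : M.Hom [] b) (p : w ⟶ x2) :
    M.sub1_1 (M.sub1_0 g f) p = M.sub1_0 (M.sub2_1 g p) f :=
  M.comm [] [] ys rfl rfl rfl rfl rfl rfl rfl rfl g f p

@[simp] theorem sub2_1_sub1_0 {x2 x3 b w c : M.Obj} {ys : List M.Obj}
    (g : M.Hom (b :: x2 :: x3 :: ys) c) (f : M.Hom [] b) (p : w ⟶ x3) :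
    M.sub2_1 (M.sub1_0 g f) p = M.sub1_0 (M.sub3_1 g p) f :=
  M.comm [] [x2] ys rfl rfl rfl rfl rfl rfl rfl rfl g f p

@[simp] theorem post_sub1_2 {a1 a2 b c d : M.Obj} {ys : List M.Obj} (s : c ⟶ d)
    (g : M.Hom (b :: ys) c) (f : M.Hom [a1, a2] b) :
    M.post s (M.sub1_2 g f) = M.sub1_2 (M.post s g) f :=
  M.post_sub s [] ys rfl rfl g f

theorem sub1_2_dinat {a1 a2 b d c : M.Obj} {ys : List M.Obj} (k : b ⟶ d)
    (g : M.Hom (d :: ys) c) (f : M.Hom [a1, a2] b) :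
    M.sub1_2 (M.sub1_1 g k) f = M.sub1_2 g (M.post k f) :=
  (M.assoc [] ys [] [] rfl rfl rfl rfl rfl rfl rfl g k f).symm

@[simp] theorem sub1_1_sub1_2 {a1 a2 b w c : M.Obj} {ys : List M.Obj}
    (g : M.Hom (b :: ys) c) (f : M.Hom [a1, a2] b) (p : w ⟶ a1) :
    M.sub1_1 (M.sub1_2 g f) p = M.sub1_2 g (M.sub1_1 f p) :=
  (M.assoc [] ys [] [a2] rfl rfl rfl rfl rfl rfl rfl g f p).symm

@[simp] theorem sub2_1_sub1_2 {a1 a2 b w c : M.Obj} {ys : List M.Obj}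
    (g : M.Hom (b :: ys) c) (f : M.Hom [a1, a2] b) (p : w ⟶ a2) :
    M.sub2_1 (M.sub1_2 g f) p = M.sub1_2 g (M.sub2_1 f p) :=
  (M.assoc [] ys [a1] [] rfl rfl rfl rfl rfl rfl rfl g f p).symm

@[simp] theorem sub3_1_sub1_2 {x2 a1 a2 b w c : M.Obj} {ys : List M.Obj}
    (g : M.Hom (b :: x2 :: ys) c) (f : M.Hom [a1, a2] b) (p : w ⟶ x2) :
    M.sub3_1 (M.sub1_2 g f) p = M.sub1_2 (M.sub2_1 g p) f :=
  M.comm [] [] ys rfl rfl rfl rfl rfl rfl rfl rfl g f p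

@[simp] theorem sub4_1_sub1_2 {x2 x3 a1 a2 b w c : M.Obj} {ys : List M.Obj}
    (g : M.Hom (b :: x2 :: x3 :: ys) c) (f : M.Hom [a1, a2] b) (p : w ⟶ x3) :
    M.sub4_1 (M.sub1_2 g f) p = M.sub1_2 (M.sub3_1 g p) f :=
  M.comm [] [x2] ys rfl rfl rfl rfl rfl rfl rfl rfl g f p

@[simp] theorem post_sub1_3 {a1 a2 a3 b c d : M.Obj} {ys : List M.Obj} (s : c ⟶ d)
    (g : M.Hom (b :: ys) c) (f : M.Hom [a1, a2, a3] b) :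
    M.post s (M.sub1_3 g f) = M.sub1_3 (M.post s g) f :=
  M.post_sub s [] ys rfl rfl g f

theorem sub1_3_dinat {a1 a2 a3 b d c : M.Obj} {ys : List M.Obj} (k : b ⟶ d)
    (g : M.Hom (d :: ys) c) (f : M.Hom [a1, a2, a3] b) :
    M.sub1_3 (M.sub1_1 g k) f = M.sub1_3 g (M.post k f) :=
  (M.assoc [] ys [] [] rfl rfl rfl rfl rfl rfl rfl g k f).symm

@[simp] theorem sub1_1_sub1_3 {a1 a2 a3 b w c : M.Obj} {ys : List M.Obj}
    (g : M.Hom (b :: ys) c) (f : M.Hom [a1, a2, a3] b) (p : w ⟶ a1) :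
    M.sub1_1 (M.sub1_3 g f) p = M.sub1_3 g (M.sub1_1 f p) :=
  (M.assoc [] ys [] [a2, a3] rfl rfl rfl rfl rfl rfl rfl g f p).symm

@[simp] theorem sub2_1_sub1_3 {a1 a2 a3 b w c : M.Obj} {ys : List M.Obj}
    (g : M.Hom (b :: ys) c) (f : M.Hom [a1, a2, a3] b) (p : w ⟶ a2) :
    M.sub2_1 (M.sub1_3 g f) p = M.sub1_3 g (M.sub2_1 f p) :=
  (M.assoc [] ys [a1] [a3] rfl rfl rfl rfl rfl rfl rfl g f p).symm

@[simp] theorem sub3_1_sub1_3 {a1 a2 a3 b w c : M.Obj} {ys : List M.Obj}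
    (g : M.Hom (b :: ys) c) (f : M.Hom [a1, a2, a3] b) (p : w ⟶ a3) :
    M.sub3_1 (M.sub1_3 g f) p = M.sub1_3 g (M.sub3_1 f p) :=
  (M.assoc [] ys [a1, a2] [] rfl rfl rfl rfl rfl rfl rfl g f p).symm

@[simp] theorem sub4_1_sub1_3 {x2 a1 a2 a3 b w c : M.Obj} {ys : List M.Obj}
    (g : M.Hom (b :: x2 :: ys) c) (f : M.Hom [a1, a2, a3] b) (p : w ⟶ x2) :
    M.sub4_1 (M.sub1_3 g f) p = M.sub1_3 (M.sub2_1 g p) f :=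
  M.comm [] [] ys rfl rfl rfl rfl rfl rfl rfl rfl g f p

@[simp] theorem post_sub2_1 {x1 a1 b c d : M.Obj} {ys : List M.Obj} (s : c ⟶ d)
    (g : M.Hom (x1 :: b :: ys) c) (f : a1 ⟶ b) :
    M.post s (M.sub2_1 g f) = M.sub2_1 (M.post s g) f :=
  M.post_sub s [x1] ys rfl rfl g f

@[simp] theorem sub1_1_sub2_1 {x1 a1 b w c : M.Obj} {ys : List M.Obj}
    (g : M.Hom (x1 :: b :: ys) c) (f : a1 ⟶ b) (p : w ⟶ x1) :
    M.sub1_1 (M.sub2_1 g f) p = M.sub2_1 (M.sub1_1 g p) f :=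
  (M.comm [] [] ys rfl rfl rfl rfl rfl rfl rfl rfl g p f).symm

@[simp] theorem post_sub2_0 {x1 b c d : M.Obj} {ys : List M.Obj} (s : c ⟶ d)
    (g : M.Hom (x1 :: b :: ys) c) (f : M.Hom [] b) :
    M.post s (M.sub2_0 g f) = M.sub2_0 (M.post s g) f :=
  M.post_sub s [x1] ys rfl rfl g f

theorem sub2_0_dinat {x1 b d c : M.Obj} {ys : List M.Obj} (k : b ⟶ d)
    (g : M.Hom (x1 :: d :: ys) c) (f : M.Hom [] b) :
    M.sub2_0 (M.sub2_1 g k) f = M.sub2_0 g (M.post k f) :=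
  (M.assoc [x1] ys [] [] rfl rfl rfl rfl rfl rfl rfl g k f).symm

@[simp] theorem sub1_1_sub2_0 {x1 b w c : M.Obj} {ys : List M.Obj}
    (g : M.Hom (x1 :: b :: ys) c) (f : M.Hom [] b) (p : w ⟶ x1) :
    M.sub1_1 (M.sub2_0 g f) p = M.sub2_0 (M.sub1_1 g p) f :=
  (M.comm [] [] ys rfl rfl rfl rfl rfl rfl rfl rfl g p f).symm

@[simp] theorem sub2_1_sub2_0 {x1 x3 b w c : M.Obj} {ys : List M.Obj}
    (g : M.Hom (x1 :: b :: x3 :: ys) c) (f : M.Hom [] b) (p : w ⟶ x3) :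
    M.sub2_1 (M.sub2_0 g f) p = M.sub2_0 (M.sub3_1 g p) f :=
  M.comm [x1] [] ys rfl rfl rfl rfl rfl rfl rfl rfl g f p

@[simp] theorem post_sub2_2 {x1 a1 a2 b c d : M.Obj} {ys : List M.Obj} (s : c ⟶ d)
    (g : M.Hom (x1 :: b :: ys) c) (f : M.Hom [a1, a2] b) :
    M.post s (M.sub2_2 g f) = M.sub2_2 (M.post s g) f :=
  M.post_sub s [x1] ys rfl rfl g f

theorem sub2_2_dinat {x1 a1 a2 b d c : M.Obj} {ys : List M.Obj} (k : b ⟶ d)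
    (g : M.Hom (x1 :: d :: ys) c) (f : M.Hom [a1, a2] b) :
    M.sub2_2 (M.sub2_1 g k) f = M.sub2_2 g (M.post k f) :=
  (M.assoc [x1] ys [] [] rfl rfl rfl rfl rfl rfl rfl g k f).symm

@[simp] theorem sub1_1_sub2_2 {x1 a1 a2 b w c : M.Obj} {ys : List M.Obj}
    (g : M.Hom (x1 :: b :: ys) c) (f : M.Hom [a1, a2] b) (p : w ⟶ x1) :
    M.sub1_1 (M.sub2_2 g f) p = M.sub2_2 (M.sub1_1 g p) f :=
  (M.comm [] [] ys rfl rfl rfl rfl rfl rfl rfl rfl g p f).symm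

@[simp] theorem sub2_1_sub2_2 {x1 a1 a2 b w c : M.Obj} {ys : List M.Obj}
    (g : M.Hom (x1 :: b :: ys) c) (f : M.Hom [a1, a2] b) (p : w ⟶ a1) :
    M.sub2_1 (M.sub2_2 g f) p = M.sub2_2 g (M.sub1_1 f p) :=
  (M.assoc [x1] ys [] [a2] rfl rfl rfl rfl rfl rfl rfl g f p).symm

@[simp] theorem sub3_1_sub2_2 {x1 a1 a2 b w c : M.Obj} {ys : List M.Obj}
    (g : M.Hom (x1 :: b :: ys) c) (f : M.Hom [a1, a2] b) (p : w ⟶ a2) :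
    M.sub3_1 (M.sub2_2 g f) p = M.sub2_2 g (M.sub2_1 f p) :=
  (M.assoc [x1] ys [a1] [] rfl rfl rfl rfl rfl rfl rfl g f p).symm

@[simp] theorem sub4_1_sub2_2 {x1 x3 a1 a2 b w c : M.Obj} {ys : List M.Obj}
    (g : M.Hom (x1 :: b :: x3 :: ys) c) (f : M.Hom [a1, a2] b) (p : w ⟶ x3) :
    M.sub4_1 (M.sub2_2 g f) p = M.sub2_2 (M.sub3_1 g p) f :=
  M.comm [x1] [] ys rfl rfl rfl rfl rfl rfl rfl rfl g f p

@[simp] theorem post_sub2_3 {x1 a1 a2 a3 b c d : M.Obj} {ys : List M.Obj} (s : c ⟶ d)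
    (g : M.Hom (x1 :: b :: ys) c) (f : M.Hom [a1, a2, a3] b) :
    M.post s (M.sub2_3 g f) = M.sub2_3 (M.post s g) f :=
  M.post_sub s [x1] ys rfl rfl g f

theorem sub2_3_dinat {x1 a1 a2 a3 b d c : M.Obj} {ys : List M.Obj} (k : b ⟶ d)
    (g : M.Hom (x1 :: d :: ys) c) (f : M.Hom [a1, a2, a3] b) :
    M.sub2_3 (M.sub2_1 g k) f = M.sub2_3 g (M.post k f) :=
  (M.assoc [x1] ys [] [] rfl rfl rfl rfl rfl rfl rfl g k f).symm

@[simp] theorem sub1_1_sub2_3 {x1 a1 a2 a3 b w c : M.Obj} {ys : List M.Obj}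
    (g : M.Hom (x1 :: b :: ys) c) (f : M.Hom [a1, a2, a3] b) (p : w ⟶ x1) :
    M.sub1_1 (M.sub2_3 g f) p = M.sub2_3 (M.sub1_1 g p) f :=
  (M.comm [] [] ys rfl rfl rfl rfl rfl rfl rfl rfl g p f).symm

@[simp] theorem sub2_1_sub2_3 {x1 a1 a2 a3 b w c : M.Obj} {ys : List M.Obj}
    (g : M.Hom (x1 :: b :: ys) c) (f : M.Hom [a1, a2, a3] b) (p : w ⟶ a1) :
    M.sub2_1 (M.sub2_3 g f) p = M.sub2_3 g (M.sub1_1 f p) :=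
  (M.assoc [x1] ys [] [a2, a3] rfl rfl rfl rfl rfl rfl rfl g f p).symm

@[simp] theorem sub3_1_sub2_3 {x1 a1 a2 a3 b w c : M.Obj} {ys : List M.Obj}
    (g : M.Hom (x1 :: b :: ys) c) (f : M.Hom [a1, a2, a3] b) (p : w ⟶ a2) :
    M.sub3_1 (M.sub2_3 g f) p = M.sub2_3 g (M.sub2_1 f p) :=
  (M.assoc [x1] ys [a1] [a3] rfl rfl rfl rfl rfl rfl rfl g f p).symm

@[simp] theorem sub4_1_sub2_3 {x1 a1 a2 a3 b w c : M.Obj} {ys : List M.Obj}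
    (g : M.Hom (x1 :: b :: ys) c) (f : M.Hom [a1, a2, a3] b) (p : w ⟶ a3) :
    M.sub4_1 (M.sub2_3 g f) p = M.sub2_3 g (M.sub3_1 f p) :=
  (M.assoc [x1] ys [a1, a2] [] rfl rfl rfl rfl rfl rfl rfl g f p).symm

@[simp] theorem post_sub3_1 {x1 x2 a1 b c d : M.Obj} {ys : List M.Obj} (s : c ⟶ d)
    (g : M.Hom (x1 :: x2 :: b :: ys) c) (f : a1 ⟶ b) :
    M.post s (M.sub3_1 g f) = M.sub3_1 (M.post s g) f :=
  M.post_sub s [x1, x2] ys rfl rfl g f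

@[simp] theorem sub1_1_sub3_1 {x1 x2 a1 b w c : M.Obj} {ys : List M.Obj}
    (g : M.Hom (x1 :: x2 :: b :: ys) c) (f : a1 ⟶ b) (p : w ⟶ x1) :
    M.sub1_1 (M.sub3_1 g f) p = M.sub3_1 (M.sub1_1 g p) f :=
  (M.comm [] [x2] ys rfl rfl rfl rfl rfl rfl rfl rfl g p f).symm

@[simp] theorem sub2_1_sub3_1 {x1 x2 a1 b w c : M.Obj} {ys : List M.Obj}
    (g : M.Hom (x1 :: x2 :: b :: ys) c) (f : a1 ⟶ b) (p : w ⟶ x2) :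
    M.sub2_1 (M.sub3_1 g f) p = M.sub3_1 (M.sub2_1 g p) f :=
  (M.comm [x1] [] ys rfl rfl rfl rfl rfl rfl rfl rfl g p f).symm

@[simp] theorem post_sub3_0 {x1 x2 b c d : M.Obj} {ys : List M.Obj} (s : c ⟶ d)
    (g : M.Hom (x1 :: x2 :: b :: ys) c) (f : M.Hom [] b) :
    M.post s (M.sub3_0 g f) = M.sub3_0 (M.post s g) f :=
  M.post_sub s [x1, x2] ys rfl rfl g f

theorem sub3_0_dinat {x1 x2 b d c : M.Obj} {ys : List M.Obj} (k : b ⟶ d)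
    (g : M.Hom (x1 :: x2 :: d :: ys) c) (f : M.Hom [] b) :
    M.sub3_0 (M.sub3_1 g k) f = M.sub3_0 g (M.post k f) :=
  (M.assoc [x1, x2] ys [] [] rfl rfl rfl rfl rfl rfl rfl g k f).symm

@[simp] theorem sub1_1_sub3_0 {x1 x2 b w c : M.Obj} {ys : List M.Obj}
    (g : M.Hom (x1 :: x2 :: b :: ys) c) (f : M.Hom [] b) (p : w ⟶ x1) :
    M.sub1_1 (M.sub3_0 g f) p = M.sub3_0 (M.sub1_1 g p) f :=
  (M.comm [] [x2] ys rfl rfl rfl rfl rfl rfl rfl rfl g p f).symm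

@[simp] theorem sub2_1_sub3_0 {x1 x2 b w c : M.Obj} {ys : List M.Obj}
    (g : M.Hom (x1 :: x2 :: b :: ys) c) (f : M.Hom [] b) (p : w ⟶ x2) :
    M.sub2_1 (M.sub3_0 g f) p = M.sub3_0 (M.sub2_1 g p) f :=
  (M.comm [x1] [] ys rfl rfl rfl rfl rfl rfl rfl rfl g p f).symm

@[simp] theorem post_sub3_2 {x1 x2 a1 a2 b c d : M.Obj} {ys : List M.Obj} (s : c ⟶ d)
    (g : M.Hom (x1 :: x2 :: b :: ys) c) (f : M.Hom [a1, a2] b) :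
    M.post s (M.sub3_2 g f) = M.sub3_2 (M.post s g) f :=
  M.post_sub s [x1, x2] ys rfl rfl g f

theorem sub3_2_dinat {x1 x2 a1 a2 b d c : M.Obj} {ys : List M.Obj} (k : b ⟶ d)
    (g : M.Hom (x1 :: x2 :: d :: ys) c) (f : M.Hom [a1, a2] b) :
    M.sub3_2 (M.sub3_1 g k) f = M.sub3_2 g (M.post k f) :=
  (M.assoc [x1, x2] ys [] [] rfl rfl rfl rfl rfl rfl rfl g k f).symm

@[simp] theorem sub1_1_sub3_2 {x1 x2 a1 a2 b w c : M.Obj} {ys : List M.Obj}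
    (g : M.Hom (x1 :: x2 :: b :: ys) c) (f : M.Hom [a1, a2] b) (p : w ⟶ x1) :
    M.sub1_1 (M.sub3_2 g f) p = M.sub3_2 (M.sub1_1 g p) f :=
  (M.comm [] [x2] ys rfl rfl rfl rfl rfl rfl rfl rfl g p f).symm

@[simp] theorem sub2_1_sub3_2 {x1 x2 a1 a2 b w c : M.Obj} {ys : List M.Obj}
    (g : M.Hom (x1 :: x2 :: b :: ys) c) (f : M.Hom [a1, a2] b) (p : w ⟶ x2) :
    M.sub2_1 (M.sub3_2 g f) p = M.sub3_2 (M.sub2_1 g p) f :=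
  (M.comm [x1] [] ys rfl rfl rfl rfl rfl rfl rfl rfl g p f).symm

@[simp] theorem sub3_1_sub3_2 {x1 x2 a1 a2 b w c : M.Obj} {ys : List M.Obj}
    (g : M.Hom (x1 :: x2 :: b :: ys) c) (f : M.Hom [a1, a2] b) (p : w ⟶ a1) :
    M.sub3_1 (M.sub3_2 g f) p = M.sub3_2 g (M.sub1_1 f p) :=
  (M.assoc [x1, x2] ys [] [a2] rfl rfl rfl rfl rfl rfl rfl g f p).symm

@[simp] theorem sub4_1_sub3_2 {x1 x2 a1 a2 b w c : M.Obj} {ys : List M.Obj}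
    (g : M.Hom (x1 :: x2 :: b :: ys) c) (f : M.Hom [a1, a2] b) (p : w ⟶ a2) :
    M.sub4_1 (M.sub3_2 g f) p = M.sub3_2 g (M.sub2_1 f p) :=
  (M.assoc [x1, x2] ys [a1] [] rfl rfl rfl rfl rfl rfl rfl g f p).symm

@[simp] theorem post_sub4_1 {x1 x2 x3 a1 b c d : M.Obj} {ys : List M.Obj} (s : c ⟶ d)
    (g : M.Hom (x1 :: x2 :: x3 :: b :: ys) c) (f : a1 ⟶ b) :
    M.post s (M.sub4_1 g f) = M.sub4_1 (M.post s g) f :=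
  M.post_sub s [x1, x2, x3] ys rfl rfl g f

@[simp] theorem sub1_1_sub4_1 {x1 x2 x3 a1 b w c : M.Obj} {ys : List M.Obj}
    (g : M.Hom (x1 :: x2 :: x3 :: b :: ys) c) (f : a1 ⟶ b) (p : w ⟶ x1) :
    M.sub1_1 (M.sub4_1 g f) p = M.sub4_1 (M.sub1_1 g p) f :=
  (M.comm [] [x2, x3] ys rfl rfl rfl rfl rfl rfl rfl rfl g p f).symm

@[simp] theorem sub2_1_sub4_1 {x1 x2 x3 a1 b w c : M.Obj} {ys : List M.Obj}
    (g : M.Hom (x1 :: x2 :: x3 :: b :: ys) c) (f : a1 ⟶ b) (p : w ⟶ x2) :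
    M.sub2_1 (M.sub4_1 g f) p = M.sub4_1 (M.sub2_1 g p) f :=
  (M.comm [x1] [x3] ys rfl rfl rfl rfl rfl rfl rfl rfl g p f).symm

@[simp] theorem sub3_1_sub4_1 {x1 x2 x3 a1 b w c : M.Obj} {ys : List M.Obj}
    (g : M.Hom (x1 :: x2 :: x3 :: b :: ys) c) (f : a1 ⟶ b) (p : w ⟶ x3) :
    M.sub3_1 (M.sub4_1 g f) p = M.sub4_1 (M.sub3_1 g p) f :=
  (M.comm [x1, x2] [] ys rfl rfl rfl rfl rfl rfl rfl rfl g p f).symm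

end Substitution

set_option maxHeartbeats 1000000 in
/-- The underlying short multicategory, which forgets all multimaps of arity greater than `4`. -/
def toShort (M : Multicat.{v, u}) : ShortMulticat.{v, u} where
  Obj := M.Obj
  cat := M.underlying
  M₀ z := M.Hom [] z
  M₂ a b z := M.Hom [a, b] z
  M₃ a b c z := M.Hom [a, b, c] z
  M₄ a b c d z := M.Hom [a, b, c, d] z
  map₀ s f := M.post s f
  map₂ p q s f := M.sub2_1 (M.sub1_1 (M.post s f) p) q
  map₃ p q r s f := M.sub3_1 (M.sub2_1 (M.sub1_1 (M.post s f) p) q) r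
  map₄ p q r t s f := M.sub4_1 (M.sub3_1 (M.sub2_1 (M.sub1_1 (M.post s f) p) q) r) t
  sub₂₂_1 g f := M.sub1_2 g f
  sub₂₂_2 g f := M.sub2_2 g f
  sub₃₂_1 g f := M.sub1_2 g f
  sub₃₂_2 g f := M.sub2_2 g f
  sub₃₂_3 g f := M.sub3_2 g f
  sub₂₃_1 g f := M.sub1_3 g f
  sub₂₃_2 g f := M.sub2_3 g f
  sub₂₀_1 g f := M.sub1_0 g f
  sub₂₀_2 g f := M.sub2_0 g f
  sub₃₀_1 g f := M.sub1_0 g f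
  sub₃₀_2 g f := M.sub2_0 g f
  sub₃₀_3 g f := M.sub3_0 g f
  map₀_id f := by simp
  map₀_comp s s' f := post_post s s' f
  map₂_id f := by simp
  map₂_comp := by intros; simp
  map₃_id f := by simp
  map₃_comp := by intros; simp
  map₄_id f := by simp
  map₄_comp := by intros; simp
  sub₂₂_1_nat := by intros; simp
  sub₂₂_1_dinat := by intros; simp [sub1_2_dinat]
  sub₂₂_2_nat := by intros; simp
  sub₂₂_2_dinat := by intros; simp [sub2_2_dinat]
  sub₃₂_1_nat := by intros; simp
  sub₃₂_1_dinat := by intros; simp [sub1_2_dinat]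
  sub₃₂_2_nat := by intros; simp
  sub₃₂_2_dinat := by intros; simp [sub2_2_dinat]
  sub₃₂_3_nat := by intros; simp
  sub₃₂_3_dinat := by intros; simp [sub3_2_dinat]
  sub₂₃_1_nat := by intros; simp
  sub₂₃_1_dinat := by intros; simp [sub1_3_dinat]
  sub₂₃_2_nat := by intros; simp
  sub₂₃_2_dinat := by intros; simp [sub2_3_dinat]
  sub₂₀_1_nat r s g f := by
    change M.sub1_1 (M.post s (M.sub1_0 g f)) r = M.sub1_0 (M.sub2_1 (M.sub1_1 (M.post s g) (𝟙 _)) r) f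
    simp
  sub₂₀_1_dinat := by intros; simp [sub1_0_dinat]
  sub₂₀_2_nat r s g f := by
    change M.sub1_1 (M.post s (M.sub2_0 g f)) r = M.sub2_0 (M.sub2_1 (M.sub1_1 (M.post s g) r) (𝟙 _)) f
    simp
  sub₂₀_2_dinat := by intros; simp [sub2_0_dinat]
  sub₃₀_1_nat := by intros; simp
  sub₃₀_1_dinat := by intros; simp [sub1_0_dinat]
  sub₃₀_2_nat := by intros; simp
  sub₃₀_2_dinat := by intros; simp [sub2_0_dinat]
  sub₃₀_3_nat := by intros; simp
  sub₃₀_3_dinat := by intros; simp [sub3_0_dinat]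
  assoc₂_11 {x y z a b c d} f g h :=
    M.assoc [] [y] [] [b] rfl rfl rfl rfl rfl rfl rfl f g h
  assoc₂_12 {x y z a b c d} f g h :=
    M.assoc [] [y] [a] [] rfl rfl rfl rfl rfl rfl rfl f g h
  assoc₂_21 {x y z a b c d} f g h :=
    M.assoc [x] [] [] [b] rfl rfl rfl rfl rfl rfl rfl f g h
  assoc₂_22 {x y z a b c d} f g h :=
    M.assoc [x] [] [a] [] rfl rfl rfl rfl rfl rfl rfl f g h
  assoc₀_11 {x y z a b} f g h := by
    simp only [post_id, sub2_1_id]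
    exact M.assoc [] [y] [] [b] rfl rfl rfl rfl rfl rfl rfl f g h
  assoc₀_12 {x y z a b} f g h := by
    simp only [post_id, sub2_1_id]
    exact M.assoc [] [y] [a] [] rfl rfl rfl rfl rfl rfl rfl f g h
  assoc₀_21 {x y z a b} f g h := by
    simp only [post_id, sub1_1_id]
    exact M.assoc [x] [] [] [b] rfl rfl rfl rfl rfl rfl rfl f g h
  assoc₀_22 {x y z a b} f g h := by
    simp only [post_id, sub1_1_id]
    exact M.assoc [x] [] [a] [] rfl rfl rfl rfl rfl rfl rfl f g h
  comm₂₂ f g h := M.comm [] [] [] rfl rfl rfl rfl rfl rfl rfl rfl f g h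
  comm₂₀ f g h := by
    simp only [sub1_1_id, sub2_1_id]
    exact M.comm [] [] [] rfl rfl rfl rfl rfl rfl rfl rfl f g h
  comm₀₂ f g h := by
    simp only [sub1_1_id, sub2_1_id]
    exact M.comm [] [] [] rfl rfl rfl rfl rfl rfl rfl rfl f g h
  comm₀₀ f g h := by
    exact M.comm [] [] [] rfl rfl rfl rfl rfl rfl rfl rfl f g h

namespace Multifunctor

variable {M N : Multicat.{v, u}} (F : Multifunctor M N)

theorem map_post {l : List M.Obj} {l' : List N.Obj} {c c' : M.Obj} (h : l' = l.map F.obj)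
    (s : c ⟶ c') (g : M.Hom l c) :
    F.map h (M.post s g) = N.post (F.map (l' := [F.obj c]) rfl s) (F.map h g) :=
  F.map_sub [] [] [] [] rfl _ rfl h h rfl rfl _ _ s g

theorem map_sub1_1 {a b c : M.Obj} {ys : List M.Obj} {ys' : List N.Obj} (e : ys' = ys.map F.obj)
    (h : F.obj a :: ys' = (a :: ys).map F.obj)
    (g : M.Hom (b :: ys) c) (p : a ⟶ b) :
    F.map h (M.sub1_1 g p) = N.sub1_1
      (F.map (l' := F.obj b :: ys') (by simp [e]) g) (F.map (l' := [F.obj a]) rfl p) :=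
  F.map_sub [] ys [] ys' rfl rfl _ h rfl rfl e rfl rfl g p

theorem map_sub2_1 {x1 a b c : M.Obj} {ys : List M.Obj} {ys' : List N.Obj} (e : ys' = ys.map F.obj)
    (h : F.obj x1 :: F.obj a :: ys' = (x1 :: a :: ys).map F.obj)
    (g : M.Hom (x1 :: b :: ys) c) (p : a ⟶ b) :
    F.map h (M.sub2_1 g p) = N.sub2_1
      (F.map (l' := F.obj x1 :: F.obj b :: ys') (by simp [e]) g) (F.map (l' := [F.obj a]) rfl p) :=
  F.map_sub [x1] ys [F.obj x1] ys' rfl rfl _ h rfl rfl e rfl rfl g p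

theorem map_sub3_1 {x1 x2 a b c : M.Obj} {ys : List M.Obj} {ys' : List N.Obj} (e : ys' = ys.map F.obj)
    (h : F.obj x1 :: F.obj x2 :: F.obj a :: ys' = (x1 :: x2 :: a :: ys).map F.obj)
    (g : M.Hom (x1 :: x2 :: b :: ys) c) (p : a ⟶ b) :
    F.map h (M.sub3_1 g p) = N.sub3_1
      (F.map (l' := F.obj x1 :: F.obj x2 :: F.obj b :: ys') (by simp [e]) g) (F.map (l' := [F.obj a]) rfl p) :=
  F.map_sub [x1, x2] ys [F.obj x1, F.obj x2] ys' rfl rfl _ h rfl rfl e rfl rfl g p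

theorem map_sub4_1 {x1 x2 x3 a b c : M.Obj} {ys : List M.Obj} {ys' : List N.Obj} (e : ys' = ys.map F.obj)
    (h : F.obj x1 :: F.obj x2 :: F.obj x3 :: F.obj a :: ys' = (x1 :: x2 :: x3 :: a :: ys).map F.obj)
    (g : M.Hom (x1 :: x2 :: x3 :: b :: ys) c) (p : a ⟶ b) :
    F.map h (M.sub4_1 g p) = N.sub4_1
      (F.map (l' := F.obj x1 :: F.obj x2 :: F.obj x3 :: F.obj b :: ys') (by simp [e]) g) (F.map (l' := [F.obj a]) rfl p) :=
  F.map_sub [x1, x2, x3] ys [F.obj x1, F.obj x2, F.obj x3] ys' rfl rfl _ h rfl rfl e rfl rfl g p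

theorem map_pre₂ {a a' b b' z z' : M.Obj} (p : a' ⟶ a) (q : b' ⟶ b)
    (s : z ⟶ z') (f : M.Hom [a, b] z) :
    F.map (l' := [F.obj a', F.obj b']) rfl
      (M.sub2_1 (M.sub1_1 (M.post s f) p) q)
      = N.sub2_1 (N.sub1_1 (N.post (F.map (l' := [F.obj z]) rfl s) (F.map (l' := [F.obj a, F.obj b]) rfl f)) (F.map (l' := [F.obj a']) rfl p)) (F.map (l' := [F.obj b']) rfl q) := by
  rw [F.map_sub2_1 (ys := []) (ys' := []) rfl,
    F.map_sub1_1 (ys := [b]) (ys' := [F.obj b]) rfl, F.map_post]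

theorem map_pre₃ {a a' b b' c c' z z' : M.Obj} (p : a' ⟶ a) (q : b' ⟶ b) (r : c' ⟶ c)
    (s : z ⟶ z') (f : M.Hom [a, b, c] z) :
    F.map (l' := [F.obj a', F.obj b', F.obj c']) rfl
      (M.sub3_1 (M.sub2_1 (M.sub1_1 (M.post s f) p) q) r)
      = N.sub3_1 (N.sub2_1 (N.sub1_1 (N.post (F.map (l' := [F.obj z]) rfl s) (F.map (l' := [F.obj a, F.obj b, F.obj c]) rfl f)) (F.map (l' := [F.obj a']) rfl p)) (F.map (l' := [F.obj b']) rfl q)) (F.map (l' := [F.obj c']) rfl r) := by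
  rw [F.map_sub3_1 (ys := []) (ys' := []) rfl,
    F.map_sub2_1 (ys := [c]) (ys' := [F.obj c]) rfl,
    F.map_sub1_1 (ys := [b, c]) (ys' := [F.obj b, F.obj c]) rfl, F.map_post]

theorem map_pre₄ {a a' b b' c c' d d' z z' : M.Obj} (p : a' ⟶ a) (q : b' ⟶ b) (r : c' ⟶ c) (t : d' ⟶ d)
    (s : z ⟶ z') (f : M.Hom [a, b, c, d] z) :
    F.map (l' := [F.obj a', F.obj b', F.obj c', F.obj d']) rfl
      (M.sub4_1 (M.sub3_1 (M.sub2_1 (M.sub1_1 (M.post s f) p) q) r) t)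
      = N.sub4_1 (N.sub3_1 (N.sub2_1 (N.sub1_1 (N.post (F.map (l' := [F.obj z]) rfl s) (F.map (l' := [F.obj a, F.obj b, F.obj c, F.obj d]) rfl f)) (F.map (l' := [F.obj a']) rfl p)) (F.map (l' := [F.obj b']) rfl q)) (F.map (l' := [F.obj c']) rfl r)) (F.map (l' := [F.obj d']) rfl t) := by
  rw [F.map_sub4_1 (ys := []) (ys' := []) rfl,
    F.map_sub3_1 (ys := [d]) (ys' := [F.obj d]) rfl,
    F.map_sub2_1 (ys := [c, d]) (ys' := [F.obj c, F.obj d]) rfl,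
    F.map_sub1_1 (ys := [b, c, d]) (ys' := [F.obj b, F.obj c, F.obj d]) rfl, F.map_post]

end Multifunctor

/-- The forgetful functor from multicategories to short multicategories. -/
def U : Multicat.{v, u} ⥤ ShortMulticat.{v, u} where
  obj M := M.toShort
  map {M N} F :=
    { functor :=
        { obj := F.obj
          map := fun {a b} f => F.map (l := [a]) (l' := [F.obj a]) rfl f
          map_id := F.map_id
          map_comp := fun f g =>
            F.map_sub [] [] [] [] rfl rfl rfl rfl rfl rfl rfl rfl rfl g f }
      F₀ := fun f => F.map (l' := []) rfl f
      F₂ := fun {a b z} f => F.map (l' := [F.obj a, F.obj b]) rfl f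
      F₃ := fun {a b c z} f => F.map (l' := [F.obj a, F.obj b, F.obj c]) rfl f
      F₄ := fun {a b c d z} f => F.map (l' := [F.obj a, F.obj b, F.obj c, F.obj d]) rfl f
      nat₀ := F.map_post rfl
      nat₂ := F.map_pre₂
      nat₃ := F.map_pre₃
      nat₄ := F.map_pre₄
      comm_sub₂₂_1 := fun {x y z a b} g f =>
        F.map_sub [] [y] [] [F.obj y] rfl rfl rfl rfl rfl rfl rfl rfl rfl g f
      comm_sub₂₂_2 := fun {x y z a b} g f =>
        F.map_sub [x] [] [F.obj x] [] rfl rfl rfl rfl rfl rfl rfl rfl rfl g f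
      comm_sub₃₂_1 := fun {x y w z a b} g f =>
        F.map_sub [] [y, w] [] [F.obj y, F.obj w] rfl rfl rfl rfl rfl rfl rfl rfl rfl g f
      comm_sub₃₂_2 := fun {x y w z a b} g f =>
        F.map_sub [x] [w] [F.obj x] [F.obj w] rfl rfl rfl rfl rfl rfl rfl rfl rfl g f
      comm_sub₃₂_3 := fun {x y w z a b} g f =>
        F.map_sub [x, y] [] [F.obj x, F.obj y] [] rfl rfl rfl rfl rfl rfl rfl rfl rfl g f
      comm_sub₂₃_1 := fun {x y z a b c} g f =>
        F.map_sub [] [y] [] [F.obj y] rfl rfl rfl rfl rfl rfl rfl rfl rfl g f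
      comm_sub₂₃_2 := fun {x y z a b c} g f =>
        F.map_sub [x] [] [F.obj x] [] rfl rfl rfl rfl rfl rfl rfl rfl rfl g f
      comm_sub₂₀_1 := fun {x y z} g f =>
        F.map_sub [] [y] [] [F.obj y] rfl rfl rfl rfl rfl rfl rfl rfl rfl g f
      comm_sub₂₀_2 := fun {x y z} g f =>
        F.map_sub [x] [] [F.obj x] [] rfl rfl rfl rfl rfl rfl rfl rfl rfl g f
      comm_sub₃₀_1 := fun {x y w z} g f =>
        F.map_sub [] [y, w] [] [F.obj y, F.obj w] rfl rfl rfl rfl rfl rfl rfl rfl rfl g f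
      comm_sub₃₀_2 := fun {x y w z} g f =>
        F.map_sub [x] [w] [F.obj x] [F.obj w] rfl rfl rfl rfl rfl rfl rfl rfl rfl g f
      comm_sub₃₀_3 := fun {x y w z} g f =>
        F.map_sub [x, y] [] [F.obj x, F.obj y] [] rfl rfl rfl rfl rfl rfl rfl rfl rfl g f }
  map_id M := rfl
  map_comp F G := rfl

/-- `θ` is a left universal multimap, in particular a map classifier. -/
def IsLeftUniversal (M : Multicat.{v, u}) {l : List M.Obj} {m : M.Obj} (θ : M.Hom l m) : Prop :=
  ∀ (ys r : List M.Obj) (hr : r = l ++ ys) (d : M.Obj),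
    Function.Bijective (fun f : M.Hom (m :: ys) d => M.sub [] ys rfl hr f θ)

/-- `θ` is a multimap which is universal in every variable, in particular a map classifier. -/
def IsUniversal (M : Multicat.{v, u}) {l : List M.Obj} {m : M.Obj} (θ : M.Hom l m) : Prop :=
  ∀ (xs ys r : List M.Obj) (hr : r = xs ++ (l ++ ys)) (d : M.Obj),
    Function.Bijective (fun f : M.Hom (xs ++ m :: ys) d => M.sub xs ys rfl hr f θ)

/-- Left representable multicategories. -/
def isLeftRepresentable : ObjectProperty Multicat.{v, u} := fun M =>
  ∀ l : List M.Obj, ∃ (m : M.Obj) (θ : M.Hom l m), M.IsLeftUniversal θ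

/-- Representable multicategories. -/
def isRepresentable : ObjectProperty Multicat.{v, u} := fun M =>
  ∀ l : List M.Obj, ∃ (m : M.Obj) (θ : M.Hom l m), M.IsUniversal θ

/-- Closed multicategories. -/
def isClosed : ObjectProperty Multicat.{v, u} := fun M =>
  ∀ b c : M.Obj, ∃ (h : M.Obj) (e : M.Hom [h, b] c), ∀ (xs r : List M.Obj) (hr : r = xs ++ [b]),
    Function.Bijective (fun f : M.Hom xs h => M.sub [] [b] rfl hr e f)

/-- Representable closed multicategories. -/
def isClosedRepresentable : ObjectProperty Multicat.{v, u} := isRepresentable ⊓ isClosed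

theorem isClosedRepresentable_le : isClosedRepresentable.{v, u} ≤ isLeftRepresentable := by
  rintro M ⟨h, -⟩ l
  obtain ⟨m, θ, hθ⟩ := h l
  exact ⟨m, θ, fun ys r hr d => hθ [] ys r hr d⟩

/-- A choice of a left universal multimap for every list of objects. -/
structure Classifiers (M : Multicat.{v, u}) where
  m : List M.Obj → M.Obj
  θ : ∀ l : List M.Obj, M.Hom l (m l)
  univ : ∀ l : List M.Obj, M.IsLeftUniversal (θ l)

theorem nonempty_classifiers {M : Multicat.{v, u}} (h : isLeftRepresentable M) :
    Nonempty M.Classifiers := by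
  choose m θ hθ using h
  exact ⟨⟨m, θ, hθ⟩⟩

theorem pre_id (M : Multicat.{v, u}) {a b c : M.Obj} (g : M.Hom [a, b] c) :
    M.sub2_1 (M.sub1_1 g (𝟙 a)) (𝟙 b) = g := by
  rw [sub1_1_id, sub2_1_id]

namespace Classifiers

variable {M : Multicat.{v, u}} (L : M.Classifiers)

/-- The nullary and binary classifiers, in the underlying short multicategory. -/
def toShort : M.toShort.Classifiers where
  unit := L.m []
  u := L.θ []
  u_univ :=
    { bij₀ := fun z => L.univ [] [] [] rfl z
      bij₁ := fun x z => L.univ [] [x] [x] rfl z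
      bij₂ := fun x y z => L.univ [] [x, y] [x, y] rfl z }
  tensor a b := L.m [a, b]
  θ a b := L.θ [a, b]
  θ_univ a b :=
    { bij₁ := fun z => by
        have h : (fun f : L.m [a, b] ⟶ z => M.sub2_1 (M.sub1_1 (M.post f (L.θ [a, b])) (𝟙 a)) (𝟙 b))
            = fun f : L.m [a, b] ⟶ z => M.post f (L.θ [a, b]) := by
          funext f
          exact M.pre_id _
        have h' := L.univ [a, b] [] [a, b] rfl z
        exact (congrArg Function.Bijective h).mpr h'
      bij₂ := fun x z => L.univ [a, b] [x] [a, b, x] rfl z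
      bij₃ := fun x y z => L.univ [a, b] [x, y] [a, b, x, y] rfl z }

/-- The map out of the classifying object which corresponds to a multimap. -/
noncomputable def desc {l : List M.Obj} {b : M.Obj} (f : M.Hom l b) : L.m l ⟶ b :=
  ((L.univ l [] l (by simp) b).2 f).choose

theorem desc_spec {l : List M.Obj} {b : M.Obj} (f : M.Hom l b) : M.post (L.desc f) (L.θ l) = f :=
  ((L.univ l [] l (by simp) b).2 f).choose_spec

/-- The binary map which corresponds to a ternary map. -/
noncomputable def desc₂ {a b c d : M.Obj} (f : M.Hom [a, b, c] d) : M.Hom [L.m [a, b], c] d :=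
  ((L.univ [a, b] [c] [a, b, c] rfl d).2 f).choose

theorem desc₂_spec {a b c d : M.Obj} (f : M.Hom [a, b, c] d) :
    M.sub1_2 (L.desc₂ f) (L.θ [a, b]) = f :=
  ((L.univ [a, b] [c] [a, b, c] rfl d).2 f).choose_spec

/-- The binary map out of the unit which corresponds to a unary map. -/
noncomputable def desc₀ {a b : M.Obj} (f : a ⟶ b) : M.Hom [L.m [], a] b :=
  ((L.univ [] [a] [a] rfl b).2 f).choose

theorem desc₀_spec {a b : M.Obj} (f : a ⟶ b) : M.sub1_0 (L.desc₀ f) (L.θ []) = f :=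
  ((L.univ [] [a] [a] rfl b).2 f).choose_spec

/-- The structure maps defined by the universal properties of the classifiers. -/
noncomputable def tensorData : L.toShort.TensorData where
  tensorHom {a a' b b'} f g := L.desc (M.sub2_1 (M.sub1_1 (L.θ [a', b']) f) g)
  α a b c := L.desc (L.desc₂ (M.sub2_2 (L.θ [a, L.m [b, c]]) (L.θ [b, c])))
  lam a := L.desc (L.desc₀ (𝟙 a))
  rho a := M.sub2_0 (L.θ [a, L.m []]) (L.θ [])
  tensorHom_spec {a a' b b'} f g := (M.pre_id _).trans ((L.desc_spec _).trans
    (congrArg (fun h : M.Hom [a', b'] _ => M.sub2_1 (M.sub1_1 h f) g)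
      (post_id (L.θ [a', b'])).symm))
  α_spec a b c := (M.toShort.post₂₂_1 _ _ _).trans
    ((congrArg (fun h : M.Hom [L.m [a, b], c] _ => M.sub1_2 h (L.θ [a, b]))
      ((M.pre_id _).trans (L.desc_spec _))).trans (L.desc₂_spec _))
  lam_spec a := (M.toShort.post₂₀_1 _ _ _).trans
    ((congrArg (fun h : M.Hom [L.m [], a] a => M.sub1_0 h (L.θ []))
      ((M.pre_id _).trans (L.desc_spec _))).trans (L.desc₀_spec _))
  rho_spec _ := rfl

end Classifiers

/-- The structure maps of the lax monoidal functor of `F`, defined by universal properties. -/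
noncomputable def laxData {M N : Multicat.{v, u}} (L : M.Classifiers) (L' : N.Classifiers)
    (F : M ⟶ N) : ShortMulticat.LaxData L.toShort L'.toShort (U.map F) where
  f₀ := L'.desc (F.map (l' := []) rfl (L.θ []))
  f₂ a b := L'.desc (F.map (l' := [F.obj a, F.obj b]) rfl (L.θ [a, b]))
  f₀_spec := L'.desc_spec _
  f₂_spec _ _ := (N.pre_id _).trans (L'.desc_spec _)

/-- A choice of left universal multimaps for every left representable multicategory. -/
abbrev Choice := ∀ M : isLeftRepresentable.{v, u}.FullSubcategory, M.obj.Classifiers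

/-- The functor from left representable multicategories to left normal skew monoidal categories:
`a ⊗ b` and the unit are the chosen classifiers, and `f ⊗ g`, `α`, `λ`, `ρ`, `f₀`, `f₂` are
determined by the universal properties. -/
noncomputable def T (κ : Choice.{v, u}) :
    isLeftRepresentable.{v, u}.FullSubcategory ⥤ SkewMonCat.isLeftNormal.{v, u}.FullSubcategory where
  obj M := ⟨(κ M).tensorData.toSkewMonCat, (κ M).tensorData.isLeftNormal_toSkewMonCat⟩
  map {M N} F := ObjectProperty.homMk ((laxData (κ M) (κ N) F.hom).toLaxFunctor _ _)
  map_id M := by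
    have h := ShortMulticat.LaxData.ext' (laxData (κ M) (κ M) (𝟙 M.obj))
      (ShortMulticat.idLaxData (κ M).toShort)
    apply ObjectProperty.hom_ext
    exact SkewMonCat.LaxFunctor.ext rfl (heq_of_eq h.1) (heq_of_eq h.2)
  map_comp {M N P} F G := by
    have h := ShortMulticat.LaxData.ext' (laxData (κ M) (κ P) (F.hom ≫ G.hom))
      ((laxData (κ M) (κ N) F.hom).comp (laxData (κ N) (κ P) G.hom))
    apply ObjectProperty.hom_ext
    exact SkewMonCat.LaxFunctor.ext rfl (heq_of_eq h.1) (heq_of_eq h.2)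

end Multicat

/-! ## Restrictions to the representable closed case -/

/-- The full subcategory of representable closed multicategories. -/
abbrev MultiRepCl := Multicat.isClosedRepresentable.{v, u}.FullSubcategory

/-- The full subcategory of representable closed short multicategories. -/
abbrev ShortMultiRepCl := ShortMulticat.isClosedRepresentable.{v, u}.FullSubcategory

/-- The full subcategory of closed monoidal categories. -/
abbrev MonCl := SkewMonCat.isClosedMonoidal.{v, u}.FullSubcategory

/-- The inclusion of representable closed into left representable multicategories. -/
abbrev multiIncl : MultiRepCl.{v, u} ⥤ Multicat.isLeftRepresentable.{v, u}.FullSubcategory :=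
  ObjectProperty.ιOfLE Multicat.isClosedRepresentable_le

/-- The inclusion of representable closed into left representable short multicategories. -/
abbrev shortMultiIncl :
    ShortMultiRepCl.{v, u} ⥤ ShortMulticat.isLeftRepresentable.{v, u}.FullSubcategory :=
  ObjectProperty.ιOfLE ShortMulticat.isClosedRepresentable_le

/-- The restriction of `K`, provided that it takes values in closed monoidal categories. -/
noncomputable def KRepCl (χ : ShortMulticat.Choice.{v, u})
    (h : ∀ C : ShortMultiRepCl.{v, u},
      SkewMonCat.isClosedMonoidal ((ShortMulticat.K χ).obj (shortMultiIncl.obj C)).obj) :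
    ShortMultiRepCl.{v, u} ⥤ MonCl.{v, u} :=
  SkewMonCat.isClosedMonoidal.lift
    (shortMultiIncl ⋙ ShortMulticat.K χ ⋙ SkewMonCat.isLeftNormal.ι) h

/-- The restriction of `U`, provided that it takes values in representable closed short
multicategories. -/
def URepCl (h : ∀ M : MultiRepCl.{v, u},
      ShortMulticat.isClosedRepresentable (Multicat.U.obj M.obj)) :
    MultiRepCl.{v, u} ⥤ ShortMultiRepCl.{v, u} :=
  ShortMulticat.isClosedRepresentable.lift (Multicat.isClosedRepresentable.ι ⋙ Multicat.U) h

/-- The restriction of `T`, provided that it takes values in closed monoidal categories. -/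
noncomputable def TRepCl (κ : Multicat.Choice.{v, u})
    (h : ∀ M : MultiRepCl.{v, u},
      SkewMonCat.isClosedMonoidal ((Multicat.T κ).obj (multiIncl.obj M)).obj) :
    MultiRepCl.{v, u} ⥤ MonCl.{v, u} :=
  SkewMonCat.isClosedMonoidal.lift
    (multiIncl ⋙ Multicat.T κ ⋙ SkewMonCat.isLeftNormal.ι) h

/-! In a left representable short multicategory every multimap is built from unary ones. A nullary
map is a map out of the unit, a binary map is a map out of a tensor product, and a map of arity 3 or
4 is one of arity one less with some `θ` substituted in its first variable. A morphism out of it is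
therefore determined by its functor and the images of `u` and of the `θ a b`. Conversely, such
images extend to a morphism as soon as they are compatible with `f ⊗ g`, `α`, `λ` and `ρ`
(`Extension.toMorphism`, `Extension.toMorphism_eq`). If the target has classifiers too, these images
are the same thing as `f₀` and `f₂`, and the compatibilities are the axioms of a lax monoidal
functor (`Extension.ofLax`). Hence `K` is fully faithful.

For essential surjectivity, a skew monoidal category `D` has a multicategory `toMulticat`, whose
multimaps are the maps out of `((i a₁) ⋯) aₙ`. To substitute `f` after variables with product `x`, a
unit is inserted by `ρ`, moved by `α`, and `f` is applied next to `x` (`whiskerList`). The five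
axioms are what the multicategory laws need: the pentagon and `rho_α` give associativity
(`substMap_substMap`), `α_lam` and `rho_lam` give the left unit law, `rho_α_lam` gives the right
one. Commutativity needs only naturality (`substMap_comm`). If `λ` is invertible, then maps `i a ⟶
b` are maps `a ⟶ b`, the maps `λ ⊗ 1` are classifiers, and `D` is recovered up to isomorphism
(`toUnaryIso`).

In the restricted statement, universality in later variables makes `α` and `ρ` invertible, and
internal homs give right adjoints (`isMonoidal_toSkewMonCat`, `isClosed_toSkewMonCat`). Conversely,
the multicategory of a closed monoidal category is representable and closed
(`isClosedRepresentable_toMulticat`), which gives essential surjectivity of the restrictions of `K`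
and `U` together.

A morphism between underlying short multicategories extends uniquely to all arities when its source
is left representable: classifiers are peeled off the first two variables until the arity is small.
Preservation of substitution reduces in the same way to maps of arity at most 2 substituted in one
of the first two positions (`preservesSub`). So `U` is fully faithful there (`U_map_bijective`).
Finally, two choices of classifiers give skew monoidal categories that are canonically isomorphic
over the identity functor (`changeIso`); this makes the triangle commute, and `T` is an equivalence
because `K` and `U` are. -/

/-! ## The multicategory of a skew monoidal category -/

namespace SkewMonCat

/-! ### Left-bracketed tensor products of lists, and substitution along them. -/

section TensorList

variable (D : SkewMonCat.{v, u})

/-- The tensor product of `x` and the objects of a list, bracketed from the left. -/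
@[reducible] def tensorList : D.Obj → List D.Obj → D.Obj
  | x, [] => x
  | x, a :: l => tensorList (D.tensor x a) l

/-- The action of `tensorList` on morphisms of its first argument. -/
def tensorListMap : ∀ {x y : D.Obj} (l : List D.Obj), (x ⟶ y) →
    (D.tensorList x l ⟶ D.tensorList y l)
  | _, _, [], f => f
  | _, _, a :: l, f => tensorListMap l (D.tensorHom f (𝟙 a))

/-- The comparison `(xy)l ⟶ x(yl)` built from the associativity maps. -/
def assocList (x : D.Obj) : ∀ (y : D.Obj) (l : List D.Obj),
    D.tensorList (D.tensor x y) l ⟶ D.tensor x (D.tensorList y l)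
  | _, [] => 𝟙 _
  | y, a :: l => D.tensorListMap l (D.α x y a) ≫ assocList x (D.tensor y a) l

variable {D}

theorem tensorHom_id_comp {x a b c : D.Obj} (f : a ⟶ b) (g : b ⟶ c) :
    D.tensorHom (𝟙 x) (f ≫ g) = D.tensorHom (𝟙 x) f ≫ D.tensorHom (𝟙 x) g := by
  rw [← D.tensorHom_comp, Category.comp_id]

theorem tensorHom_comp_id {x a b c : D.Obj} (f : a ⟶ b) (g : b ⟶ c) :
    D.tensorHom (f ≫ g) (𝟙 x) = D.tensorHom f (𝟙 x) ≫ D.tensorHom g (𝟙 x) := by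
  rw [← D.tensorHom_comp, Category.comp_id]

@[simp] theorem tensorListMap_id (x : D.Obj) (l : List D.Obj) :
    D.tensorListMap l (𝟙 x) = 𝟙 _ := by
  induction l generalizing x with
  | nil => rfl
  | cons a l ih =>
    simp only [tensorListMap, D.tensorHom_id, ih]

theorem tensorListMap_comp {x y z : D.Obj} (l : List D.Obj) (f : x ⟶ y) (g : y ⟶ z) :
    D.tensorListMap l (f ≫ g) = D.tensorListMap l f ≫ D.tensorListMap l g := by
  induction l generalizing x y z with
  | nil => rfl
  | cons a l ih => simp only [tensorListMap, tensorHom_comp_id, ih]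

theorem isIso_tensorHom {a a' b b' : D.Obj} (f : a ⟶ a') (g : b ⟶ b') [IsIso f] [IsIso g] :
    IsIso (D.tensorHom f g) :=
  ⟨D.tensorHom (inv f) (inv g), by simp [← D.tensorHom_comp, D.tensorHom_id],
    by simp [← D.tensorHom_comp, D.tensorHom_id]⟩

theorem isIso_tensorListMap {x y : D.Obj} (l : List D.Obj) (f : x ⟶ y) [IsIso f] :
    IsIso (D.tensorListMap l f) :=
  ⟨D.tensorListMap l (inv f), by simp [← tensorListMap_comp], by simp [← tensorListMap_comp]⟩

theorem assocList_naturality {x x' y y' : D.Obj} (l : List D.Obj) (f : x ⟶ x') (g : y ⟶ y') :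
    D.tensorListMap l (D.tensorHom f g) ≫ D.assocList x' y' l
      = D.assocList x y l ≫ D.tensorHom f (D.tensorListMap l g) := by
  induction l generalizing y y' with
  | nil => simp [tensorListMap, assocList]
  | cons a l ih =>
    simp only [tensorListMap, assocList, Category.assoc]
    rw [← ih, ← Category.assoc, ← Category.assoc, ← tensorListMap_comp, ← tensorListMap_comp,
      D.α_naturality]

/-- An iterated pentagon. Each further object of the list costs one pentagon, applied under
`tensorListMap l`, and one use of `assocList_naturality` to bring `1 ⊗ α` into place. -/
theorem assocList_pentagon (x y z : D.Obj) (l : List D.Obj) :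
    D.assocList (D.tensor x y) z l ≫ D.α x y (D.tensorList z l)
      = D.tensorListMap l (D.α x y z) ≫ D.assocList x (D.tensor y z) l
        ≫ D.tensorHom (𝟙 x) (D.assocList y z l) := by
  induction l generalizing z with
  | nil => simp [tensorListMap, assocList, D.tensorHom_id, tensorList]
  | cons a l ih =>
    simp only [tensorListMap, assocList, Category.assoc, tensorHom_id_comp]
    erw [ih]
    have h := congrArg (D.tensorListMap l) (D.pentagon x y z a)
    simp only [tensorListMap_comp] at h
    have n := assocList_naturality (D := D) l (𝟙 x) (D.α y z a)
    rw [← reassoc_of% n, ← reassoc_of% h]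

/-- The list version of the axiom `α_lam`, which is applied once for every object of `l`. -/
theorem assocList_lam (y : D.Obj) (l : List D.Obj) :
    D.assocList D.unit y l ≫ D.lam (D.tensorList y l) = D.tensorListMap l (D.lam y) := by
  induction l generalizing y with
  | nil => simp [tensorListMap, assocList, tensorList]
  | cons a l ih =>
    simp only [tensorListMap, assocList, Category.assoc]
    erw [ih]
    rw [← tensorListMap_comp, D.α_lam]

theorem isIso_assocList (h : ∀ a b c, IsIso (D.α a b c)) (x y : D.Obj) (l : List D.Obj) :
    IsIso (D.assocList x y l) := by
  induction l generalizing y with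
  | nil => exact inferInstanceAs (IsIso (𝟙 _))
  | cons a l ih =>
    have := isIso_tensorListMap l (D.α x y a)
    have := ih (D.tensor y a)
    exact IsIso.comp_isIso

/-- The map `xl ⟶ xb` obtained from a map `il ⟶ b`. -/
def whiskerList {l : List D.Obj} {b : D.Obj} (f : D.tensorList D.unit l ⟶ b) (x : D.Obj) :
    D.tensorList x l ⟶ D.tensor x b :=
  D.tensorListMap l (D.rho x) ≫ D.assocList x D.unit l ≫ D.tensorHom (𝟙 x) f

theorem whiskerList_naturality {l : List D.Obj} {b x x' : D.Obj} (f : D.tensorList D.unit l ⟶ b)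
    (g : x ⟶ x') :
    D.tensorListMap l g ≫ whiskerList f x' = whiskerList f x ≫ D.tensorHom g (𝟙 b) := by
  simp only [whiskerList, Category.assoc, ← D.tensorHom_comp, Category.comp_id, Category.id_comp]
  rw [← Category.assoc, ← tensorListMap_comp, D.rho_naturality, tensorListMap_comp, Category.assoc,
    ← Category.assoc (D.tensorListMap l (D.tensorHom g (𝟙 D.unit))), assocList_naturality,
    Category.assoc, tensorListMap_id, ← D.tensorHom_comp, Category.id_comp, Category.comp_id]

theorem whiskerList_comp {l : List D.Obj} {b c : D.Obj} (f : D.tensorList D.unit l ⟶ b)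
    (g : b ⟶ c) (x : D.Obj) :
    whiskerList (f ≫ g) x = whiskerList f x ≫ D.tensorHom (𝟙 x) g := by
  simp only [whiskerList, tensorHom_id_comp, Category.assoc]

/-- Whiskering by `y` and then by `x` agrees with whiskering by `x ⊗ y`, up to associativity. The
unit inserted next to `y` is traded by `rho_α` for one inserted next to `x ⊗ y`; the iterated
pentagon and naturality of `α` in `f` do the rest. -/
theorem assocList_whiskerList {l : List D.Obj} {b : D.Obj} (f : D.tensorList D.unit l ⟶ b)
    (x y : D.Obj) :
    D.assocList x y l ≫ D.tensorHom (𝟙 x) (whiskerList f y)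
      = whiskerList f (D.tensor x y) ≫ D.α x y b := by
  simp only [whiskerList, tensorHom_id_comp, Category.assoc]
  have e1 := assocList_naturality (D := D) l (𝟙 x) (D.rho y)
  rw [← reassoc_of% e1, ← D.rho_α, tensorListMap_comp, Category.assoc]
  have e2 := assocList_pentagon x y D.unit l
  rw [← reassoc_of% e2, ← D.α_naturality, D.tensorHom_id]

/-- Naturality moves `λ` before `f`, `assocList_lam` moves it to the front, and there `rho_lam`
cancels it against `ρ`. This is the left unit law of the multicategory. -/
theorem whiskerList_unit {l : List D.Obj} {b : D.Obj} (f : D.tensorList D.unit l ⟶ b) :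
    whiskerList f D.unit ≫ D.lam b = f := by
  simp only [whiskerList, Category.assoc]
  rw [D.lam_naturality, reassoc_of% (assocList_lam D.unit l), ← Category.assoc,
    ← tensorListMap_comp, D.rho_lam, tensorListMap_id, Category.id_comp]

/-- For a one-element list the composite is exactly the left side of the axiom `rho_α_lam`. This is
the right unit law of the multicategory. -/
theorem whiskerList_lam (b x : D.Obj) :
    whiskerList (l := [b]) (D.lam b) x = 𝟙 _ := by
  refine Eq.trans ?_ (D.rho_α_lam x b)
  simp only [whiskerList, tensorListMap, assocList, Category.comp_id]

theorem isIso_whiskerList (h : isMonoidal D) {l : List D.Obj} {b : D.Obj}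
    (f : D.tensorList D.unit l ⟶ b) [IsIso f] (x : D.Obj) : IsIso (whiskerList f x) := by
  have := h.2.2 x
  have := isIso_tensorListMap l (D.rho x)
  have := isIso_assocList h.1 x D.unit l
  have := isIso_tensorHom (𝟙 x) f
  exact IsIso.comp_isIso

/-- The map `x(l ++ ys) ⟶ z ys` obtained from a map `xl ⟶ z`. -/
def appendMapAux : ∀ {x z : D.Obj} (as ys : List D.Obj), (D.tensorList x as ⟶ z) →
    (D.tensorList x (as ++ ys) ⟶ D.tensorList z ys)
  | _, _, [], ys, φ => D.tensorListMap ys φ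
  | _, _, _ :: as, ys, φ => appendMapAux as ys φ

/-- The map `x(l ++ ys) ⟶ z ys` obtained from a map `xl ⟶ z`, with the list `l ++ ys` given up to
equality. -/
def appendMap {x z : D.Obj} {r as : List D.Obj} (ys : List D.Obj) (h : r = as ++ ys)
    (φ : D.tensorList x as ⟶ z) : D.tensorList x r ⟶ D.tensorList z ys := by
  subst h
  exact appendMapAux as ys φ

theorem appendMap_cons {x z a : D.Obj} {r as ys : List D.Obj} (h : a :: r = (a :: as) ++ ys)
    (φ : D.tensorList (D.tensor x a) as ⟶ z) :
    appendMap (D := D) (x := x) (as := a :: as) ys h φ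
      = appendMap (x := D.tensor x a) ys (List.cons.inj h).2 φ := by
  obtain rfl := (List.cons.inj h).2
  rfl

/-- Under the identification of `x(as ++ ys)` with `(x as)ys`, the map `appendMap ys` is
`tensorListMap ys`. This lemma and the next two express its functoriality, without ever using the
identification as a morphism. -/
theorem tensorListMap_appendMap {x x' z : D.Obj} {r as ys : List D.Obj} (h : r = as ++ ys)
    (g : x ⟶ x') (φ : D.tensorList x' as ⟶ z) :
    D.tensorListMap r g ≫ appendMap ys h φ = appendMap ys h (D.tensorListMap as g ≫ φ) := by
  induction as generalizing x x' r with
  | nil =>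
    obtain rfl : r = ys := h
    exact (tensorListMap_comp _ g φ).symm
  | cons a as ih =>
    subst h
    exact ih rfl (D.tensorHom g (𝟙 a)) φ

theorem appendMap_tensorListMap {x z z' : D.Obj} {r as ys : List D.Obj} (h : r = as ++ ys)
    (φ : D.tensorList x as ⟶ z) (g : z ⟶ z') :
    appendMap ys h φ ≫ D.tensorListMap ys g = appendMap ys h (φ ≫ g) := by
  induction as generalizing x r with
  | nil =>
    obtain rfl : r = ys := h
    exact (tensorListMap_comp _ φ g).symm
  | cons a as ih =>
    subst h
    exact ih rfl φ

theorem appendMap_append {x z w : D.Obj} {q r as vs ys : List D.Obj} (hq : q = as ++ vs)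
    (hr : r = q ++ ys) (hr' : r = as ++ (vs ++ ys)) (φ : D.tensorList x as ⟶ z)
    (ψ : D.tensorList z vs ⟶ w) :
    appendMap ys hr (appendMap vs hq φ ≫ ψ)
      = appendMap (vs ++ ys) hr' φ ≫ appendMap ys rfl ψ := by
  induction as generalizing x q r with
  | nil =>
    obtain rfl : q = vs := hq
    subst hr
    exact (tensorListMap_appendMap rfl φ ψ).symm
  | cons a as ih =>
    subst hq hr
    simp only [List.cons_append, appendMap_cons]
    exact ih rfl rfl (by simp) φ

theorem appendMap_right_nil {x z : D.Obj} {as : List D.Obj} (h : as = as ++ [])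
    (φ : D.tensorList x as ⟶ z) : appendMap [] h φ = φ := by
  induction as generalizing x with
  | nil => rfl
  | cons a as ih => exact (appendMap_cons h φ).trans (ih _ φ)

theorem isIso_appendMap {x z : D.Obj} {r as ys : List D.Obj} (h : r = as ++ ys)
    (φ : D.tensorList x as ⟶ z) [IsIso φ] : IsIso (appendMap ys h φ) := by
  induction as generalizing x r with
  | nil =>
    obtain rfl : r = ys := h
    exact isIso_tensorListMap _ φ
  | cons a as ih =>
    subst h
    exact ih rfl φ

theorem assocList_appendMap {x y z : D.Obj} {r as ys : List D.Obj} (h : r = as ++ ys)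
    (φ : D.tensorList y as ⟶ z) :
    D.assocList x y r ≫ D.tensorHom (𝟙 x) (appendMap ys h φ)
      = appendMap ys h (D.assocList x y as ≫ D.tensorHom (𝟙 x) φ) ≫ D.assocList x z ys := by
  induction as generalizing y r with
  | nil =>
    obtain rfl : r = ys := h
    refine (assocList_naturality _ (𝟙 x) φ).symm.trans ?_
    simp only [assocList]
    erw [Category.id_comp]
    rfl
  | cons a as ih =>
    subst h
    simp only [List.cons_append, appendMap_cons, assocList, Category.assoc]
    rw [ih rfl, ← Category.assoc, tensorListMap_appendMap]

/-- The map `x(xs ++ as ++ ys) ⟶ x(xs ++ b :: ys)` obtained from a map `i as ⟶ b`. -/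
def substMapAux {as : List D.Obj} {b : D.Obj} (f : D.tensorList D.unit as ⟶ b) :
    ∀ (x : D.Obj) (xs ys : List D.Obj),
      (D.tensorList x (xs ++ (as ++ ys)) ⟶ D.tensorList x (xs ++ b :: ys))
  | x, [], ys => appendMap ys rfl (whiskerList f x)
  | x, a :: xs, ys => substMapAux f (D.tensor x a) xs ys

/-- The map `x(xs ++ as ++ ys) ⟶ x(xs ++ b :: ys)` obtained from a map `i as ⟶ b`, with both lists
given up to equality. -/
def substMap {l r as : List D.Obj} {b : D.Obj} (f : D.tensorList D.unit as ⟶ b)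
    (x : D.Obj) (xs ys : List D.Obj) (hl : l = xs ++ b :: ys) (hr : r = xs ++ (as ++ ys)) :
    D.tensorList x r ⟶ D.tensorList x l := by
  subst hl hr
  exact substMapAux f x xs ys

theorem substMap_cons {l r as : List D.Obj} {a b : D.Obj} (f : D.tensorList D.unit as ⟶ b)
    (x : D.Obj) (xs ys : List D.Obj) (hl : a :: l = (a :: xs) ++ b :: ys)
    (hr : a :: r = (a :: xs) ++ (as ++ ys)) :
    substMap f x (a :: xs) ys hl hr
      = substMap f (D.tensor x a) xs ys (List.cons.inj hl).2 (List.cons.inj hr).2 := by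
  obtain rfl := (List.cons.inj hl).2
  obtain rfl := (List.cons.inj hr).2
  rfl

theorem substMap_naturality {l r as : List D.Obj} {b : D.Obj} (f : D.tensorList D.unit as ⟶ b)
    {x x' : D.Obj} (xs ys : List D.Obj) (hl : l = xs ++ b :: ys) (hr : r = xs ++ (as ++ ys))
    (g : x ⟶ x') :
    D.tensorListMap r g ≫ substMap f x' xs ys hl hr
      = substMap f x xs ys hl hr ≫ D.tensorListMap l g := by
  subst hl hr
  induction xs generalizing x x' with
  | nil =>
    refine (tensorListMap_appendMap rfl g (whiskerList f x')).trans ?_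
    rw [whiskerList_naturality, ← appendMap_tensorListMap]
    rfl
  | cons a xs ih => exact ih (D.tensorHom g (𝟙 a))

/-- Substitution does not see how the objects to its left are bracketed. The objects before the
substituted variable are absorbed into `y`, which leaves the case of `assocList_whiskerList`. -/
theorem assocList_substMap {l r as : List D.Obj} {b : D.Obj} (f : D.tensorList D.unit as ⟶ b)
    (x y : D.Obj) (xs ys : List D.Obj) (hl : l = xs ++ b :: ys) (hr : r = xs ++ (as ++ ys)) :
    D.assocList x y r ≫ D.tensorHom (𝟙 x) (substMap f y xs ys hl hr)
      = substMap f (D.tensor x y) xs ys hl hr ≫ D.assocList x y l := by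
  subst hl hr
  induction xs generalizing y with
  | nil =>
    refine (assocList_appendMap rfl (whiskerList f y)).trans ?_
    rw [assocList_whiskerList, ← appendMap_tensorListMap, Category.assoc]
    rfl
  | cons a xs ih =>
    simp only [List.cons_append, assocList, Category.assoc]
    refine (congrArg (_ ≫ ·) (ih (D.tensor y a))).trans ?_
    rw [← Category.assoc, substMap_naturality, Category.assoc]
    rfl

/-- The core of associativity: both ingredients of whiskering, the insertion of a unit and the
reassociation, commute with a substitution performed inside the list. -/
theorem whiskerList_substMap {l r as : List D.Obj} {b c : D.Obj}
    (f : D.tensorList D.unit as ⟶ b) (x : D.Obj) (xs ys : List D.Obj) (hl : l = xs ++ b :: ys)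
    (hr : r = xs ++ (as ++ ys)) (g : D.tensorList D.unit l ⟶ c) :
    whiskerList (substMap f D.unit xs ys hl hr ≫ g) x
      = substMap f x xs ys hl hr ≫ whiskerList g x := by
  simp only [whiskerList, tensorHom_id_comp]
  rw [reassoc_of% (assocList_substMap f x D.unit xs ys hl hr),
    reassoc_of% (substMap_naturality f xs ys hl hr (D.rho x))]

theorem appendMap_substMap {m p q r as : List D.Obj} {d x z : D.Obj} (us vs ys : List D.Obj)
    (f : D.tensorList D.unit as ⟶ d) (hm : m = us ++ d :: vs) (hq : q = us ++ (as ++ vs))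
    (hp : p = m ++ ys) (hp' : p = us ++ d :: (vs ++ ys)) (hr : r = q ++ ys)
    (hr' : r = us ++ (as ++ (vs ++ ys))) (φ : D.tensorList x m ⟶ z) :
    appendMap ys hr (substMap f x us vs hm hq ≫ φ)
      = substMap f x us (vs ++ ys) hp' hr' ≫ appendMap ys hp φ := by
  induction us generalizing x m p q r with
  | nil =>
    subst hm hq hp hr'
    exact appendMap_append (as := as) (vs := vs) (z := D.tensor x d) rfl hr rfl (whiskerList f x) φ
  | cons a us ih =>
    subst hm hq hp hr
    simp only [List.cons_append, appendMap_cons, substMap_cons]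
    exact ih rfl rfl rfl (by simp) rfl (by simp) φ

/-- Associativity of substitution. The variables `xs` are absorbed into `x`; then the inner
substitution passes through the whiskering (`whiskerList_substMap`) and through the trailing
variables `ys` (`appendMap_substMap`). -/
theorem substMap_substMap {l m p q r as : List D.Obj} {b d : D.Obj} (xs ys us vs : List D.Obj)
    (hl : l = xs ++ b :: ys) (hm : m = us ++ d :: vs) (hp : p = xs ++ (m ++ ys))
    (hp' : p = (xs ++ us) ++ d :: (vs ++ ys)) (hq : q = us ++ (as ++ vs))
    (hr : r = xs ++ (q ++ ys)) (hr' : r = (xs ++ us) ++ (as ++ (vs ++ ys))) (x : D.Obj)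
    (g : D.tensorList D.unit m ⟶ b) (f : D.tensorList D.unit as ⟶ d) :
    substMap (substMap f D.unit us vs hm hq ≫ g) x xs ys hl hr
      = substMap f x (xs ++ us) (vs ++ ys) hp' hr' ≫ substMap g x xs ys hl hp := by
  induction xs generalizing x l p r with
  | nil =>
    subst hl hr hp
    refine Eq.trans ?_ (appendMap_substMap us vs ys f hm hq rfl hp' rfl hr' (whiskerList g x))
    rw [← whiskerList_substMap]
    rfl
  | cons a xs ih =>
    subst hl hr hp
    simp only [List.cons_append, substMap_cons]
    exact ih rfl rfl (by simpa using hp') rfl (by simpa using hr') (D.tensor x a)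

theorem substMap_appendMap {p r as bs : List D.Obj} {d x z : D.Obj} (ys zs : List D.Obj)
    (hp : p = as ++ (ys ++ d :: zs)) (hp' : p = (as ++ ys) ++ d :: zs)
    (hr : r = (as ++ ys) ++ (bs ++ zs)) (hr' : r = as ++ (ys ++ (bs ++ zs)))
    (f : D.tensorList D.unit bs ⟶ d) (φ : D.tensorList x as ⟶ z) :
    substMap f x (as ++ ys) zs hp' hr ≫ appendMap (ys ++ d :: zs) hp φ
      = appendMap (ys ++ (bs ++ zs)) hr' φ ≫ substMap f z ys zs rfl rfl := by
  induction as generalizing x p r with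
  | nil =>
    subst hp hr
    exact (substMap_naturality f ys zs rfl rfl φ).symm
  | cons a as ih =>
    subst hp hr
    simp only [List.cons_append, appendMap_cons, substMap_cons]
    exact ih rfl (by simp) rfl (by simp) φ

/-- Once `xs` is absorbed into `x`, the map for `g` changes only the object to the left of `ys`, in
which the substitution of `f` is natural. No coherence axiom enters, only naturality of `α` and `ρ`.
-/
theorem substMap_comm {l p q r as bs : List D.Obj} {b d : D.Obj} (xs ys zs : List D.Obj)
    (hl : l = xs ++ b :: (ys ++ d :: zs)) (hl' : l = (xs ++ b :: ys) ++ d :: zs)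
    (hp : p = xs ++ (as ++ (ys ++ d :: zs))) (hp' : p = (xs ++ as ++ ys) ++ d :: zs)
    (hq : q = (xs ++ b :: ys) ++ (bs ++ zs)) (hq' : q = xs ++ b :: (ys ++ (bs ++ zs)))
    (hr : r = (xs ++ as ++ ys) ++ (bs ++ zs)) (hr' : r = xs ++ (as ++ (ys ++ (bs ++ zs))))
    (x : D.Obj) (g : D.tensorList D.unit as ⟶ b) (f : D.tensorList D.unit bs ⟶ d) :
    substMap f x (xs ++ as ++ ys) zs hp' hr ≫ substMap g x xs (ys ++ d :: zs) hl hp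
      = substMap g x xs (ys ++ (bs ++ zs)) hq' hr' ≫ substMap f x (xs ++ b :: ys) zs hl' hq := by
  induction xs generalizing x l p q r with
  | nil =>
    subst hl hp hq hr
    exact substMap_appendMap ys zs rfl hp' rfl hr' f (whiskerList g x)
  | cons a xs ih =>
    subst hl hp hq hr
    simp only [List.cons_append, substMap_cons]
    exact ih rfl (by simp) rfl (by simp) rfl (by simp) rfl (by simp) (D.tensor x a)

theorem substMap_lam {l : List D.Obj} {b : D.Obj} (x : D.Obj) (xs ys : List D.Obj)
    (hl : l = xs ++ b :: ys) (hr : l = xs ++ ([b] ++ ys)) :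
    substMap (as := [b]) (D.lam b) x xs ys hl hr = 𝟙 _ := by
  subst hl
  induction xs generalizing x with
  | nil => exact (congrArg (D.tensorListMap ys) (whiskerList_lam b x)).trans (tensorListMap_id _ _)
  | cons a xs ih => exact ih (D.tensor x a) rfl

theorem isIso_substMap (h : isMonoidal D) {l r as : List D.Obj} {b : D.Obj}
    (f : D.tensorList D.unit as ⟶ b) [IsIso f] (x : D.Obj) (xs ys : List D.Obj)
    (hl : l = xs ++ b :: ys) (hr : r = xs ++ (as ++ ys)) : IsIso (substMap f x xs ys hl hr) := by
  subst hl hr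
  induction xs generalizing x with
  | nil =>
    have := isIso_whiskerList h f x
    exact isIso_appendMap (ys := ys) rfl (whiskerList f x)
  | cons a xs ih => exact ih (D.tensor x a)

end TensorList

/-- The multicategory of a skew monoidal category: a multimap from `a₁, …, aₙ` to `b` is a map
`((i a₁) ⋯) aₙ ⟶ b`. -/
def toMulticat (D : SkewMonCat.{v, u}) : Multicat.{v, u} where
  Obj := D.Obj
  Hom l b := D.tensorList D.unit l ⟶ b
  id a := D.lam a
  sub xs ys hl hr g f := substMap f D.unit xs ys hl hr ≫ g
  id_sub {as b} hr f := by
    have h : substMap f D.unit [] [] rfl hr = whiskerList f D.unit :=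
      (show _ = appendMap [] (by simp) (whiskerList f D.unit) by
        have key : ∀ (r : List D.Obj) (e : r = [] ++ (as ++ [])) (e' : r = as ++ []),
            substMap f D.unit [] [] rfl e = appendMap [] e' (whiskerList f D.unit) := by
          rintro r rfl e'
          rfl
        exact key as hr (by simp)).trans (appendMap_right_nil _ _)
    exact (congrArg (· ≫ D.lam b) h).trans (whiskerList_unit f)
  sub_id xs ys hl hr g := by
    rw [substMap_lam, Category.id_comp]
  assoc xs ys us vs hl hm hp hp' hq hr hr' h g f := by
    rw [substMap_substMap xs ys us vs hl hm hp hp' hq hr hr', Category.assoc]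
  comm xs ys zs hl hl' hp hp' hq hq' hr hr' h g f := by
    rw [← Category.assoc, substMap_comm xs ys zs hl hl' hp hp' hq hq' hr hr', Category.assoc]

end SkewMonCat

/-! ### Universality and closedness pass to the underlying short multicategory. -/

namespace Multicat

variable {M : Multicat.{v, u}}

theorem IsLeftUniversal.nullary {i : M.Obj} {u : M.Hom [] i} (h : M.IsLeftUniversal u) :
    M.toShort.IsLeftUniversalNullary u where
  bij₀ z := h [] [] rfl z
  bij₁ x z := h [x] [x] rfl z
  bij₂ x y z := h [x, y] [x, y] rfl z

theorem map₂_id_id {a b z z' : M.Obj} (f : M.Hom [a, b] z) (s : z ⟶ z') :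
    M.toShort.map₂ (𝟙 a) (𝟙 b) s f = M.post s f := M.pre_id _

theorem map₃_id_id {a b c z z' : M.Obj} (f : M.Hom [a, b, c] z) (s : z ⟶ z') :
    M.toShort.map₃ (𝟙 a) (𝟙 b) (𝟙 c) s f = M.post s f := by
  change M.sub3_1 (M.sub2_1 (M.sub1_1 (M.post s f) (𝟙 a)) (𝟙 b)) (𝟙 c) = M.post s f
  rw [sub1_1_id, sub2_1_id, sub3_1_id]

theorem IsLeftUniversal.binary {a b m : M.Obj} {θ : M.Hom [a, b] m} (h : M.IsLeftUniversal θ) :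
    M.toShort.IsLeftUniversalBinary θ where
  bij₁ z := (congrArg Function.Bijective (funext fun f => map₂_id_id θ f)).mpr
    (h [] [a, b] rfl z)
  bij₂ x z := h [x] [a, b, x] rfl z
  bij₃ x y z := h [x, y] [a, b, x, y] rfl z

theorem IsUniversal.isLeftUniversal {l : List M.Obj} {m : M.Obj} {θ : M.Hom l m}
    (h : M.IsUniversal θ) : M.IsLeftUniversal θ := fun ys r hr d => h [] ys r hr d

theorem IsUniversal.nullary {i : M.Obj} {u : M.Hom [] i} (h : M.IsUniversal u) :
    M.toShort.IsUniversalNullary u where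
  toIsLeftUniversalNullary := h.isLeftUniversal.nullary
  bij₂_2 x z := h [x] [] [x] rfl z
  bij₃_2 x y z := h [x] [y] [x, y] rfl z
  bij₃_3 x y z := h [x, y] [] [x, y] rfl z

theorem IsUniversal.binary {a b m : M.Obj} {θ : M.Hom [a, b] m} (h : M.IsUniversal θ) :
    M.toShort.IsUniversalBinary θ where
  toIsLeftUniversalBinary := h.isLeftUniversal.binary
  bij₂_2 x z := h [x] [] [x, a, b] rfl z
  bij₃_2 x y z := h [x] [y] [x, a, b, y] rfl z
  bij₃_3 x y z := h [x, y] [] [x, y, a, b] rfl z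

theorem isClosedRepresentable_toShort (h : isClosedRepresentable M) :
    ShortMulticat.isClosedRepresentable M.toShort := by
  refine ⟨⟨?_, fun a b => ?_⟩, fun b c => ?_⟩
  · obtain ⟨i, u, hu⟩ := h.1 []
    exact ⟨i, u, hu.nullary⟩
  · obtain ⟨m, θ, hθ⟩ := h.1 [a, b]
    exact ⟨m, θ, hθ.binary⟩
  · obtain ⟨k, e, he⟩ := h.2 b c
    refine ⟨k, e, he [] [b] rfl, fun x => ?_, fun x y => he [x, y] [x, y, b] rfl,
      fun x y w => he [x, y, w] [x, y, w, b] rfl⟩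
    exact (congrArg Function.Bijective (funext fun f => (sub2_1_id _).trans
      (congrArg (fun g : M.Hom [k, b] c => M.sub1_1 g f) (post_id e)))).mpr (he [x] [x, b] rfl)

end Multicat

/-! ### Universal multimaps and internal homs in the multicategory of `D`. -/

namespace SkewMonCat

variable {D : SkewMonCat.{v, u}}

theorem bijective_comp_left {C : Type u} [Category.{v} C] {a b : C} (k : a ⟶ b) [IsIso k] (c : C) :
    Function.Bijective (fun f : b ⟶ c => k ≫ f) :=
  ⟨fun _ _ h => (cancel_epi k).1 h, fun g => ⟨inv k ≫ g, by simp⟩⟩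

/-- Substitution in the first variable whiskers only by the unit object, and there
`whiskerList_unit` shows that the whiskered map differs from `θ` by `λ`. This is why invertibility
of `α` and `ρ` is not needed. -/
theorem isLeftUniversal_toMulticat (h : isLeftNormal D) {l : List D.Obj} {m : D.Obj}
    (θ : D.tensorList D.unit l ⟶ m) [IsIso θ] :
    D.toMulticat.IsLeftUniversal (l := l) (m := m) θ := by
  intro ys r hr d
  have := h m
  have : IsIso (whiskerList θ D.unit ≫ D.lam m) := by
    rw [whiskerList_unit]
    infer_instance
  have : IsIso (whiskerList θ D.unit) := IsIso.of_isIso_comp_right _ (D.lam m)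
  have : IsIso (substMap θ D.unit [] ys rfl hr) := by
    subst hr
    exact isIso_appendMap (ys := ys) rfl (whiskerList θ D.unit)
  exact bijective_comp_left (substMap θ D.unit [] ys rfl hr) d

/-- In a later variable the whiskering object is arbitrary, so the whiskered map contains genuine
instances of `ρ` and `α`, which must be invertible. -/
theorem isUniversal_toMulticat (h : isMonoidal D) {l : List D.Obj} {m : D.Obj}
    (θ : D.tensorList D.unit l ⟶ m) [IsIso θ] :
    D.toMulticat.IsUniversal (l := l) (m := m) θ := by
  intro xs ys r hr d
  have := isIso_substMap h θ D.unit xs ys rfl hr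
  exact bijective_comp_left (substMap θ D.unit xs ys rfl hr) d

theorem isRepresentable_toMulticat (h : isMonoidal D) :
    Multicat.isRepresentable D.toMulticat :=
  fun l => ⟨D.tensorList D.unit l, 𝟙 _, isUniversal_toMulticat h (𝟙 _)⟩

theorem isClosed_toMulticat (h : isClosed D) : Multicat.isClosed D.toMulticat := by
  intro (b : D.Obj) (c : D.Obj)
  have := h b
  let adj := Adjunction.ofIsLeftAdjoint (D.tensorRight b)
  let k : D.Obj := (D.tensorRight b).rightAdjoint.obj c
  -- A binary multimap starts at `(i k) b`, so the counit of the adjunction has to be preceded by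
  -- `λ` to become the evaluation.
  refine ⟨k, D.tensorHom (D.lam k) (𝟙 b) ≫ adj.counit.app c, ?_⟩
  intro (xs : List D.Obj) r hr
  subst hr
  -- The two objects coincide only by induction on `xs`, so their identification is carried by an
  -- isomorphism.
  let j : D.tensorList D.unit (xs ++ [b]) ⟶ D.tensor (D.tensorList D.unit xs) b :=
    appendMap (as := xs) [b] rfl (𝟙 _)
  have : IsIso j := isIso_appendMap (ys := [b]) rfl (𝟙 _)
  -- Substituting `f` in the evaluation is transposition along the adjunction, followed by
  -- precomposition with `j`: the `λ` in the evaluation turns the whiskered `f` back into `f`.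
  have key : (fun f : D.toMulticat.Hom xs k => D.toMulticat.sub [] [b] rfl rfl
      (show D.toMulticat.Hom [k, b] c from D.tensorHom (D.lam k) (𝟙 b) ≫ adj.counit.app c) f)
      = (fun g : D.tensor (D.tensorList D.unit xs) b ⟶ c => j ≫ g)
        ∘ (adj.homEquiv (D.tensorList D.unit xs) c).symm := by
    funext (f : D.tensorList D.unit xs ⟶ k)
    have e : appendMap [b] rfl (whiskerList f D.unit)
        = j ≫ D.tensorHom (whiskerList f D.unit) (𝟙 b) :=
      (congrArg (appendMap [b] rfl) (Category.id_comp _).symm).trans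
        (appendMap_tensorListMap (ys := [b]) rfl (𝟙 _) (whiskerList f D.unit)).symm
    refine Eq.trans ?_ (congrArg (j ≫ ·) (adj.homEquiv_counit _ _ f)).symm
    let ε : D.tensor k b ⟶ c := adj.counit.app c
    change appendMap [b] rfl (whiskerList f D.unit) ≫ D.tensorHom (D.lam k) (𝟙 b) ≫ ε
      = j ≫ D.tensorHom f (𝟙 b) ≫ ε
    rw [e, Category.assoc, ← Category.assoc (D.tensorHom _ _), ← tensorHom_comp_id,
      whiskerList_unit]
  exact (congrArg Function.Bijective key).mpr
    ((bijective_comp_left j c).comp (Equiv.bijective _))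

theorem isClosedRepresentable_toMulticat (h : isClosedMonoidal D) :
    Multicat.isClosedRepresentable D.toMulticat :=
  ⟨isRepresentable_toMulticat h.1, isClosed_toMulticat h.2⟩

/-! ### Recovering a left normal skew monoidal category from its multicategory. -/

/-- The classifiers of the multicategory of `D` given by the unit and the tensor product of `D`. -/
def classifiers (h : isLeftNormal D) : D.toMulticat.toShort.Classifiers where
  unit := D.unit
  u := 𝟙 D.unit
  u_univ := (isLeftUniversal_toMulticat h (l := []) (𝟙 D.unit)).nullary
  tensor := D.tensor
  -- The source of a binary multimap is `(i a) b`. Composing with `λ ⊗ 1` makes the classifying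
  -- object the tensor product of `D` itself; left normality makes this map invertible, hence left
  -- universal.
  θ (a : D.Obj) (b : D.Obj) := D.tensorHom (D.lam a) (D.cat.id b)
  θ_univ (a : D.Obj) (b : D.Obj) :=
    have := h a
    have : IsIso (D.tensorHom (D.lam a) (D.cat.id b)) := isIso_tensorHom _ _
    (isLeftUniversal_toMulticat h (l := [a, b]) (D.tensorHom (D.lam a) (D.cat.id b))).binary

/-- The identification of the maps of `D` with the unary maps of its multicategory. -/
def toUnary {a b : D.Obj} (f : a ⟶ b) : D.toMulticat.Hom [a] b :=
  (D.lam a ≫ f : D.tensor D.unit a ⟶ b)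

/-- The `λ` contained in `toUnary f` is absorbed by the left unit law. This is also what makes
`toUnary` functorial. -/
theorem post_toUnary {l : List D.Obj} {b c : D.Obj} (f : b ⟶ c) (g : D.tensorList D.unit l ⟶ b) :
    D.toMulticat.post (l := l) (toUnary f) g = (g ≫ f : D.tensorList D.unit l ⟶ c) := by
  have h : substMap g D.unit [] [] rfl (List.append_nil l).symm ≫ D.lam b = g :=
    D.toMulticat.id_sub (as := l) (List.append_nil l).symm g
  refine Eq.trans ?_ (congrArg (fun k => k ≫ f) h)
  exact (Category.assoc _ _ _).symm

theorem whiskerList_toUnary {a b : D.Obj} (f : a ⟶ b) (x : D.Obj) :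
    whiskerList (l := [a]) (D.lam a ≫ f) x = D.tensorHom (𝟙 x) f := by
  rw [whiskerList_comp, whiskerList_lam, Category.id_comp]

theorem toUnary_injective {a b : D.Obj} (h : isLeftNormal D) :
    Function.Injective (toUnary : (a ⟶ b) → _) := by
  intro f g e
  have := h a
  exact (cancel_epi (D.lam a)).1 e

/-- Whiskering inserts a unit by `ρ`, and the classifier removes it by `λ`. Naturality of `α` brings
the two together, `rho_α_lam` cancels them, and only the outer `α` remains. -/
theorem whiskerList_binary (a b c : D.Obj) :
    whiskerList (l := [b, c]) (D.tensorHom (D.lam b) (𝟙 c)) a = D.α a b c := by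
  change D.tensorHom (D.tensorHom (D.rho a) (𝟙 b)) (𝟙 c) ≫ (D.tensorHom (D.α a D.unit b) (𝟙 c)
    ≫ D.α a (D.tensor D.unit b) c ≫ 𝟙 _) ≫ D.tensorHom (𝟙 a) (D.tensorHom (D.lam b) (𝟙 c)) = _
  rw [Category.comp_id, Category.assoc, ← D.α_naturality, ← Category.assoc, ← Category.assoc,
    ← tensorHom_comp_id, ← tensorHom_comp_id, Category.assoc, D.rho_α_lam, D.tensorHom_id,
    Category.id_comp]

/-- This lemma and the next four evaluate in `D` the multimaps that occur in the specification of
`TensorData`. They show that `f ⊗ g`, `α`, `λ` and `ρ` of `D` satisfy the equations by which the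
corresponding maps of the multicategory are determined. -/
theorem map₂_toUnary (h : isLeftNormal D) {a a' b b' : D.Obj} (p : a ⟶ a') (q : b ⟶ b') :
    D.toMulticat.toShort.map₂ (toUnary p) (toUnary q) (𝟙 _) ((classifiers h).θ a' b')
      = (D.tensorHom (D.lam a) (𝟙 b) ≫ D.tensorHom p q :
          D.tensor (D.tensor D.unit a) b ⟶ D.tensor a' b') := by
  refine (congrArg (fun k => D.toMulticat.sub2_1 (D.toMulticat.sub1_1 k (toUnary p)) (toUnary q))
    (Multicat.post_id _)).trans ?_
  change whiskerList (l := [b]) (D.lam b ≫ q) (D.tensor D.unit a)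
    ≫ D.tensorHom (whiskerList (l := [a]) (D.lam a ≫ p) D.unit) (𝟙 b')
    ≫ D.tensorHom (D.lam a') (𝟙 b') = _
  simp only [whiskerList_toUnary, ← D.tensorHom_comp, Category.comp_id, Category.id_comp,
    D.lam_naturality]

theorem sub₂₂_1_classifiers (h : isLeftNormal D) (a b c : D.Obj) :
    D.toMulticat.toShort.sub₂₂_1 ((classifiers h).θ ((classifiers h).tensor a b) c)
        ((classifiers h).θ a b)
      = (D.tensorHom (D.tensorHom (D.lam a) (𝟙 b)) (𝟙 c) :
          D.tensor (D.tensor (D.tensor D.unit a) b) c ⟶ D.tensor (D.tensor a b) c) := by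
  change D.tensorHom (whiskerList (l := [a, b]) (D.tensorHom (D.lam a) (𝟙 b)) D.unit) (𝟙 c)
    ≫ D.tensorHom (D.lam (D.tensor a b)) (𝟙 c) = _
  rw [← tensorHom_comp_id, whiskerList_unit]

theorem sub₂₂_2_classifiers (h : isLeftNormal D) (a b c : D.Obj) :
    D.toMulticat.toShort.sub₂₂_2 ((classifiers h).θ a ((classifiers h).tensor b c))
        ((classifiers h).θ b c)
      = (D.tensorHom (D.tensorHom (D.lam a) (𝟙 b)) (𝟙 c) ≫ D.α a b c :
          D.tensor (D.tensor (D.tensor D.unit a) b) c ⟶ D.tensor a (D.tensor b c)) := by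
  change whiskerList (l := [b, c]) (D.tensorHom (D.lam b) (𝟙 c)) (D.tensor D.unit a)
    ≫ D.tensorHom (D.lam a) (𝟙 (D.tensor b c)) = _
  rw [← whiskerList_naturality, whiskerList_binary]
  rfl

theorem sub₂₀_1_classifiers (h : isLeftNormal D) (a : D.Obj) :
    D.toMulticat.toShort.sub₂₀_1 ((classifiers h).θ (classifiers h).unit a) (classifiers h).u
      = (𝟙 (D.tensor D.unit a) : D.tensor D.unit a ⟶ D.tensor D.unit a) := by
  change D.tensorHom (whiskerList (l := []) (𝟙 D.unit) D.unit) (𝟙 a)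
    ≫ D.tensorHom (D.lam D.unit) (𝟙 a) = _
  rw [← tensorHom_comp_id, whiskerList_unit, D.tensorHom_id]

theorem sub₂₀_2_classifiers (h : isLeftNormal D) (a : D.Obj) :
    D.toMulticat.toShort.sub₂₀_2 ((classifiers h).θ a (classifiers h).unit) (classifiers h).u
      = toUnary (D.rho a) := by
  change (D.rho (D.tensor D.unit a) ≫ 𝟙 _ ≫ D.tensorHom (𝟙 (D.tensor D.unit a)) (𝟙 D.unit))
    ≫ D.tensorHom (D.lam a) (𝟙 D.unit) = D.lam a ≫ D.rho a
  rw [D.tensorHom_id, Category.comp_id, Category.comp_id, ← D.rho_naturality]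

theorem comp_id_eq_id_comp {C : Type u} [Category.{v} C] {a b : C} {f g : a ⟶ b} (h : f = g) :
    f ≫ 𝟙 b = 𝟙 a ≫ g := by
  simp [h]

/-- When `f₀` and `f₂` are identities, each axiom of a lax monoidal functor says only that one
structure map is preserved; `m` is the image of that map. The three lemmas serve both directions of
`toUnaryIso`. -/
theorem strict_associativity (E : SkewMonCat.{v, u}) {a b c : E.Obj}
    {m : E.tensor (E.tensor a b) c ⟶ E.tensor a (E.tensor b c)} (h : m = E.α a b c) :
    E.tensorHom (𝟙 (E.tensor a b)) (𝟙 c) ≫ 𝟙 _ ≫ m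
      = E.α a b c ≫ E.tensorHom (𝟙 a) (𝟙 (E.tensor b c)) ≫ 𝟙 _ := by
  simp [h, E.tensorHom_id]

theorem strict_left_unitality (E : SkewMonCat.{v, u}) {a : E.Obj}
    {m : E.tensor E.unit a ⟶ a} (h : m = E.lam a) :
    E.tensorHom (𝟙 E.unit) (𝟙 a) ≫ 𝟙 _ ≫ m = E.lam a := by
  simp [h, E.tensorHom_id]

theorem strict_right_unitality (E : SkewMonCat.{v, u}) {a : E.Obj}
    {m : a ⟶ E.tensor a E.unit} (h : m = E.rho a) :
    E.rho a ≫ E.tensorHom (𝟙 a) (𝟙 E.unit) ≫ 𝟙 _ = m := by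
  simp [h, E.tensorHom_id]

section Comparison

variable (h : isLeftNormal D) (T : (classifiers h).TensorData)

/-- Maps out of a classifying object are determined by what they do to the classifier, and both
sides solve the same equation. The same argument treats `α` and `λ`; for `ρ` the defining formula
itself is evaluated. -/
theorem toUnary_tensorHom {a a' b b' : D.Obj} (p : a ⟶ a') (q : b ⟶ b') :
    toUnary (D.tensorHom p q) = T.tensorHom (toUnary p) (toUnary q) := by
  apply (classifiers h).ext₂
  refine Eq.trans ?_ (T.tensorHom_spec (toUnary p) (toUnary q)).symm
  rw [map₂_toUnary]
  exact (Multicat.map₂_id_id (M := D.toMulticat) _ _).trans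
    (post_toUnary (l := [a, b]) _ _)

theorem toUnary_α (a b c : D.Obj) : toUnary (D.α a b c) = T.α a b c := by
  apply (classifiers h).ext₃
  refine Eq.trans ?_ (T.α_spec a b c).symm
  rw [sub₂₂_2_classifiers, sub₂₂_1_classifiers]
  refine Eq.trans ?_ (post_toUnary (l := [a, b, c]) (D.α a b c) _)
  exact Multicat.map₃_id_id (M := D.toMulticat) _ _

theorem toUnary_lam (a : D.Obj) : toUnary (D.lam a) = T.lam a := by
  apply (classifiers h).ext₁
  refine Eq.trans ?_ (T.lam_spec a).symm
  rw [sub₂₀_1_classifiers]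
  exact (post_toUnary (l := [a]) (D.lam a) (𝟙 _)).trans (Category.id_comp _)

theorem toUnary_rho (a : D.Obj) : toUnary (D.rho a) = T.rho a :=
  (sub₂₀_2_classifiers h a).symm.trans (T.rho_spec a).symm

theorem toUnary_id (a : D.Obj) : toUnary (𝟙 a) = D.toMulticat.id a := Category.comp_id _

theorem toUnary_comp {a b c : D.Obj} (f : a ⟶ b) (g : b ⟶ c) :
    toUnary (f ≫ g) = D.toMulticat.post (toUnary g) (toUnary f) :=
  ((post_toUnary (l := [a]) g _).trans (Category.assoc _ _ _)).symm

/-- The map of `D` which corresponds to a unary map of its multicategory. -/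
noncomputable def ofUnary {a b : D.Obj} (f : D.toMulticat.Hom [a] b) : a ⟶ b :=
  have := h a
  inv (D.lam a) ≫ (show D.tensor D.unit a ⟶ b from f)

theorem toUnary_ofUnary {a b : D.Obj} (f : D.toMulticat.Hom [a] b) :
    toUnary (ofUnary h f) = f := by
  have := h a
  exact IsIso.hom_inv_id_assoc (D.lam a) _

theorem ofUnary_toUnary {a b : D.Obj} (f : a ⟶ b) : ofUnary h (toUnary f) = f :=
  toUnary_injective h (toUnary_ofUnary h _)

/-- The comparison functor from `D` to the skew monoidal category of its multicategory. -/
def toUnaryFunctor : D.Obj ⥤ T.toSkewMonCat.Obj where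
  obj a := a
  map f := toUnary f
  map_id a := toUnary_id a
  map_comp f g := toUnary_comp f g

/-- The inverse of `toUnaryFunctor`. -/
noncomputable def ofUnaryFunctor : T.toSkewMonCat.Obj ⥤ D.Obj where
  obj a := a
  map f := ofUnary h f
  map_id a := toUnary_injective h ((toUnary_ofUnary h _).trans (toUnary_id _).symm)
  map_comp f g := toUnary_injective h <| (toUnary_ofUnary h _).trans <| Eq.symm <|
    (toUnary_comp _ _).trans <| congrArg₂ (fun p q => D.toMulticat.post q p)
      (toUnary_ofUnary h f) (toUnary_ofUnary h g)

/-- The comparison of `D` with the skew monoidal category of its multicategory. -/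
def toUnaryLax : LaxFunctor D T.toSkewMonCat where
  functor := toUnaryFunctor h T
  f₀ := 𝟙 T.toSkewMonCat.unit
  f₂ a b := 𝟙 (T.toSkewMonCat.tensor a b)
  f₂_naturality p q := comp_id_eq_id_comp (toUnary_tensorHom h T p q).symm
  associativity a b c := strict_associativity T.toSkewMonCat (toUnary_α h T a b c)
  left_unitality a := strict_left_unitality T.toSkewMonCat (toUnary_lam h T a)
  right_unitality a := strict_right_unitality T.toSkewMonCat (toUnary_rho h T a)

/-- The inverse of `toUnaryLax`. -/
noncomputable def ofUnaryLax : LaxFunctor T.toSkewMonCat D where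
  functor := ofUnaryFunctor h T
  f₀ := 𝟙 D.unit
  f₂ a b := 𝟙 (D.tensor a b)
  f₂_naturality p q := comp_id_eq_id_comp <| toUnary_injective h <|
    (toUnary_tensorHom h T _ _).trans <| (congrArg₂ (fun p q => T.tensorHom p q)
      (toUnary_ofUnary h p) (toUnary_ofUnary h q)).trans (toUnary_ofUnary h _).symm
  associativity a b c := strict_associativity D
    ((congrArg (ofUnary h) (toUnary_α h T a b c).symm).trans (ofUnary_toUnary h _))
  left_unitality a := strict_left_unitality D
    ((congrArg (ofUnary h) (toUnary_lam h T a).symm).trans (ofUnary_toUnary h _))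
  right_unitality a := strict_right_unitality D
    ((congrArg (ofUnary h) (toUnary_rho h T a).symm).trans (ofUnary_toUnary h _))

/-- Every left normal skew monoidal category is isomorphic to that of its multicategory. -/
noncomputable def toUnaryIso : D ≅ T.toSkewMonCat where
  hom := toUnaryLax h T
  inv := ofUnaryLax h T
  hom_inv_id := LaxFunctor.ext
    (Functor.hext (fun _ => rfl) fun _ _ f => heq_of_eq (ofUnary_toUnary h f))
    (heq_of_eq ((Category.id_comp _).trans ((ofUnaryFunctor h T).map_id _)))
    (heq_of_eq (funext fun _ => funext fun _ =>
      (Category.id_comp _).trans ((ofUnaryFunctor h T).map_id _)))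
  inv_hom_id := LaxFunctor.ext
    (Functor.hext (fun _ => rfl) fun _ _ f => heq_of_eq (toUnary_ofUnary h f))
    (heq_of_eq ((Category.id_comp _).trans ((toUnaryFunctor h T).map_id _)))
    (heq_of_eq (funext fun _ => funext fun _ =>
      (Category.id_comp _).trans ((toUnaryFunctor h T).map_id _)))

end Comparison

end SkewMonCat

/-! ### Morphisms out of a left representable short multicategory. -/

namespace ShortMulticat

section Lemmas

variable (C : ShortMulticat.{v, u})

/-- Meant for `f` and `f'` classifiers and `k` the tensor product of `p` and `q`: the action on the
variables of `f` is moved, by dinaturality, to the variable in which `f` was substituted. -/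
theorem map₃_sub₂₂_1 {x x' y y' z z' a a' b b' : C.Obj} (p : a' ⟶ a) (q : b' ⟶ b) (r : y' ⟶ y)
    (s : z ⟶ z') (k : x' ⟶ x) (g : C.M₂ x y z) (f : C.M₂ a b x) (f' : C.M₂ a' b' x')
    (h : C.map₂ p q (𝟙 x) f = C.map₂ (𝟙 a') (𝟙 b') k f') :
    C.map₃ p q r s (C.sub₂₂_1 g f) = C.sub₂₂_1 (C.map₂ k r s g) f' := by
  rw [C.sub₂₂_1_nat, h, ← C.sub₂₂_1_dinat, ← C.map₂_split_1]

theorem map₄_sub₃₂_1 {x x' y y' w w' z z' a a' b b' : C.Obj} (p : a' ⟶ a) (q : b' ⟶ b)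
    (r : y' ⟶ y) (t : w' ⟶ w) (s : z ⟶ z') (k : x' ⟶ x) (g : C.M₃ x y w z) (f : C.M₂ a b x)
    (f' : C.M₂ a' b' x') (h : C.map₂ p q (𝟙 x) f = C.map₂ (𝟙 a') (𝟙 b') k f') :
    C.map₄ p q r t s (C.sub₃₂_1 g f) = C.sub₃₂_1 (C.map₃ k r t s g) f' := by
  rw [C.sub₃₂_1_nat, h, ← C.sub₃₂_1_dinat, C.map₃_comp]
  simp only [Category.comp_id, Category.id_comp]

theorem sub₂₂_2_post {x y z a b w m : C.Obj} (g : C.M₂ x y m) (s : m ⟶ z) (k : w ⟶ y)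
    (f : C.M₂ a b w) :
    C.sub₂₂_2 (C.map₂ (𝟙 x) (𝟙 y) s g) (C.map₂ (𝟙 a) (𝟙 b) k f)
      = C.map₃ (𝟙 x) (𝟙 a) (𝟙 b) s (C.sub₂₂_2 (C.map₂ (𝟙 x) k (𝟙 m) g) f) := by
  rw [C.post₂₂_2, ← C.sub₂₂_2_dinat, C.map₂_comp, C.map₂_comp]
  simp only [Category.comp_id, Category.id_comp]

end Lemmas

namespace Classifiers

variable {C : ShortMulticat.{v, u}} (L : C.Classifiers)

/-- The map out of the unit which corresponds to a nullary map. -/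
noncomputable def desc₀ {z : C.Obj} (f : C.M₀ z) : L.unit ⟶ z :=
  ((L.u_univ.bij₀ z).2 f).choose

theorem desc₀_spec {z : C.Obj} (f : C.M₀ z) : C.map₀ (L.desc₀ f) L.u = f :=
  ((L.u_univ.bij₀ z).2 f).choose_spec

/-- The unary map which corresponds to a binary map. -/
noncomputable def desc₂ {a b z : C.Obj} (f : C.M₂ a b z) : L.tensor a b ⟶ z :=
  (((L.θ_univ a b).bij₁ z).2 f).choose

theorem desc₂_spec {a b z : C.Obj} (f : C.M₂ a b z) :
    C.map₂ (𝟙 a) (𝟙 b) (L.desc₂ f) (L.θ a b) = f :=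
  (((L.θ_univ a b).bij₁ z).2 f).choose_spec

/-- The binary map which corresponds to a ternary map. -/
noncomputable def desc₃ {a b c z : C.Obj} (f : C.M₃ a b c z) : C.M₂ (L.tensor a b) c z :=
  (((L.θ_univ a b).bij₂ c z).2 f).choose

theorem desc₃_spec {a b c z : C.Obj} (f : C.M₃ a b c z) :
    C.sub₂₂_1 (L.desc₃ f) (L.θ a b) = f :=
  (((L.θ_univ a b).bij₂ c z).2 f).choose_spec

/-- The ternary map which corresponds to a map of arity `4`. -/
noncomputable def desc₄ {a b c d z : C.Obj} (f : C.M₄ a b c d z) : C.M₃ (L.tensor a b) c d z :=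
  (((L.θ_univ a b).bij₃ c d z).2 f).choose

theorem desc₄_spec {a b c d z : C.Obj} (f : C.M₄ a b c d z) :
    C.sub₃₂_1 (L.desc₄ f) (L.θ a b) = f :=
  (((L.θ_univ a b).bij₃ c d z).2 f).choose_spec

theorem exists₀ {z : C.Obj} (f : C.M₀ z) : ∃ k, f = C.map₀ k L.u := ⟨_, (L.desc₀_spec f).symm⟩

theorem exists₂ {a b z : C.Obj} (f : C.M₂ a b z) : ∃ k, f = C.map₂ (𝟙 a) (𝟙 b) k (L.θ a b) :=
  ⟨_, (L.desc₂_spec f).symm⟩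

theorem exists₃ {a b c z : C.Obj} (f : C.M₃ a b c z) : ∃ g, f = C.sub₂₂_1 g (L.θ a b) :=
  ⟨_, (L.desc₃_spec f).symm⟩

theorem exists₄ {a b c d z : C.Obj} (f : C.M₄ a b c d z) : ∃ g, f = C.sub₃₂_1 g (L.θ a b) :=
  ⟨_, (L.desc₄_spec f).symm⟩

end Classifiers

/-- The images of the classifiers under a morphism of short multicategories: a functor together with
a nullary map and binary maps which are compatible with the skew monoidal structure. -/
structure Extension {C : ShortMulticat.{v, u}} {L : C.Classifiers} (T : L.TensorData)
    (D : ShortMulticat.{v, u}) where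
  functor : C.Obj ⥤ D.Obj
  u : D.M₀ (functor.obj L.unit)
  θ : ∀ a b : C.Obj, D.M₂ (functor.obj a) (functor.obj b) (functor.obj (L.tensor a b))
  nat : ∀ {a a' b b' : C.Obj} (p : a ⟶ a') (q : b ⟶ b'),
    D.map₂ (functor.map p) (functor.map q) (𝟙 _) (θ a' b')
      = D.map₂ (𝟙 _) (𝟙 _) (functor.map (T.tensorHom p q)) (θ a b)
  α : ∀ a b c : C.Obj,
    D.map₃ (𝟙 _) (𝟙 _) (𝟙 _) (functor.map (T.α a b c)) (D.sub₂₂_1 (θ (L.tensor a b) c) (θ a b))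
      = D.sub₂₂_2 (θ a (L.tensor b c)) (θ b c)
  lam : ∀ a : C.Obj, D.sub₂₀_1 (θ L.unit a) u ≫ functor.map (T.lam a) = 𝟙 _
  rho : ∀ a : C.Obj, D.sub₂₀_2 (θ a L.unit) u = functor.map (T.rho a)

namespace Extension

variable {C D : ShortMulticat.{v, u}} {L : C.Classifiers} {T : L.TensorData} (E : Extension T D)

/-- The action on nullary maps. -/
noncomputable def F₀ {z : C.Obj} (f : C.M₀ z) : D.M₀ (E.functor.obj z) :=
  D.map₀ (E.functor.map (L.desc₀ f)) E.u

/-- The action on binary maps. -/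
noncomputable def F₂ {a b z : C.Obj} (f : C.M₂ a b z) :
    D.M₂ (E.functor.obj a) (E.functor.obj b) (E.functor.obj z) :=
  D.map₂ (𝟙 _) (𝟙 _) (E.functor.map (L.desc₂ f)) (E.θ a b)

/-- The action on ternary maps. -/
noncomputable def F₃ {a b c z : C.Obj} (f : C.M₃ a b c z) :
    D.M₃ (E.functor.obj a) (E.functor.obj b) (E.functor.obj c) (E.functor.obj z) :=
  D.sub₂₂_1 (E.F₂ (L.desc₃ f)) (E.θ a b)

/-- The action on maps of arity `4`. -/
noncomputable def F₄ {a b c d z : C.Obj} (f : C.M₄ a b c d z) :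
    D.M₄ (E.functor.obj a) (E.functor.obj b) (E.functor.obj c) (E.functor.obj d)
      (E.functor.obj z) :=
  D.sub₃₂_1 (E.F₃ (L.desc₄ f)) (E.θ a b)

/-- The actions were defined through chosen preimages. Injectivity of the universal bijections makes
this lemma and the next three valid for every presentation of a multimap by a classifier. -/
theorem F₀_u {z : C.Obj} (k : L.unit ⟶ z) :
    E.F₀ (C.map₀ k L.u) = D.map₀ (E.functor.map k) E.u := by
  rw [F₀, L.ext₀ (L.desc₀_spec (C.map₀ k L.u))]

theorem F₂_θ {a b z : C.Obj} (k : L.tensor a b ⟶ z) :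
    E.F₂ (C.map₂ (𝟙 a) (𝟙 b) k (L.θ a b)) = D.map₂ (𝟙 _) (𝟙 _) (E.functor.map k) (E.θ a b) := by
  rw [F₂, L.ext₂ (L.desc₂_spec (C.map₂ (𝟙 a) (𝟙 b) k (L.θ a b)))]

theorem F₃_θ {a b c z : C.Obj} (g : C.M₂ (L.tensor a b) c z) :
    E.F₃ (C.sub₂₂_1 g (L.θ a b)) = D.sub₂₂_1 (E.F₂ g) (E.θ a b) := by
  rw [F₃, ((L.θ_univ a b).bij₂ c z).1 (L.desc₃_spec (C.sub₂₂_1 g (L.θ a b)))]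

theorem F₄_θ {a b c d z : C.Obj} (g : C.M₃ (L.tensor a b) c d z) :
    E.F₄ (C.sub₃₂_1 g (L.θ a b)) = D.sub₃₂_1 (E.F₃ g) (E.θ a b) := by
  rw [F₄, ((L.θ_univ a b).bij₃ c d z).1 (L.desc₄_spec (C.sub₃₂_1 g (L.θ a b)))]

theorem nat₀ {z z' : C.Obj} (s : z ⟶ z') (f : C.M₀ z) :
    E.F₀ (C.map₀ s f) = D.map₀ (E.functor.map s) (E.F₀ f) := by
  obtain ⟨k, rfl⟩ := L.exists₀ f
  rw [C.map₀_comp, F₀_u, F₀_u, D.map₀_comp, E.functor.map_comp]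

/-- With `f` written as `k ∘ θ`, acting by `p` and `q` becomes precomposing `k` with `p ⊗ q`, which
the functor respects; the field `nat` undoes this step in `D`. -/
theorem nat₂ {a a' b b' z z' : C.Obj} (p : a' ⟶ a) (q : b' ⟶ b) (s : z ⟶ z')
    (f : C.M₂ a b z) :
    E.F₂ (C.map₂ p q s f)
      = D.map₂ (E.functor.map p) (E.functor.map q) (E.functor.map s) (E.F₂ f) := by
  obtain ⟨k, rfl⟩ := L.exists₂ f
  rw [← C.map₂_post, ← T.tensorHom_spec', F₂_θ, F₂_θ, ← D.map₂_post, E.functor.map_comp,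
    D.map₂_post, ← E.nat, ← D.map₂_post', Category.id_comp, E.functor.map_comp]

theorem nat₃ {a a' b b' c c' z z' : C.Obj} (p : a' ⟶ a) (q : b' ⟶ b) (r : c' ⟶ c) (s : z ⟶ z')
    (f : C.M₃ a b c z) :
    E.F₃ (C.map₃ p q r s f) = D.map₃ (E.functor.map p) (E.functor.map q) (E.functor.map r)
      (E.functor.map s) (E.F₃ f) := by
  obtain ⟨g, rfl⟩ := L.exists₃ f
  rw [C.map₃_sub₂₂_1 p q r s _ g _ _ (T.tensorHom_spec p q).symm, F₃_θ, F₃_θ, E.nat₂,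
    D.map₃_sub₂₂_1 _ _ _ _ _ _ _ _ (E.nat p q)]

theorem nat₄ {a a' b b' c c' d d' z z' : C.Obj} (p : a' ⟶ a) (q : b' ⟶ b) (r : c' ⟶ c)
    (t : d' ⟶ d) (s : z ⟶ z') (f : C.M₄ a b c d z) :
    E.F₄ (C.map₄ p q r t s f) = D.map₄ (E.functor.map p) (E.functor.map q) (E.functor.map r)
      (E.functor.map t) (E.functor.map s) (E.F₄ f) := by
  obtain ⟨g, rfl⟩ := L.exists₄ f
  rw [C.map₄_sub₃₂_1 p q r t s _ g _ _ (T.tensorHom_spec p q).symm, F₄_θ, F₄_θ, E.nat₃,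
    D.map₄_sub₃₂_1 _ _ _ _ _ _ _ _ _ (E.nat p q)]

theorem comm_sub₂₂_1 {x y z a b : C.Obj} (g : C.M₂ x y z) (f : C.M₂ a b x) :
    E.F₃ (C.sub₂₂_1 g f) = D.sub₂₂_1 (E.F₂ g) (E.F₂ f) := by
  obtain ⟨k, rfl⟩ := L.exists₂ f
  rw [← C.sub₂₂_1_dinat, F₃_θ, nat₂, F₂_θ, ← D.sub₂₂_1_dinat, E.functor.map_id, E.functor.map_id]

theorem comm_sub₃₂_1 {x y w z a b : C.Obj} (g : C.M₃ x y w z) (f : C.M₂ a b x) :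
    E.F₄ (C.sub₃₂_1 g f) = D.sub₃₂_1 (E.F₃ g) (E.F₂ f) := by
  obtain ⟨k, rfl⟩ := L.exists₂ f
  rw [← C.sub₃₂_1_dinat, F₄_θ, nat₃, F₂_θ, ← D.sub₃₂_1_dinat]
  simp only [E.functor.map_id]

theorem F₂_θ_id (a b : C.Obj) : E.F₂ (L.θ a b) = E.θ a b := by
  have h := E.F₂_θ (𝟙 (L.tensor a b))
  rwa [C.map₂_id, E.functor.map_id, D.map₂_id] at h

theorem F₀_u_id : E.F₀ L.u = E.u := by
  have h := E.F₀_u (𝟙 L.unit)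
  rwa [C.map₀_id, E.functor.map_id, D.map₀_id] at h

theorem F₃_post {a b c z z' : C.Obj} (s : z ⟶ z') (f : C.M₃ a b c z) :
    E.F₃ (C.map₃ (𝟙 a) (𝟙 b) (𝟙 c) s f)
      = D.map₃ (𝟙 _) (𝟙 _) (𝟙 _) (E.functor.map s) (E.F₃ f) := by
  rw [E.nat₃, E.functor.map_id, E.functor.map_id, E.functor.map_id]

/-- The only place where compatibility with `α` enters. After unary maps are pulled out of `g` and
`f`, there remains `θ ∘₂ θ`, which is `α ∘ (θ ∘₁ θ)` by `α_spec`; the field `α` says that the same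
holds for the images in `D`. -/
theorem comm_sub₂₂_2 {x y z a b : C.Obj} (g : C.M₂ x y z) (f : C.M₂ a b y) :
    E.F₃ (C.sub₂₂_2 g f) = D.sub₂₂_2 (E.F₂ g) (E.F₂ f) := by
  obtain ⟨s, rfl⟩ := L.exists₂ g
  obtain ⟨k, rfl⟩ := L.exists₂ f
  have n := E.nat (𝟙 x) k
  rw [E.functor.map_id] at n
  rw [F₂_θ, F₂_θ, C.sub₂₂_2_post, D.sub₂₂_2_post, ← T.tensorHom_spec, ← C.post₂₂_2, F₃_post,
    F₃_post, n, ← D.post₂₂_2, ← T.α_spec, F₃_post, comm_sub₂₂_1, F₂_θ_id, F₂_θ_id, E.α]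

/-- Every ternary map has the form `h ∘₁ θ` with `h` binary, so the remaining substitutions that
involve a ternary map are rewritten by the associativity and commutativity axioms into ones already
treated. -/
theorem comm_sub₂₃_1 {x y z a b c : C.Obj} (g : C.M₂ x y z) (f : C.M₃ a b c x) :
    E.F₄ (C.sub₂₃_1 g f) = D.sub₂₃_1 (E.F₂ g) (E.F₃ f) := by
  obtain ⟨h, rfl⟩ := L.exists₃ f
  rw [C.assoc₂_11, comm_sub₃₂_1, comm_sub₂₂_1, comm_sub₂₂_1, D.assoc₂_11]

theorem comm_sub₃₂_2 {x y w z a b : C.Obj} (g : C.M₃ x y w z) (f : C.M₂ a b y) :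
    E.F₄ (C.sub₃₂_2 g f) = D.sub₃₂_2 (E.F₃ g) (E.F₂ f) := by
  obtain ⟨h, rfl⟩ := L.exists₃ g
  rw [← C.assoc₂_12, comm_sub₂₃_1, comm_sub₂₂_1, comm_sub₂₂_2, D.assoc₂_12]

theorem comm_sub₃₂_3 {x y w z a b : C.Obj} (g : C.M₃ x y w z) (f : C.M₂ a b w) :
    E.F₄ (C.sub₃₂_3 g f) = D.sub₃₂_3 (E.F₃ g) (E.F₂ f) := by
  obtain ⟨h, rfl⟩ := L.exists₃ g
  rw [C.comm₂₂, comm_sub₃₂_1, comm_sub₂₂_1, comm_sub₂₂_2, D.comm₂₂]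

theorem comm_sub₂₃_2 {x y z a b c : C.Obj} (g : C.M₂ x y z) (f : C.M₃ a b c y) :
    E.F₄ (C.sub₂₃_2 g f) = D.sub₂₃_2 (E.F₂ g) (E.F₃ f) := by
  obtain ⟨h, rfl⟩ := L.exists₃ f
  rw [C.assoc₂_21, comm_sub₃₂_2, comm_sub₂₂_1, comm_sub₂₂_2, D.assoc₂_21]

theorem lam_sub (T : L.TensorData) (a : C.Obj) :
    T.lam a ≫ C.sub₂₀_1 (L.θ L.unit a) L.u = 𝟙 _ := by
  apply L.ext₁
  rw [← Category.assoc, T.lam_spec, Category.id_comp, Category.comp_id]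

/-- The field `lam` provides a section of the image of `λ`. Since `λ` is invertible in `C` with
inverse `θ ∘₁ u` (`lam_sub`), its image is invertible, and the section must be the image of that
inverse. -/
theorem map_sub₂₀_1_u (a : C.Obj) :
    E.functor.map (C.sub₂₀_1 (L.θ L.unit a) L.u) = D.sub₂₀_1 (E.θ L.unit a) E.u := by
  have h := congrArg (fun k => D.sub₂₀_1 (E.θ L.unit a) E.u ≫ E.functor.map k) (lam_sub T a)
  simp only [E.functor.map_comp, E.functor.map_id, ← Category.assoc, E.lam] at h
  simpa using h

theorem comm_sub₂₀_1 {x y z : C.Obj} (g : C.M₂ x y z) (f : C.M₀ x) :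
    E.functor.map (C.sub₂₀_1 g f) = D.sub₂₀_1 (E.F₂ g) (E.F₀ f) := by
  obtain ⟨k, rfl⟩ := L.exists₀ f
  rw [F₀_u, ← C.sub₂₀_1_dinat, ← D.sub₂₀_1_dinat]
  have n := E.nat₂ k (𝟙 y) (𝟙 z) g
  rw [E.functor.map_id, E.functor.map_id] at n
  rw [← n]
  obtain ⟨s, e⟩ := L.exists₂ (C.map₂ k (𝟙 y) (𝟙 z) g)
  rw [e, ← C.post₂₀_1, F₂_θ, ← D.post₂₀_1, E.functor.map_comp, map_sub₂₀_1_u]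

theorem comm_sub₂₀_2 {x y z : C.Obj} (g : C.M₂ x y z) (f : C.M₀ y) :
    E.functor.map (C.sub₂₀_2 g f) = D.sub₂₀_2 (E.F₂ g) (E.F₀ f) := by
  obtain ⟨k, rfl⟩ := L.exists₀ f
  rw [F₀_u, ← C.sub₂₀_2_dinat, ← D.sub₂₀_2_dinat]
  have n := E.nat₂ (𝟙 x) k (𝟙 z) g
  rw [E.functor.map_id, E.functor.map_id] at n
  rw [← n]
  obtain ⟨s, e⟩ := L.exists₂ (C.map₂ (𝟙 x) k (𝟙 z) g)
  rw [e, ← C.post₂₀_2, F₂_θ, ← D.post₂₀_2, E.functor.map_comp, ← T.rho_spec, E.rho]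

theorem comm_sub₃₀_1 {x y w z : C.Obj} (g : C.M₃ x y w z) (f : C.M₀ x) :
    E.F₂ (C.sub₃₀_1 g f) = D.sub₃₀_1 (E.F₃ g) (E.F₀ f) := by
  obtain ⟨h, rfl⟩ := L.exists₃ g
  rw [← C.assoc₀_11, nat₂, comm_sub₂₀_1, comm_sub₂₂_1, ← D.assoc₀_11, E.functor.map_id,
    E.functor.map_id]

theorem comm_sub₃₀_2 {x y w z : C.Obj} (g : C.M₃ x y w z) (f : C.M₀ y) :
    E.F₂ (C.sub₃₀_2 g f) = D.sub₃₀_2 (E.F₃ g) (E.F₀ f) := by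
  obtain ⟨h, rfl⟩ := L.exists₃ g
  rw [← C.assoc₀_12, nat₂, comm_sub₂₀_2, comm_sub₂₂_1, ← D.assoc₀_12, E.functor.map_id,
    E.functor.map_id]

theorem comm_sub₃₀_3 {x y w z : C.Obj} (g : C.M₃ x y w z) (f : C.M₀ w) :
    E.F₂ (C.sub₃₀_3 g f) = D.sub₃₀_3 (E.F₃ g) (E.F₀ f) := by
  obtain ⟨h, rfl⟩ := L.exists₃ g
  rw [C.comm₂₀, nat₂, comm_sub₂₀_2, comm_sub₂₂_1, D.comm₂₀, E.functor.map_id, E.functor.map_id]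

/-- The morphism of short multicategories with the given values on the classifiers. -/
noncomputable def toMorphism : C ⟶ D :=
  { functor := E.functor
    F₀ := E.F₀
    F₂ := E.F₂
    F₃ := E.F₃
    F₄ := E.F₄
    nat₀ := E.nat₀
    nat₂ := E.nat₂
    nat₃ := E.nat₃
    nat₄ := E.nat₄
    comm_sub₂₂_1 := E.comm_sub₂₂_1
    comm_sub₂₂_2 := E.comm_sub₂₂_2
    comm_sub₃₂_1 := E.comm_sub₃₂_1
    comm_sub₃₂_2 := E.comm_sub₃₂_2
    comm_sub₃₂_3 := E.comm_sub₃₂_3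
    comm_sub₂₃_1 := E.comm_sub₂₃_1
    comm_sub₂₃_2 := E.comm_sub₂₃_2
    comm_sub₂₀_1 := E.comm_sub₂₀_1
    comm_sub₂₀_2 := E.comm_sub₂₀_2
    comm_sub₃₀_1 := E.comm_sub₃₀_1
    comm_sub₃₀_2 := E.comm_sub₃₀_2
    comm_sub₃₀_3 := E.comm_sub₃₀_3 }

/-- Uniqueness of the extension: all multimaps arise from the classifiers by unary actions and by
`∘₁` with some `θ`, and every morphism preserves these operations. -/
theorem toMorphism_eq (F : C ⟶ D) (hf : E.functor = F.functor) (hu : HEq E.u (F.F₀ L.u))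
    (hθ : ∀ a b, HEq (E.θ a b) (F.F₂ (L.θ a b))) : E.toMorphism = F := by
  obtain ⟨φ, u, θ, n, hα, hl, hr⟩ := E
  obtain rfl : φ = F.functor := hf
  obtain rfl : u = F.F₀ L.u := eq_of_heq hu
  obtain rfl : θ = fun a b => F.F₂ (L.θ a b) := funext fun a => funext fun b => eq_of_heq (hθ a b)
  set E : Extension T D := ⟨F.functor, F.F₀ L.u, fun a b => F.F₂ (L.θ a b), n, hα, hl, hr⟩
  have h₂ : ∀ {a b z : C.Obj} (f : C.M₂ a b z), E.F₂ f = F.F₂ f := by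
    intro a b z f
    obtain ⟨k, rfl⟩ := L.exists₂ f
    rw [F₂_θ, F.nat₂, F.functor.map_id, F.functor.map_id]
  have h₃ : ∀ {a b c z : C.Obj} (f : C.M₃ a b c z), E.F₃ f = F.F₃ f := by
    intro a b c z f
    obtain ⟨k, rfl⟩ := L.exists₃ f
    rw [F₃_θ, h₂, F.comm_sub₂₂_1]
  refine Morphism.ext rfl ?_ ?_ ?_ ?_
  · refine heq_of_eq (funext fun z => funext fun f => ?_)
    change E.F₀ f = F.F₀ f
    obtain ⟨k, rfl⟩ := L.exists₀ f
    rw [F₀_u, F.nat₀]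
  · exact heq_of_eq (funext fun a => funext fun b => funext fun z => funext fun f => h₂ f)
  · exact heq_of_eq (funext fun a => funext fun b => funext fun c => funext fun z =>
      funext fun f => h₃ f)
  · refine heq_of_eq (funext fun a => funext fun b => funext fun c => funext fun d =>
      funext fun z => funext fun f => ?_)
    change E.F₄ f = F.F₄ f
    obtain ⟨k, rfl⟩ := L.exists₄ f
    rw [F₄_θ, h₃, F.comm_sub₃₂_1]

end Extension

/-! ### Lax monoidal functors as morphisms of short multicategories; `K` is fully faithful. -/

section LaxFunctor

variable {C D : ShortMulticat.{v, u}} {L : C.Classifiers} {L' : D.Classifiers}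

/-- The extension given by maps `f₀` and `f₂` which satisfy the axioms of a lax monoidal functor. -/
def Extension.ofLax (T : L.TensorData) (T' : L'.TensorData) (F : C.Obj ⥤ D.Obj)
    (f₀ : L'.unit ⟶ F.obj L.unit)
    (f₂ : ∀ a b : C.Obj, L'.tensor (F.obj a) (F.obj b) ⟶ F.obj (L.tensor a b))
    (nat : ∀ {a a' b b' : C.Obj} (p : a ⟶ a') (q : b ⟶ b'),
      T'.tensorHom (F.map p) (F.map q) ≫ f₂ a' b' = f₂ a b ≫ F.map (T.tensorHom p q))
    (assoc : ∀ a b c : C.Obj,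
      T'.tensorHom (f₂ a b) (𝟙 (F.obj c)) ≫ f₂ (L.tensor a b) c ≫ F.map (T.α a b c)
        = T'.α (F.obj a) (F.obj b) (F.obj c)
          ≫ T'.tensorHom (𝟙 (F.obj a)) (f₂ b c) ≫ f₂ a (L.tensor b c))
    (left : ∀ a : C.Obj, T'.tensorHom f₀ (𝟙 (F.obj a)) ≫ f₂ L.unit a ≫ F.map (T.lam a)
      = T'.lam (F.obj a))
    (right : ∀ a : C.Obj, T'.rho (F.obj a) ≫ T'.tensorHom (𝟙 (F.obj a)) f₀ ≫ f₂ a L.unit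
      = F.map (T.rho a)) : Extension T D where
  functor := F
  u := D.map₀ f₀ L'.u
  θ a b := D.map₂ (𝟙 _) (𝟙 _) (f₂ a b) (L'.θ _ _)
  nat {a a' b b'} p q := by
    rw [← D.map₂_post', ← nat, T'.tensorHom_spec', ← D.map₂_post, Category.comp_id]
  -- The left side is brought to the form of a single unary map acting on `θ ∘₁ θ`, where `assoc`
  -- applies; `α_spec` then turns `θ ∘₁ θ` into `θ ∘₂ θ`.
  α a b c := by
    rw [← D.sub₂₂_1_dinat, D.map₂_comp, D.post₂₂_1, D.map₂_comp]
    simp only [Category.comp_id, Category.id_comp]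
    rw [← T'.tensorHom_spec', ← D.post₂₂_1, assoc, D.map₃_post, T'.α_spec, D.post₂₂_2,
      T'.tensorHom_spec', ← D.sub₂₂_2_dinat, D.map₂_comp]
    simp only [Category.comp_id]
  lam a := by
    rw [← D.sub₂₀_1_dinat, D.post₂₀_1, D.map₂_comp, D.map₂_comp]
    simp only [Category.comp_id, Category.id_comp]
    rw [← T'.tensorHom_spec', ← D.post₂₀_1, left, T'.lam_spec]
  rho a := by
    rw [← D.sub₂₀_2_dinat, D.map₂_comp]
    simp only [Category.comp_id]
    rw [← T'.tensorHom_spec', ← D.post₂₀_2, ← T'.rho_spec, right]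

variable (T : L.TensorData) (T' : L'.TensorData)

/-- The morphism of short multicategories which corresponds to a lax monoidal functor. -/
noncomputable def ofLaxFunctor (Φ : SkewMonCat.LaxFunctor T.toSkewMonCat T'.toSkewMonCat) :
    C ⟶ D :=
  (Extension.ofLax T T' Φ.functor Φ.f₀ Φ.f₂ Φ.f₂_naturality Φ.associativity Φ.left_unitality
    Φ.right_unitality).toMorphism

/-- The structure maps of the morphism which corresponds to a lax monoidal functor. -/
def ofLaxFunctorData (Φ : SkewMonCat.LaxFunctor T.toSkewMonCat T'.toSkewMonCat) :
    LaxData L L' (ofLaxFunctor T T' Φ) where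
  f₀ := Φ.f₀
  f₂ := Φ.f₂
  f₀_spec := (Extension.F₀_u_id (Extension.ofLax T T' Φ.functor Φ.f₀ Φ.f₂ Φ.f₂_naturality
    Φ.associativity Φ.left_unitality Φ.right_unitality)).symm
  f₂_spec a b := (Extension.F₂_θ_id (Extension.ofLax T T' Φ.functor Φ.f₀ Φ.f₂ Φ.f₂_naturality
    Φ.associativity Φ.left_unitality Φ.right_unitality) a b).symm

theorem ofLaxFunctor_toLaxFunctor {F : C ⟶ D} (X : LaxData L L' F) :
    ofLaxFunctor T T' (X.toLaxFunctor T T') = F :=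
  Extension.toMorphism_eq _ F rfl (heq_of_eq X.f₀_spec) fun a b => heq_of_eq (X.f₂_spec a b)

theorem toLaxFunctor_eq {F : C ⟶ D} (X Y : LaxData L L' F) :
    X.toLaxFunctor T T' = Y.toLaxFunctor T T' :=
  have h := LaxData.ext' X Y
  SkewMonCat.LaxFunctor.ext rfl (heq_of_eq h.1) (heq_of_eq h.2)

end LaxFunctor

/-- A morphism is rebuilt from its lax monoidal functor by `ofLaxFunctor`. For fullness, the rebuilt
morphism has the prescribed `f₀` and `f₂`, and these are the only structure maps it can have,
however `laxData` chose them. -/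
instance faithful_K (χ : Choice.{v, u}) : (K χ).Faithful where
  map_injective {C D F G} h := by
    apply ObjectProperty.hom_ext
    rw [← ofLaxFunctor_toLaxFunctor (χ C).tensorData (χ D).tensorData
        (laxData (χ C) (χ D) F.hom),
      ← ofLaxFunctor_toLaxFunctor (χ C).tensorData (χ D).tensorData
        (laxData (χ C) (χ D) G.hom)]
    exact congrArg (fun k => ofLaxFunctor _ _ (InducedCategory.Hom.hom k)) h

instance full_K (χ : Choice.{v, u}) : (K χ).Full where
  map_surjective {C D} Φ := by
    refine ⟨ObjectProperty.homMk (ofLaxFunctor (χ C).tensorData (χ D).tensorData Φ.hom), ?_⟩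
    apply ObjectProperty.hom_ext
    exact toLaxFunctor_eq (χ C).tensorData (χ D).tensorData (laxData (χ C) (χ D) _)
      (ofLaxFunctorData (χ C).tensorData (χ D).tensorData Φ.hom)

/-! ### Independence of the choice of classifiers. -/

section Change

variable {C D : ShortMulticat.{v, u}}

/-- The identity morphism, as a lax monoidal functor between the skew monoidal categories given by
two choices of classifiers. -/
noncomputable def changeLax {L L' : C.Classifiers} (T : L.TensorData) (T' : L'.TensorData) :
    T.toSkewMonCat ⟶ T'.toSkewMonCat :=
  (laxData L L' (𝟙 C)).toLaxFunctor T T'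

theorem changeLax_comp_changeLax {L L' : C.Classifiers} (T : L.TensorData) (T' : L'.TensorData) :
    changeLax T T' ≫ changeLax T' T = 𝟙 T.toSkewMonCat := by
  have h := LaxData.ext' ((laxData L L' (𝟙 C)).comp (laxData L' L (𝟙 C))) (idLaxData L)
  exact SkewMonCat.LaxFunctor.ext rfl (heq_of_eq h.1) (heq_of_eq h.2)

/-- The skew monoidal categories given by two choices of classifiers are isomorphic. -/
noncomputable def changeIso {L L' : C.Classifiers} (T : L.TensorData) (T' : L'.TensorData) :
    T.toSkewMonCat ≅ T'.toSkewMonCat where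
  hom := changeLax T T'
  inv := changeLax T' T
  hom_inv_id := changeLax_comp_changeLax T T'
  inv_hom_id := changeLax_comp_changeLax T' T

/-- Both composites lie over the same morphism `F` and between the same classifiers, so their
structure maps agree by uniqueness (`LaxData.ext'`). -/
theorem changeLax_naturality {L₁ L₂ : C.Classifiers} {L₁' L₂' : D.Classifiers} (T₁ : L₁.TensorData)
    (T₂ : L₂.TensorData) (T₁' : L₁'.TensorData) (T₂' : L₂'.TensorData) {F : C ⟶ D}
    (X : LaxData L₁ L₁' F) (Y : LaxData L₂ L₂' F) :
    (show T₁.toSkewMonCat ⟶ T₁'.toSkewMonCat from X.toLaxFunctor T₁ T₁') ≫ changeLax T₁' T₂'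
      = changeLax T₁ T₂ ≫ (show T₂.toSkewMonCat ⟶ T₂'.toSkewMonCat from Y.toLaxFunctor T₂ T₂') := by
  have h := LaxData.ext' (F := F) (X.comp (laxData L₁' L₂' (𝟙 D)))
    ((laxData L₁ L₂ (𝟙 C)).comp Y)
  exact SkewMonCat.LaxFunctor.ext rfl (heq_of_eq h.1) (heq_of_eq h.2)

/-- The specifying equations have unique solutions. `K` and `T` choose their solutions separately,
so this is what turns equal classifiers into equal skew monoidal categories. -/
theorem tensorData_eq {L : C.Classifiers} (T T' : L.TensorData) : T = T' := by
  obtain ⟨t, α, l, r, ht, hα, hl, hr⟩ := T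
  obtain ⟨t', α', l', r', ht', hα', hl', hr'⟩ := T'
  obtain rfl : @t = @t' := by
    funext a a' b b' f g
    exact L.ext₂ ((ht f g).trans (ht' f g).symm)
  obtain rfl : α = α' := by
    funext a b c
    exact L.ext₃ ((hα a b c).trans (hα' a b c).symm)
  obtain rfl : l = l' := by
    funext a
    exact L.ext₁ ((hl a).trans (hl' a).symm)
  obtain rfl : r = r' := by
    funext a
    exact (hr a).trans (hr' a).symm
  rfl

theorem toSkewMonCat_eq {L L' : C.Classifiers} (h : L = L') (T : L.TensorData)
    (T' : L'.TensorData) : T.toSkewMonCat = T'.toSkewMonCat := by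
  subst h
  rw [tensorData_eq T T']

theorem toLaxFunctor_heq {L₁ L₂ : C.Classifiers} {L₁' L₂' : D.Classifiers} (h : L₁ = L₂)
    (h' : L₁' = L₂') (T₁ : L₁.TensorData) (T₂ : L₂.TensorData) (T₁' : L₁'.TensorData)
    (T₂' : L₂'.TensorData) {F : C ⟶ D} (X : LaxData L₁ L₁' F) (Y : LaxData L₂ L₂' F) :
    HEq (X.toLaxFunctor T₁ T₁') (Y.toLaxFunctor T₂ T₂') := by
  subst h h'
  obtain rfl := tensorData_eq T₁ T₂
  obtain rfl := tensorData_eq T₁' T₂'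
  exact heq_of_eq (toLaxFunctor_eq _ _ X Y)

end Change

/-! ### Representable closed short multicategories give closed monoidal categories. -/

section ClosedMonoidal

variable {C : ShortMulticat.{v, u}}

theorem isIso_of_bijective {C : Type u} [Category.{v} C] {a b : C} (k : a ⟶ b)
    (h : ∀ z, Function.Bijective (fun g : b ⟶ z => k ≫ g)) : IsIso k := by
  obtain ⟨g, hg⟩ := (h a).2 (𝟙 a)
  dsimp only at hg
  refine ⟨g, hg, (h b).1 ?_⟩
  change k ≫ g ≫ k = k ≫ 𝟙 b
  rw [← Category.assoc, hg, Category.id_comp, Category.comp_id]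

theorem bijective_of_comp_eq {α β γ : Type v} {f : α → β} {g : β → γ} {h : α → γ}
    (e : ∀ x, g (f x) = h x) (hg : Function.Bijective g) (hh : Function.Bijective h) :
    Function.Bijective f := by
  obtain rfl : g ∘ f = h := funext e
  exact (Function.Bijective.of_comp_iff' hg f).1 hh

theorem IsLeftUniversalNullary.exists_iso {i j : C.Obj} {u : C.M₀ i} {u' : C.M₀ j}
    (hu : C.IsLeftUniversalNullary u) (hu' : C.IsLeftUniversalNullary u') :
    ∃ s : i ≅ j, C.map₀ s.hom u = u' := by
  obtain ⟨s, hs⟩ := (hu.bij₀ j).2 u'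
  obtain ⟨t, ht⟩ := (hu'.bij₀ i).2 u
  dsimp only at hs ht
  refine ⟨⟨s, t, (hu.bij₀ i).1 ?_, (hu'.bij₀ j).1 ?_⟩, hs⟩
  · simp only [← C.map₀_comp, hs, ht, C.map₀_id]
  · simp only [← C.map₀_comp, hs, ht, C.map₀_id]

theorem IsLeftUniversalBinary.exists_iso {a b m n : C.Obj} {θ : C.M₂ a b m} {θ' : C.M₂ a b n}
    (hθ : C.IsLeftUniversalBinary θ) (hθ' : C.IsLeftUniversalBinary θ') :
    ∃ s : m ≅ n, C.map₂ (𝟙 a) (𝟙 b) s.hom θ = θ' := by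
  obtain ⟨s, hs⟩ := (hθ.bij₁ n).2 θ'
  obtain ⟨t, ht⟩ := (hθ'.bij₁ m).2 θ
  dsimp only at hs ht
  refine ⟨⟨s, t, (hθ.bij₁ m).1 ?_, (hθ'.bij₁ n).1 ?_⟩, hs⟩
  · simp only [C.map₂_post, hs, ht, C.map₂_id]
  · simp only [C.map₂_post, hs, ht, C.map₂_id]

/-- Precomposition with an isomorphism in the second variable. -/
theorem bijective_map₂_2 {x m n z : C.Obj} (s : m ≅ n) :
    Function.Bijective (fun f : C.M₂ x n z => C.map₂ (𝟙 x) s.hom (𝟙 z) f) := by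
  refine Function.bijective_iff_has_inverse.2
    ⟨fun f => C.map₂ (𝟙 x) s.inv (𝟙 z) f, fun f => ?_, fun f => ?_⟩ <;>
  simp [C.map₂_comp, C.map₂_id]

variable {L : C.Classifiers}

/-- The chosen `θ` is only known to be left universal. Representability supplies some universal
binary map, and the isomorphism between the two classifying objects carries its universality in the
second variable over to `θ`. -/
theorem bijective_sub₂₂_2_θ (h : isRepresentable C) (a b x z : C.Obj) :
    Function.Bijective (fun f : C.M₂ x (L.tensor a b) z => C.sub₂₂_2 f (L.θ a b)) := by
  obtain ⟨m, θ, hθ⟩ := h.2 a b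
  obtain ⟨s, hs⟩ := hθ.toIsLeftUniversalBinary.exists_iso (L.θ_univ a b)
  rw [← hs]
  simp only [← C.sub₂₂_2_dinat]
  exact (hθ.bij₂_2 x z).comp (bijective_map₂_2 s)

theorem bijective_sub₂₀_2_u (h : isRepresentable C) (x z : C.Obj) :
    Function.Bijective (fun f : C.M₂ x L.unit z => C.sub₂₀_2 f L.u) := by
  obtain ⟨i, u, hu⟩ := h.1
  obtain ⟨s, hs⟩ := hu.toIsLeftUniversalNullary.exists_iso L.u_univ
  rw [← hs]
  simp only [← C.sub₂₀_2_dinat]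
  exact (hu.bij₂_2 x z).comp (bijective_map₂_2 s)

/-- Maps out of `(ab)c` and out of `a(bc)` both classify ternary maps, the latter because `θ b c` is
universal in the second variable, and precomposition with `α` compares the two bijections. For `ρ`,
universality of `u` in the second variable is used in the same way. -/
theorem isMonoidal_toSkewMonCat (T : L.TensorData) (h : isRepresentable C) :
    SkewMonCat.isMonoidal T.toSkewMonCat := by
  refine ⟨fun (a : C.Obj) (b : C.Obj) (c : C.Obj) => isIso_of_bijective (T.α a b c) fun z => ?_,
    T.isLeftNormal_toSkewMonCat, fun (a : C.Obj) => isIso_of_bijective (T.rho a) fun z => ?_⟩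
  · have e₁ : Function.Bijective (fun g : L.tensor (L.tensor a b) c ⟶ z =>
        C.map₃ (𝟙 a) (𝟙 b) (𝟙 c) g (C.sub₂₂_1 (L.θ (L.tensor a b) c) (L.θ a b))) := by
      simp only [C.post₂₂_1]
      exact ((L.θ_univ a b).bij₂ c z).comp ((L.θ_univ (L.tensor a b) c).bij₁ z)
    have e₂ : Function.Bijective (fun g : L.tensor a (L.tensor b c) ⟶ z =>
        C.map₃ (𝟙 a) (𝟙 b) (𝟙 c) g (C.sub₂₂_2 (L.θ a (L.tensor b c)) (L.θ b c))) := by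
      simp only [C.post₂₂_2]
      exact (bijective_sub₂₂_2_θ h b c a z).comp ((L.θ_univ a (L.tensor b c)).bij₁ z)
    refine bijective_of_comp_eq (fun g => ?_) e₁ e₂
    exact (C.map₃_post (T.α a b c) g _).trans (by rw [T.α_spec])
  · have e : Function.Bijective (fun g : L.tensor a L.unit ⟶ z =>
        C.sub₂₀_2 (L.θ a L.unit) L.u ≫ g) := by
      simp only [C.post₂₀_2]
      exact (bijective_sub₂₀_2_u h a z).comp ((L.θ_univ a L.unit).bij₁ z)
    rw [← T.rho_spec] at e
    exact e

/-- Maps `x ⊗ b ⟶ c` correspond to binary maps, and these to maps `x ⟶ [b, c]`. Only the bijection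
for unary maps into `[b, c]` is needed, and naturality in `x` comes from the equation that defines
`f ⊗ 1`. -/
theorem isClosed_toSkewMonCat (T : L.TensorData) (h : isClosed C) :
    SkewMonCat.isClosed T.toSkewMonCat := by
  intro (b : C.Obj)
  choose k e he using fun c => h b c
  let eqv (x c : C.Obj) : (L.tensor x b ⟶ c) ≃ (x ⟶ k c) :=
    (Equiv.ofBijective _ ((L.θ_univ x b).bij₁ c)).trans
      (Equiv.ofBijective _ ((he c).2.1 x)).symm
  have spec (x c : C.Obj) (f : L.tensor x b ⟶ c) : C.map₂ (eqv x c f) (𝟙 b) (𝟙 c) (e c)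
      = C.map₂ (𝟙 x) (𝟙 b) f (L.θ x b) :=
    (Equiv.ofBijective _ ((he c).2.1 x)).apply_symm_apply _
  refine (Adjunction.adjunctionOfEquivRight (F := T.toSkewMonCat.tensorRight b) (G_obj := k) eqv
    fun (x' : C.Obj) (x : C.Obj) (c : C.Obj) (f : x' ⟶ x) (g : L.tensor x b ⟶ c) =>
      ((he c).2.1 x').1 ?_).isLeftAdjoint
  refine (spec x' c _).trans ((T.tensorHom_spec' f (𝟙 b) g).trans (Eq.symm ?_))
  change C.map₂ (f ≫ eqv x c g) (𝟙 b) (𝟙 c) (e c) = _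
  have h' := congrArg (C.map₂ f (𝟙 b) (𝟙 c)) (spec x c g)
  rw [C.map₂_comp, C.map₂_comp] at h'
  simpa only [Category.comp_id] using h'

end ClosedMonoidal

end ShortMulticat

/-! ### Extending a morphism of underlying short multicategories to all arities. -/

namespace Multicat

theorem sub_congr (M : Multicat.{v, u}) {l r as : List M.Obj} {b c : M.Obj}
    {xs xs' ys ys' : List M.Obj} (hx : xs = xs') (hy : ys = ys') (hl : l = xs ++ b :: ys)
    (hr : r = xs ++ (as ++ ys)) (hl' : l = xs' ++ b :: ys') (hr' : r = xs' ++ (as ++ ys'))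
    (g : M.Hom l c) (f : M.Hom as b) : M.sub xs ys hl hr g f = M.sub xs' ys' hl' hr' g f := by
  subst hx hy
  rfl

theorem sub1_2_comm (M : Multicat.{v, u}) {l r xs ys as : List M.Obj} {x y m b c : M.Obj}
    (hl : m :: l = (m :: xs) ++ b :: ys) (hr : m :: r = (m :: xs) ++ (as ++ ys))
    (hl' : x :: y :: l = (x :: y :: xs) ++ b :: ys)
    (hr' : x :: y :: r = (x :: y :: xs) ++ (as ++ ys))
    (g : M.Hom (m :: l) c) (θ : M.Hom [x, y] m) (h : M.Hom as b) :
    M.sub (x :: y :: xs) ys hl' hr' (M.sub1_2 g θ) h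
      = M.sub1_2 (M.sub (m :: xs) ys hl hr g h) θ := by
  obtain rfl := (List.cons.inj hl).2
  obtain rfl := (List.cons.inj hr).2
  exact M.comm [] xs ys rfl rfl rfl rfl rfl rfl rfl rfl g θ h

theorem sub_sub1_2 (M : Multicat.{v, u}) {l m r xs ys zs : List M.Obj} {zs' : List M.Obj} {a b c d e : M.Obj}
    (hl : l = xs ++ e :: ys) (hm : m = xs ++ (c :: zs ++ ys)) (hr : r = xs ++ (a :: b :: zs ++ ys))
    (hzs : zs' = zs ++ ys) (hm' : m = xs ++ c :: zs')
    (hr' : r = xs ++ ([a, b] ++ zs')) (f : M.Hom l d) (g : M.Hom (c :: zs) e)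
    (θ : M.Hom [a, b] c) :
    M.sub xs zs' hm' hr' (M.sub xs ys hl hm f g) θ = M.sub xs ys hl hr f (M.sub1_2 g θ) := by
  subst hl hm hr hzs
  refine (M.sub_congr (List.append_nil xs).symm rfl _ _ ?_ ?_ _ _).trans
    (M.assoc xs ys [] zs rfl rfl rfl ?_ rfl rfl ?_ f g θ).symm
  all_goals simp

section Extension

variable {M N : Multicat.{v, u}} (L : M.Classifiers) (Φ : M.toShort ⟶ N.toShort)

theorem Classifiers.exists_post {l : List M.Obj} {c : M.Obj} (f : M.Hom l c) :
    ∃ s : L.m l ⟶ c, f = M.post s (L.θ l) := ⟨_, (L.desc_spec f).symm⟩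

/-- The map with one variable less which corresponds to a map with at least two variables. -/
noncomputable def Classifiers.descCons {a b c : M.Obj} {l : List M.Obj}
    (f : M.Hom (a :: b :: l) c) : M.Hom (L.m [a, b] :: l) c :=
  ((L.univ [a, b] l (a :: b :: l) rfl c).2 f).choose

theorem Classifiers.descCons_spec {a b c : M.Obj} {l : List M.Obj} (f : M.Hom (a :: b :: l) c) :
    M.sub1_2 (L.descCons f) (L.θ [a, b]) = f :=
  ((L.univ [a, b] l (a :: b :: l) rfl c).2 f).choose_spec

theorem Classifiers.descCons_sub {a b c : M.Obj} {l : List M.Obj} (g : M.Hom (L.m [a, b] :: l) c) :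
    L.descCons (M.sub1_2 g (L.θ [a, b])) = g :=
  (L.univ [a, b] l (a :: b :: l) rfl c).1 (L.descCons_spec _)

theorem Classifiers.exists_sub {a b c : M.Obj} {l : List M.Obj} (f : M.Hom (a :: b :: l) c) :
    ∃ g : M.Hom (L.m [a, b] :: l) c, f = M.sub1_2 g (L.θ [a, b]) :=
  ⟨_, (L.descCons_spec f).symm⟩

/-- The object map of a morphism of underlying short multicategories. -/
def shortObj (a : M.Obj) : N.Obj := Φ.functor.obj a

/-- The action on nullary maps. -/
def shortMap₀ {z : M.Obj} (f : M.Hom [] z) : N.Hom [] (shortObj Φ z) := Φ.F₀ f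

/-- The action on unary maps. -/
def shortMap₁ {a z : M.Obj} (f : a ⟶ z) : shortObj Φ a ⟶ shortObj Φ z := Φ.functor.map f

/-- The action on binary maps. -/
def shortMap₂ {a b z : M.Obj} (f : M.Hom [a, b] z) : N.Hom [shortObj Φ a, shortObj Φ b] (shortObj Φ z) :=
  Φ.F₂ f

/-- The action on ternary maps. -/
def shortMap₃ {a b c z : M.Obj} (f : M.Hom [a, b, c] z) :
    N.Hom [shortObj Φ a, shortObj Φ b, shortObj Φ c] (shortObj Φ z) :=
  Φ.F₃ f

theorem shortMap₁_id (a : M.Obj) : shortMap₁ Φ (𝟙 a) = 𝟙 (shortObj Φ a) := Φ.functor.map_id a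

theorem shortMap₂_map₂ {a a' b b' z z' : M.Obj} (p : a' ⟶ a) (q : b' ⟶ b) (s : z ⟶ z')
    (f : M.Hom [a, b] z) :
    shortMap₂ Φ (M.sub2_1 (M.sub1_1 (M.post s f) p) q)
      = N.sub2_1 (N.sub1_1 (N.post (shortMap₁ Φ s) (shortMap₂ Φ f)) (shortMap₁ Φ p))
          (shortMap₁ Φ q) :=
  Φ.nat₂ p q s f

theorem shortMap₂_post {a b z z' : M.Obj} (s : z ⟶ z') (f : M.Hom [a, b] z) :
    shortMap₂ Φ (M.post s f) = N.post (shortMap₁ Φ s) (shortMap₂ Φ f) := by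
  have h := shortMap₂_map₂ Φ (𝟙 a) (𝟙 b) s f
  simpa only [shortMap₁_id, sub1_1_id, sub2_1_id] using h

theorem shortMap₂_sub1_1 {a a' b z : M.Obj} (p : a' ⟶ a) (f : M.Hom [a, b] z) :
    shortMap₂ Φ (M.sub1_1 f p) = N.sub1_1 (shortMap₂ Φ f) (shortMap₁ Φ p) := by
  have h := shortMap₂_map₂ Φ p (𝟙 b) (𝟙 z) f
  simpa only [shortMap₁_id, post_id, sub2_1_id] using h

theorem shortMap₂_sub2_1 {a b b' z : M.Obj} (q : b' ⟶ b) (f : M.Hom [a, b] z) :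
    shortMap₂ Φ (M.sub2_1 f q) = N.sub2_1 (shortMap₂ Φ f) (shortMap₁ Φ q) := by
  have h := shortMap₂_map₂ Φ (𝟙 a) q (𝟙 z) f
  simpa only [shortMap₁_id, post_id, sub1_1_id] using h

/-- The extension of a morphism of underlying short multicategories to maps with at least one
variable. -/
noncomputable def extendCons : ∀ (l : List M.Obj) (a : M.Obj) {c : M.Obj}, M.Hom (a :: l) c →
    N.Hom (shortObj Φ a :: l.map (shortObj Φ)) (shortObj Φ c)
  | [], _, _, f => shortMap₁ Φ f
  | b :: l, a, _, f => N.sub1_2 (extendCons l (L.m [a, b]) (L.descCons f))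
      (shortMap₂ Φ (L.θ [a, b]))

theorem extendCons_θ {a b c : M.Obj} {l : List M.Obj} (g : M.Hom (L.m [a, b] :: l) c) :
    extendCons L Φ (b :: l) a (M.sub1_2 g (L.θ [a, b]))
      = N.sub1_2 (extendCons L Φ l (L.m [a, b]) g) (shortMap₂ Φ (L.θ [a, b])) := by
  rw [extendCons, L.descCons_sub]

/-- The classifier to be peeled off changes from that of `[a, b]` to that of `[a', b]`. The unary
map `k` that compares them moves into the shorter map by dinaturality, where the induction
hypothesis applies. -/
theorem extendCons_sub1_1 {a a' c : M.Obj} (l : List M.Obj) (g : M.Hom (a :: l) c) (s : a' ⟶ a) :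
    extendCons L Φ l a' (M.sub1_1 g s) = N.sub1_1 (extendCons L Φ l a g) (shortMap₁ Φ s) := by
  induction l generalizing a a' with
  | nil => exact Φ.functor.map_comp s g
  | cons b l ih =>
    obtain ⟨g, rfl⟩ := L.exists_sub g
    obtain ⟨k, hk⟩ := L.exists_post (M.sub1_1 (L.θ [a, b]) s)
    rw [sub1_1_sub1_2, hk, ← sub1_2_dinat, extendCons_θ, extendCons_θ, ih, sub1_2_dinat,
      ← shortMap₂_post, ← hk, shortMap₂_sub1_1]
    exact (sub1_1_sub1_2 _ _ _).symm

theorem extendCons_sub1_2 {a b c d : M.Obj} (l : List M.Obj) (g : M.Hom (c :: l) d)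
    (h : M.Hom [a, b] c) :
    extendCons L Φ (b :: l) a (M.sub1_2 g h)
      = N.sub1_2 (extendCons L Φ l c g) (shortMap₂ Φ h) := by
  obtain ⟨s, rfl⟩ := L.exists_post h
  rw [← sub1_2_dinat, extendCons_θ, extendCons_sub1_1, sub1_2_dinat, shortMap₂_post]

theorem shortMap₃_sub1_2 {a b x y z : M.Obj} (g : M.Hom [x, y] z) (f : M.Hom [a, b] x) :
    shortMap₃ Φ (M.sub1_2 g f) = N.sub1_2 (shortMap₂ Φ g) (shortMap₂ Φ f) :=
  Φ.comm_sub₂₂_1 g f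

theorem extendCons_sub1_3 {a₁ a₂ a₃ c d : M.Obj} (l : List M.Obj) (g : M.Hom (c :: l) d)
    (k : M.Hom [a₁, a₂, a₃] c) :
    extendCons L Φ (a₂ :: a₃ :: l) a₁ (M.sub1_3 g k)
      = N.sub1_3 (extendCons L Φ l c g) (shortMap₃ Φ k) := by
  obtain ⟨k, rfl⟩ := L.exists_sub k
  have e : M.sub1_3 g (M.sub1_2 k (L.θ [a₁, a₂])) = M.sub1_2 (M.sub1_2 g k) (L.θ [a₁, a₂]) :=
    M.assoc [] l [] [a₃] rfl rfl rfl rfl rfl rfl rfl g k _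
  rw [e, extendCons_θ, extendCons_sub1_2, shortMap₃_sub1_2]
  exact (N.assoc [] (l.map (shortObj Φ)) [] [shortObj Φ a₃] rfl rfl rfl rfl rfl rfl rfl _ _ _).symm

/-- The extension of a morphism of underlying short multicategories to all maps. -/
noncomputable def extend : ∀ {l : List M.Obj} {c : M.Obj}, M.Hom l c →
    N.Hom (l.map (shortObj Φ)) (shortObj Φ c)
  | [], _, f => shortMap₀ Φ f
  | a :: l, _, f => extendCons L Φ l a f

theorem extend_sub1_0 {a c : M.Obj} (l : List M.Obj) (g : M.Hom (a :: l) c) (h : M.Hom [] a) :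
    extend L Φ (M.sub1_0 g h) = N.sub1_0 (extendCons L Φ l a g) (shortMap₀ Φ h) := by
  cases l with
  | nil => exact Φ.nat₀ g h
  | cons b l =>
    obtain ⟨g, rfl⟩ := L.exists_sub g
    have e : M.sub1_0 (M.sub1_2 g (L.θ [a, b])) h = M.sub1_1 g (M.sub1_0 (L.θ [a, b]) h) :=
      (M.assoc [] l [] [b] rfl rfl rfl rfl rfl rfl rfl g _ h).symm
    have e' : shortMap₁ Φ (M.sub1_0 (L.θ [a, b]) h)
        = N.sub1_0 (shortMap₂ Φ (L.θ [a, b])) (shortMap₀ Φ h) := Φ.comm_sub₂₀_1 _ _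
    rw [e]
    refine (extendCons_sub1_1 L Φ l g _).trans ?_
    rw [e', extendCons_θ]
    exact N.assoc [] (l.map (shortObj Φ)) [] [shortObj Φ b] rfl rfl rfl rfl rfl rfl rfl _ _ _

/-- The extension preserves substitution of `h` in every variable. -/
def PreservesSub {as : List M.Obj} {b : M.Obj} (h : M.Hom as b) : Prop :=
  ∀ {l r : List M.Obj} {c : M.Obj} (xs ys : List M.Obj) (hl : l = xs ++ b :: ys)
    (hr : r = xs ++ (as ++ ys))
    (hl' : l.map (shortObj Φ) = xs.map (shortObj Φ) ++ shortObj Φ b :: ys.map (shortObj Φ))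
    (hr' : r.map (shortObj Φ) = xs.map (shortObj Φ) ++ (as.map (shortObj Φ) ++ ys.map (shortObj Φ)))
    (g : M.Hom l c),
    extend L Φ (M.sub xs ys hl hr g h) = N.sub _ _ hl' hr' (extend L Φ g) (extend L Φ h)

variable {L Φ}

/-- For a variable in the third position or later, the classifier of the first two variables can be
peeled off `g`: it commutes with the substitution, and the position drops by one. -/
theorem preservesSub_of_le_two {as : List M.Obj} {b : M.Obj} {h : M.Hom as b}
    (h₁ : ∀ {c : M.Obj} (ys : List M.Obj) (hr' : (as ++ ys).map (shortObj Φ)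
        = as.map (shortObj Φ) ++ ys.map (shortObj Φ)) (g : M.Hom (b :: ys) c),
      extend L Φ (M.sub [] ys rfl rfl g h)
        = N.sub [] _ rfl hr' (extend L Φ g) (extend L Φ h))
    (h₂ : ∀ {c : M.Obj} (x : M.Obj) (ys : List M.Obj) (hr' : (x :: (as ++ ys)).map (shortObj Φ)
        = [shortObj Φ x] ++ (as.map (shortObj Φ) ++ ys.map (shortObj Φ)))
        (g : M.Hom (x :: b :: ys) c),
      extend L Φ (M.sub [x] ys rfl rfl g h)
        = N.sub [shortObj Φ x] _ rfl hr' (extend L Φ g) (extend L Φ h)) :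
    PreservesSub L Φ h := by
  intro l r c xs ys hl hr hl' hr' g
  cases xs with
  | nil =>
    subst hl hr
    exact h₁ ys hr' g
  | cons x xs =>
    induction xs generalizing x l r with
    | nil =>
      subst hl hr
      exact h₂ x ys hr' g
    | cons y xs ih =>
      subst hl hr
      obtain ⟨g, rfl⟩ := L.exists_sub g
      have e : M.sub (x :: y :: xs) ys rfl rfl (M.sub1_2 g (L.θ [x, y])) h
          = M.sub1_2 (M.sub (L.m [x, y] :: xs) ys rfl rfl g h) (L.θ [x, y]) :=
        M.comm [] xs ys rfl rfl rfl rfl rfl rfl rfl rfl g (L.θ [x, y]) h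
      rw [e]
      refine (extendCons_θ L Φ (M.sub (L.m [x, y] :: xs) ys rfl rfl g h)).trans ?_
      have i := ih (l := L.m [x, y] :: (xs ++ b :: ys)) (r := L.m [x, y] :: (xs ++ (as ++ ys)))
        g (L.m [x, y]) rfl rfl (by simp) (by simp)
      refine (congrArg (fun k => N.sub1_2 (ys := (xs ++ (as ++ ys)).map (shortObj Φ)) k
        (shortMap₂ Φ (L.θ [x, y]))) i).trans ?_
      refine Eq.trans ?_ (congrArg (fun k => N.sub _ _ hl' hr' k (extend L Φ h))
        (extendCons_θ L Φ g).symm)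
      exact (N.sub1_2_comm (by simp) (by simp) hl' hr' _ _ _).symm

theorem extend_binary {a b c : M.Obj} (f : M.Hom [a, b] c) : extend L Φ f = shortMap₂ Φ f := by
  have h := extendCons_sub1_2 L Φ [] (𝟙 c) f
  have e : M.sub1_2 (ys := []) (𝟙 c) f = f := M.post_id f
  rw [e] at h
  refine h.trans ?_
  refine (congrArg (fun k => N.sub1_2 (ys := []) k (shortMap₂ Φ f)) (shortMap₁_id Φ c)).trans ?_
  exact N.post_id (shortMap₂ Φ f)

/-- By associativity, substituting `g ∘₁ θ` is substituting `g` and then `θ` in the resulting map.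
This is why maps of small arity suffice. -/
theorem preservesSub_sub {a b c : M.Obj} {l : List M.Obj} {g : M.Hom (L.m [a, b] :: l) c}
    (hg : PreservesSub L Φ g) (hθ : PreservesSub L Φ (L.θ [a, b])) :
    PreservesSub L Φ (M.sub1_2 g (L.θ [a, b])) := by
  intro m r d xs ys hl hr hl' hr' f
  subst hl hr
  have e : extend L Φ (M.sub1_2 g (L.θ [a, b]))
      = N.sub1_2 (ys := l.map (shortObj Φ)) (extend L Φ g) (extend L Φ (L.θ [a, b])) := by
    rw [extend_binary]
    exact extendCons_θ L Φ g
  have e' : M.sub xs ys rfl rfl f (M.sub1_2 g (L.θ [a, b]))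
      = M.sub xs (l ++ ys) rfl rfl (M.sub xs ys rfl rfl f g) (L.θ [a, b]) :=
    (M.sub_sub1_2 (zs := l) rfl rfl rfl rfl rfl rfl f g (L.θ [a, b])).symm
  rw [e, e', hθ xs (l ++ ys) _ _ (by simp) (by simp), hg xs ys _ _ (by simp) (by simp)]
  exact N.sub_sub1_2 _ _ hr' (by simp) _ _ _ _ _

/-- Here and in the next two lemmas, a substitution in the second position is `(g ∘₁ θ) ∘₂ h = g ∘₁
(θ ∘₂ h)`. As `h` has arity at most 2, the map `θ ∘₂ h` has arity at most 3 and is handled by the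
given morphism, and what remains is a substitution in the first position. -/
theorem preservesSub_nullary {b : M.Obj} (h : M.Hom [] b) : PreservesSub L Φ h :=
  preservesSub_of_le_two (fun ys _ g => extend_sub1_0 L Φ ys g h) fun x ys _ g => by
    obtain ⟨g, rfl⟩ := L.exists_sub g
    have e : M.sub [x] ys rfl rfl (M.sub1_2 g (L.θ [x, b])) h
        = M.sub1_1 g (M.sub2_0 (L.θ [x, b]) h) :=
      (M.assoc [] ys [x] [] rfl rfl rfl rfl rfl rfl rfl g _ h).symm
    have e' : shortMap₁ Φ (M.sub2_0 (L.θ [x, b]) h)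
        = N.sub2_0 (shortMap₂ Φ (L.θ [x, b])) (shortMap₀ Φ h) := Φ.comm_sub₂₀_2 _ _
    rw [e]
    refine (extendCons_sub1_1 L Φ ys g _).trans ?_
    rw [e']
    refine Eq.trans ?_ (congrArg (fun k => N.sub2_0 k (shortMap₀ Φ h))
      (extendCons_θ L Φ g).symm)
    exact N.assoc [] (ys.map (shortObj Φ)) [shortObj Φ x] [] rfl rfl rfl rfl rfl rfl rfl _ _ _

theorem preservesSub_unary {a b : M.Obj} (h : M.Hom [a] b) : PreservesSub L Φ h :=
  preservesSub_of_le_two (as := [a]) (h := h) (fun ys _ g => extendCons_sub1_1 L Φ ys g h) fun x ys _ g => by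
    obtain ⟨g, rfl⟩ := L.exists_sub g
    have e : M.sub [x] ys rfl rfl (M.sub1_2 g (L.θ [x, b])) h
        = M.sub1_2 g (M.sub2_1 (L.θ [x, b]) h) :=
      (M.assoc [] ys [x] [] rfl rfl rfl rfl rfl rfl rfl g _ h).symm
    rw [e]
    refine (extendCons_sub1_2 L Φ ys g _).trans ?_
    rw [shortMap₂_sub2_1]
    refine Eq.trans ?_ (congrArg (fun k => N.sub2_1 k (shortMap₁ Φ h))
      (extendCons_θ L Φ g).symm)
    exact N.assoc [] (ys.map (shortObj Φ)) [shortObj Φ x] [] rfl rfl rfl rfl rfl rfl rfl _ _ _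

theorem preservesSub_binary {a a' b : M.Obj} (h : M.Hom [a, a'] b) : PreservesSub L Φ h :=
  preservesSub_of_le_two
    (fun ys _ g => by
      rw [extend_binary]
      exact extendCons_sub1_2 L Φ ys g h)
    fun x ys _ g => by
      obtain ⟨g, rfl⟩ := L.exists_sub g
      have e : M.sub [x] ys rfl rfl (M.sub1_2 g (L.θ [x, b])) h
          = M.sub1_3 g (M.sub2_2 (L.θ [x, b]) h) :=
        (M.assoc [] ys [x] [] rfl rfl rfl rfl rfl rfl rfl g _ h).symm
      have e' : shortMap₃ Φ (M.sub2_2 (L.θ [x, b]) h)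
          = N.sub2_2 (shortMap₂ Φ (L.θ [x, b])) (shortMap₂ Φ h) := Φ.comm_sub₂₂_2 _ _
      rw [e, extend_binary]
      refine (extendCons_sub1_3 L Φ ys g _).trans ?_
      rw [e']
      refine Eq.trans ?_ (congrArg (fun k => N.sub2_2 k (shortMap₂ Φ h))
        (extendCons_θ L Φ g).symm)
      exact N.assoc [] (ys.map (shortObj Φ)) [shortObj Φ x] [] rfl rfl rfl rfl rfl rfl rfl _ _ _

theorem preservesSub_cons (as : List M.Obj) (a : M.Obj) {b : M.Obj} (h : M.Hom (a :: as) b) :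
    PreservesSub L Φ h := by
  induction as generalizing a with
  | nil => exact preservesSub_unary h
  | cons c as ih =>
    obtain ⟨h, rfl⟩ := L.exists_sub h
    exact preservesSub_sub (ih _ h) (preservesSub_binary _)

theorem preservesSub : ∀ {as : List M.Obj} {b : M.Obj} (h : M.Hom as b), PreservesSub L Φ h
  | [], _, h => preservesSub_nullary h
  | a :: as, _, h => preservesSub_cons as a h

variable (L Φ)

/-- The multifunctor which extends a morphism of underlying short multicategories. -/
noncomputable def extension : M ⟶ N :=
  { obj := shortObj Φ
    map := fun h f => N.cast h (extend L Φ f)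
    map_id := fun a => Φ.functor.map_id a
    map_sub := by
      intro l r as l' r' as' b c xs ys xs' ys' hl hr el er eas ex ey hl' hr' g f
      subst el er eas ex ey
      exact preservesSub f xs ys hl hr hl' hr' g }

theorem extend_ternary {a b c d : M.Obj} (f : M.Hom [a, b, c] d) :
    extend L Φ f = shortMap₃ Φ f := by
  obtain ⟨g, rfl⟩ := L.exists_sub f
  refine (extendCons_θ L Φ g).trans ?_
  rw [shortMap₃_sub1_2]
  exact congrArg (fun k => N.sub1_2 k _) (extend_binary (L := L) (Φ := Φ) g)

/-- On objects and on nullary and unary maps the extension is `Φ` by definition. In arities 2 to 4 a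
classifier is peeled off, and `Φ` respects `∘₁` with it. -/
theorem U_map_extension : U.map (extension L Φ) = Φ := by
  refine ShortMulticat.Morphism.ext rfl HEq.rfl ?_ ?_ ?_
  · exact heq_of_eq (funext fun a => funext fun b => funext fun z => funext fun f =>
      extend_binary f)
  · exact heq_of_eq (funext fun a => funext fun b => funext fun c => funext fun z =>
      funext fun f => extend_ternary L Φ f)
  · refine heq_of_eq (funext fun a => funext fun b => funext fun c => funext fun d =>
      funext fun z => funext fun f => ?_)
    obtain ⟨g, rfl⟩ := L.exists_sub f
    refine (extendCons_θ L Φ g).trans ?_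
    refine Eq.trans ?_ (Φ.comm_sub₃₂_1 g (L.θ [a, b])).symm
    exact congrArg (fun k => N.sub1_2 k _) (extend_ternary L Φ g)

theorem extension_U_map (F : M ⟶ N) : extension L (U.map F) = F := by
  have key : ∀ (l : List M.Obj) (a : M.Obj) {c : M.Obj} (f : M.Hom (a :: l) c),
      extendCons L (U.map F) l a f = F.map rfl f := by
    intro l
    induction l with
    | nil => intros; rfl
    | cons b l ih =>
      intro a c f
      obtain ⟨g, rfl⟩ := L.exists_sub f
      refine (extendCons_θ L (U.map F) g).trans ?_
      refine (congrArg (fun k => N.sub1_2 k _) (ih _ g)).trans ?_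
      exact (F.map_sub [] l [] (l.map F.obj) rfl rfl rfl rfl rfl rfl rfl rfl rfl g _).symm
  refine Multifunctor.ext rfl (heq_of_eq ?_)
  funext l l' c h f
  subst h
  cases l with
  | nil => rfl
  | cons a l => exact key l a f

end Extension

/-- The classifiers of `M` break every multimap of `M` into small pieces, and the images of the
pieces are recombined by substitution in `N`; hence nothing is asked of `N`. -/
theorem U_map_bijective {M : Multicat.{v, u}} (h : isLeftRepresentable M) (N : Multicat.{v, u}) :
    Function.Bijective (fun F : M ⟶ N => U.map F) := by
  obtain ⟨L⟩ := nonempty_classifiers h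
  exact Function.bijective_iff_has_inverse.2 ⟨extension L, extension_U_map L, U_map_extension L⟩

end Multicat

namespace CategoryTheory.ObjectProperty

theorem homMk_heq {C : Type*} [Category C] {P : ObjectProperty C} {X X' Y Y' : P.FullSubcategory}
    (hX : X.obj = X'.obj) (hY : Y.obj = Y'.obj) {f : X.obj ⟶ Y.obj} {f' : X'.obj ⟶ Y'.obj}
    (h : HEq f f') : HEq (homMk f) (homMk f') := by
  obtain rfl := FullSubcategory.ext hX
  obtain rfl := FullSubcategory.ext hY
  obtain rfl := eq_of_heq h
  rfl

end CategoryTheory.ObjectProperty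

/-! ### `K` and its restriction are equivalences. -/

namespace ShortMulticat

variable (χ : Choice.{v, u})

/-- A left normal skew monoidal category is isomorphic to the one obtained from the classifiers
chosen for its underlying short multicategory. -/
noncomputable def Choice.iso {D : SkewMonCat.{v, u}} (h : SkewMonCat.isLeftNormal D)
    (h' : isLeftRepresentable D.toMulticat.toShort) :
    (χ ⟨D.toMulticat.toShort, h'⟩).tensorData.toSkewMonCat ≅ D :=
  changeIso _ (SkewMonCat.classifiers h).tensorData ≪≫ (SkewMonCat.toUnaryIso h _).symm

theorem isClosedMonoidal_K (C : ShortMultiRepCl.{v, u}) :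
    SkewMonCat.isClosedMonoidal ((K χ).obj (shortMultiIncl.obj C)).obj :=
  ⟨isMonoidal_toSkewMonCat _ C.property.1, isClosed_toSkewMonCat _ C.property.2⟩

instance essSurj_K : (K χ).EssSurj where
  mem_essImage D :=
    ⟨⟨D.obj.toMulticat.toShort, ⟨_, _, (SkewMonCat.classifiers D.property).u_univ⟩, fun a b =>
        ⟨_, _, (SkewMonCat.classifiers D.property).θ_univ a b⟩⟩,
      ⟨SkewMonCat.isLeftNormal.isoMk (Choice.iso χ D.property _)⟩⟩

instance isEquivalence_K : (K χ).IsEquivalence where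

variable (hK : ∀ C : ShortMultiRepCl.{v, u},
  SkewMonCat.isClosedMonoidal ((K χ).obj (shortMultiIncl.obj C)).obj)

instance faithful_KRepCl : (KRepCl χ hK).Faithful := by
  unfold KRepCl
  infer_instance

instance full_KRepCl : (KRepCl χ hK).Full := by
  unfold KRepCl
  infer_instance

instance essSurj_KRepCl : (KRepCl χ hK).EssSurj where
  mem_essImage D :=
    ⟨⟨D.obj.toMulticat.toShort, Multicat.isClosedRepresentable_toShort
        (SkewMonCat.isClosedRepresentable_toMulticat D.property)⟩,
      ⟨SkewMonCat.isClosedMonoidal.isoMk (Choice.iso χ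
        (SkewMonCat.isClosedMonoidal_le _ D.property) _)⟩⟩

instance isEquivalence_KRepCl : (KRepCl χ hK).IsEquivalence where

end ShortMulticat

/-! ### The restrictions of `U` and `T`, and the triangle. -/

namespace Multicat

variable (χ : ShortMulticat.Choice.{v, u}) (κ : Choice.{v, u})
  (hK : ∀ C : ShortMultiRepCl.{v, u},
    SkewMonCat.isClosedMonoidal ((ShortMulticat.K χ).obj (shortMultiIncl.obj C)).obj)
  (hU : ∀ M : MultiRepCl.{v, u}, ShortMulticat.isClosedRepresentable (U.obj M.obj))
  (hT : ∀ M : MultiRepCl.{v, u},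
    SkewMonCat.isClosedMonoidal ((T κ).obj (multiIncl.obj M)).obj)

theorem isClosedRepresentable_U (M : MultiRepCl.{v, u}) :
    ShortMulticat.isClosedRepresentable (U.obj M.obj) :=
  isClosedRepresentable_toShort M.property

theorem isClosedMonoidal_T (M : MultiRepCl.{v, u}) :
    SkewMonCat.isClosedMonoidal ((T κ).obj (multiIncl.obj M)).obj :=
  have h := isClosedRepresentable_U M
  ⟨ShortMulticat.isMonoidal_toSkewMonCat _ h.1, ShortMulticat.isClosed_toSkewMonCat _ h.2⟩

theorem URepCl_map_bijective (M N : MultiRepCl.{v, u}) :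
    Function.Bijective (fun F : M ⟶ N => (URepCl hU).map F) := by
  have h := U_map_bijective (isClosedRepresentable_le _ M.property) N.obj
  refine ⟨fun F G e => ?_, fun G => ?_⟩
  · exact ObjectProperty.hom_ext _ (h.1 (congrArg (fun k => k.hom) e))
  · obtain ⟨F, hF⟩ := h.2 G.hom
    exact ⟨ObjectProperty.homMk F, ObjectProperty.hom_ext _ hF⟩

instance faithful_URepCl : (URepCl hU).Faithful where
  map_injective e := (URepCl_map_bijective hU _ _).1 e

instance full_URepCl : (URepCl hU).Full where
  map_surjective := (URepCl_map_bijective hU _ _).2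

instance essSurj_URepCl : (URepCl hU).EssSurj where
  mem_essImage C := by
    let χ : ShortMulticat.Choice.{v, u} := fun C =>
      (ShortMulticat.nonempty_classifiers C.property).some
    let K := KRepCl χ (ShortMulticat.isClosedMonoidal_K χ)
    have h := (K.obj C).property
    refine ⟨⟨(K.obj C).obj.toMulticat, SkewMonCat.isClosedRepresentable_toMulticat h⟩,
      -- With `D` the image of the given object under `K`, the short multicategory underlying
      -- `D.toMulticat` is also sent by `K` to a copy of `D`. As `K` is fully faithful, it is
      -- isomorphic to the given object.
      ⟨K.preimageIso ?_⟩⟩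
    exact SkewMonCat.isClosedMonoidal.isoMk (ShortMulticat.Choice.iso χ
      (SkewMonCat.isClosedMonoidal_le _ h) _)

instance isEquivalence_URepCl : (URepCl hU).IsEquivalence where

/-- The comparison between the two functors to closed monoidal categories. -/
noncomputable def compIso : URepCl hU ⋙ KRepCl χ hK ≅ TRepCl κ hT :=
  NatIso.ofComponents
    (fun M => SkewMonCat.isClosedMonoidal.isoMk (ShortMulticat.changeIso
      (χ (shortMultiIncl.obj ((URepCl hU).obj M))).tensorData (κ (multiIncl.obj M)).tensorData))
    fun {M N} F => ObjectProperty.hom_ext _ (ShortMulticat.changeLax_naturality _ _ _ _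
      (ShortMulticat.laxData _ _ (U.map F.hom)) (laxData _ _ F.hom))

theorem comp_eq (h : ∀ M : MultiRepCl.{v, u},
      χ (shortMultiIncl.obj ((URepCl hU).obj M)) = (κ (multiIncl.obj M)).toShort) :
    URepCl hU ⋙ KRepCl χ hK = TRepCl κ hT := by
  have e (M : MultiRepCl.{v, u}) := ShortMulticat.toSkewMonCat_eq (h M)
    (χ (shortMultiIncl.obj ((URepCl hU).obj M))).tensorData (κ (multiIncl.obj M)).tensorData
  exact CategoryTheory.Functor.hext (fun M => ObjectProperty.FullSubcategory.ext (e M))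
    fun M N F => ObjectProperty.homMk_heq (e M) (e N) (ShortMulticat.toLaxFunctor_heq (h M) (h N)
      _ _ _ _ (ShortMulticat.laxData _ _ (U.map F.hom)) (laxData _ _ F.hom))

end Multicat

theorem mainTheorem4 (χ : ShortMulticat.Choice.{v, u}) (κ : Multicat.Choice.{v, u}) :
    (ShortMulticat.K χ).IsEquivalence ∧
    ∃ (hK : ∀ C : ShortMultiRepCl.{v, u},
        SkewMonCat.isClosedMonoidal ((ShortMulticat.K χ).obj (shortMultiIncl.obj C)).obj)
      (hU : ∀ M : MultiRepCl.{v, u}, ShortMulticat.isClosedRepresentable (Multicat.U.obj M.obj))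
      (hT : ∀ M : MultiRepCl.{v, u},
        SkewMonCat.isClosedMonoidal ((Multicat.T κ).obj (multiIncl.obj M)).obj),
      (KRepCl χ hK).IsEquivalence ∧ (URepCl hU).IsEquivalence ∧ (TRepCl κ hT).IsEquivalence ∧
      (∃ e : URepCl hU ⋙ KRepCl χ hK ≅ TRepCl κ hT,
        ∀ M : MultiRepCl.{v, u}, (e.hom.app M).hom.functor = 𝟭 M.obj.Obj) ∧
      ((∀ M : MultiRepCl.{v, u},
          χ (shortMultiIncl.obj ((URepCl hU).obj M)) = (κ (multiIncl.obj M)).toShort) →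
        URepCl hU ⋙ KRepCl χ hK = TRepCl κ hT) := by
  refine ⟨inferInstance, ShortMulticat.isClosedMonoidal_K χ,
    Multicat.isClosedRepresentable_U, Multicat.isClosedMonoidal_T κ,
    -- The components of `compIso` are lax structures on the identity morphism, so their underlying
    -- functors are identities by definition.
    inferInstance, inferInstance, ?_, ⟨Multicat.compIso χ κ _ _ _, fun _ => rfl⟩,
    Multicat.comp_eq χ κ _ _ _⟩
  -- The restriction of `T` is isomorphic to a composite of two equivalences; any choice `χ` would
  -- serve here.
  exact Functor.isEquivalence_of_iso (Multicat.compIso χ κ (ShortMulticat.isClosedMonoidal_K χ)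
    Multicat.isClosedRepresentable_U _)
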